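/- Let $f:[0,\infty)\to(0,\infty)$ be continuous, convex, vanishing at $+\infty$ and three times differentiable on $(0,\infty)$ (the right derivative at $0$ may be $-\infty$). For $x$ large let $x_t=x_t(x)\in(0,x)$ be the unique solution of $\frac{f(x)+f(x_t)}{x-x_t}=-f'(x_t)$. Assume that, as $x\to+\infty$, (A1) $f''(x)\to 0$; (A2) $|f'(x_t)|\le C|f'(x)|$ for some constant $C$ and all large $x$; (A3) $f(x)f''(x)/f'(x)^2$ is bounded away from $0$; (A4) $f''>0$ on $(0,\infty)$ and $|f'''(x)|/f''(x)$ is bounded for large $x$. Consider the billiard in $Q=\{x\ge 0,\ 0\le y\le f(x)\}$ and the return map $T$ to the dispersing wall $\{y=f(x)\}$. Its phase space is $\mathcal M=(0,\infty)\times(0,\pi)\ni(r,\varphi)$, where $r$ is arc length along the wall measured from the vertex $V=(0,f(0))$ and $\varphi$ is the angle between $\partial/\partial r$ and the outgoing velocity. Let $\mathrm{Leb}$ be the Lebesgue measure on $\mathcal M$ and $d\mu=\sin\varphi\,dr\,d\varphi$. Unfold $Q$ to $Q_4=\{|y|\le f(|x|)\}$, so that trajectories between collisions with the wall are straight segments,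 and put: - $F^{0+}=[0,\infty)\times\{\pi\}$; - $F^{1+}$: the set of elements of $\mathcal M$ whose next collision in $Q_4$ is tangential and in the quadrant $\{x<0<y\}$ (a tangency to the wall after a rebound on the vertical side); - $F^{2+}$: the set of elements of $\mathcal M$ whose next collision in $Q_4$ has $y<0$, $x\ge 0$ and either is at the vertex $(0,-f(0))$ or is tangential (after a rebound on the horizontal side); - $F^{i-}$: the image of $F^{i+}$ under $(r,\varphi)\mapsto(r,\pi-\varphi)$; $F^\pm=F^{1\pm}\cup F^{2\pm}$. For $\zeta\in\mathcal M\setminus F^-$ let $\mathcal C_1(\zeta)=DT_{T^{-1}\zeta}\{(dr,d\varphi): dr\,d\varphi\le 0\}$. An unstable curve from $\zeta$ to $w$ is a continuous $\gamma:[0,1]\to\mathbb R^2$ with $\gamma(0)=\zeta$, $\gamma(1)=w$ which on $(0,1)$ takes values in $\mathcal M$, is differentiable, and satisfies $\gamma'(t)\in\mathcal C_1(\gamma(t))$ whenever $\gamma(t)\notin F^-$. The unstable distance $d^u(\zeta,w)$ is the infimum of the Euclidean lengths of the unstable curves from $\zeta$ to $w$ ($+\infty$ if there is none), $d^u(\zeta,A)=\inf_{w\in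 A}d^u(\zeta,w)$, and $A_{[\varepsilon]}=\{\zeta\in\mathcal M: d^u(\zeta,A)\le\varepsilon\}$. Then for $i=0,1,2$ and each choice of sign there are $C,\varepsilon_0>0$ such that for all $0<\varepsilon\le\varepsilon_0$ $$\mu\big(F^{i\pm}_{[\varepsilon]}\big)\le \mathrm{Leb}\big(F^{i\pm}_{[\varepsilon]}\big)\le C\varepsilon .$$ Moreover each $F^{i\pm}$ has infinite length (its one-dimensional Hausdorff measure is $+\infty$). -/

import Mathlib

open Set Filter Topology MeasureTheory Asymptotics
open scoped ENNReal

namespace CuspBilliard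

noncomputable section

/-! ### The table and the assumptions on its profile -/

/-- Standing assumptions on `f : [0, ∞) → (0, ∞)`: continuous, convex, vanishing at infinity (hence
nonincreasing and bounded), three times differentiable on `(0, ∞)`. The right derivative at `0` may
be finite or `-∞`, so the vertex `V = (0, f 0)` is either a corner or a cusp. -/
structure IsProfile (f : ℝ → ℝ) : Prop where
  pos : ∀ x, 0 ≤ x → 0 < f x
  continuousOn : ContinuousOn f (Ici 0)
  convexOn : ConvexOn ℝ (Ici 0) f
  tendsto_zero : Tendsto f atTop (𝓝 0)
  differentiable₁ : ∀ x, 0 < x → DifferentiableAt ℝ f x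
  differentiable₂ : ∀ x, 0 < x → DifferentiableAt ℝ (deriv f) x
  differentiable₃ : ∀ x, 0 < x → DifferentiableAt ℝ (deriv^[2] f) x

/-- `s` is the abscissa `x_t(x)`: the line through `(x, -f x)` and `(s, f s)` is tangent to the
graph of `f` at `(s, f s)`. -/
def IsTangencyAbscissa (f : ℝ → ℝ) (x s : ℝ) : Prop :=
  0 < s ∧ s < x ∧ (f x + f s) / (x - s) = -deriv f s

/-- `f'' → 0`. -/
def A1 (f : ℝ → ℝ) : Prop := Tendsto (deriv^[2] f) atTop (𝓝 0)

/-- `|f'(x_t)| ≪ |f'(x)|`; for large `x` the abscissa `x_t` exists and is unique. -/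
def A2 (f : ℝ → ℝ) : Prop :=
  ∃ C : ℝ, ∀ᶠ x in atTop, ∀ s, IsTangencyAbscissa f x s → |deriv f s| ≤ C * |deriv f x|

/-- `f f'' / (f')² ≫ 1`. -/
def A3 (f : ℝ → ℝ) : Prop :=
  (fun _ : ℝ => (1 : ℝ)) =O[atTop] fun x => f x * deriv^[2] f x / deriv f x ^ 2

/-- `|f'''| / f'' ≪ 1`; this includes that `f''` is positive everywhere. -/
def A4 (f : ℝ → ℝ) : Prop :=
  (∀ x, 0 < x → 0 < deriv^[2] f x) ∧
    (fun x => |deriv^[3] f x| / deriv^[2] f x) =O[atTop] fun _ : ℝ => (1 : ℝ)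

/-! ### The cross-section -/

/-- Arc length along the dispersing wall (the graph of `f`), from `V` to abscissa `x`. -/
def arcLength (f : ℝ → ℝ) (x : ℝ) : ℝ := ∫ t in (0 : ℝ)..x, √(1 + deriv f t ^ 2)

/-- The abscissa of the point of the wall at arc length `r` from `V`. -/
def abscissa (f : ℝ → ℝ) (r : ℝ) : ℝ := Function.invFunOn (arcLength f) (Ici 0) r

/-- Unit tangent `∂/∂r` of the wall at abscissa `x`. -/
def unitTangent (f : ℝ → ℝ) (x : ℝ) : ℝ × ℝ := (√(1 + deriv f x ^ 2))⁻¹ • (1, deriv f x)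

/-- Unit normal of the wall at abscissa `x`, pointing into the table (below the graph). -/
def inwardNormal (f : ℝ → ℝ) (x : ℝ) : ℝ × ℝ := (√(1 + deriv f x ^ 2))⁻¹ • (deriv f x, -1)

/-- The phase space of line elements `(r, φ)`: arc length and angle between `∂/∂r` and the outgoing
velocity. -/
def phaseSpace : Set (ℝ × ℝ) := Ioi 0 ×ˢ Ioo 0 Real.pi

/-- Invariant measure `sin φ dr dφ` on the phase space. -/
def invMeasure : Measure (ℝ × ℝ) :=
  (volume.restrict phaseSpace).withDensity fun ζ => ENNReal.ofReal (Real.sin ζ.2)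

/-! ### The return map

The billiard flow in `Q = {0 ≤ x, 0 ≤ y ≤ f x}`, with elastic reflections at the two semiaxes, is
the image under the folding `(x, y) ↦ (|x|, |y|)` of the motion on straight lines in the four-fold
copy `Q₄ = {|y| ≤ f |x|}`. The return map takes a line element on the wall to the next line element
on the wall. -/

/-- Position of the line element `(r, φ)`. -/
def position (f : ℝ → ℝ) (ζ : ℝ × ℝ) : ℝ × ℝ := (abscissa f ζ.1, f (abscissa f ζ.1))

/-- Unit velocity of the line element `(r, φ)`. -/
def velocity (f : ℝ → ℝ) (ζ : ℝ × ℝ) : ℝ × ℝ :=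
  Real.cos ζ.2 • unitTangent f (abscissa f ζ.1) + Real.sin ζ.2 • inwardNormal f (abscissa f ζ.1)

/-- Free motion in `Q₄`. -/
def ray (f : ℝ → ℝ) (ζ : ℝ × ℝ) (t : ℝ) : ℝ × ℝ := position f ζ + t • velocity f ζ

/-- The boundary of `Q₄`. -/
def boundary₄ (f : ℝ → ℝ) : Set (ℝ × ℝ) := {p | |p.2| = f |p.1|}

/-- Travelling time to the next collision with the boundary of `Q₄`. -/
def flightTime (f : ℝ → ℝ) (ζ : ℝ × ℝ) : ℝ := sInf {t | 0 < t ∧ ray f ζ t ∈ boundary₄ f}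

/-- The next collision point, in `Q₄`. -/
def collisionPoint (f : ℝ → ℝ) (ζ : ℝ × ℝ) : ℝ × ℝ := ray f ζ (flightTime f ζ)

/-- The component along `∂/∂r` of the velocity (folded back to `Q`) at the next collision. It is
not changed by the reflection; it is `±1` if and only if the collision is tangential. -/
def tangentialSpeed (f : ℝ → ℝ) (ζ : ℝ × ℝ) : ℝ :=
  Real.sign (collisionPoint f ζ).1 * (velocity f ζ).1 *
      (unitTangent f |(collisionPoint f ζ).1|).1 +
    Real.sign (collisionPoint f ζ).2 * (velocity f ζ).2 *
      (unitTangent f |(collisionPoint f ζ).1|).2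

/-- The return map; its domain is `phaseSpace \ singPlusSet f`. -/
def returnMap (f : ℝ → ℝ) (ζ : ℝ × ℝ) : ℝ × ℝ :=
  (arcLength f |(collisionPoint f ζ).1|, Real.arccos (tangentialSpeed f ζ))

/-! ### Singularity curves -/

/-- The curves `F^{0+}`, `F^{1+}`, `F^{2+}`.
* `F^{0+} = [0, ∞) × {π}`;
* `F^{1+}`: the next collision is tangential, after a crossing of the vertical semiaxis only;
* `F^{2+}`: after a crossing of the horizontal semiaxis only, the line element ends in the vertex
  or collides tangentially. -/
def singPlus (f : ℝ → ℝ) : Fin 3 → Set (ℝ × ℝ)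
  | 0 => Ici 0 ×ˢ {Real.pi}
  | 1 => {ζ ∈ phaseSpace | (collisionPoint f ζ).1 < 0 ∧ 0 < (collisionPoint f ζ).2 ∧
      |tangentialSpeed f ζ| = 1}
  | 2 => {ζ ∈ phaseSpace | (collisionPoint f ζ).2 < 0 ∧
      ((collisionPoint f ζ).1 = 0 ∨ (0 < (collisionPoint f ζ).1 ∧ |tangentialSpeed f ζ| = 1))}

/-- The curves `F^{i-}`, obtained from `F^{i+}` by time reversal `(r, φ) ↦ (r, π - φ)`. -/
def singMinus (f : ℝ → ℝ) (i : Fin 3) : Set (ℝ × ℝ) :=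
  {ζ | (ζ.1, Real.pi - ζ.2) ∈ singPlus f i}

/-- `F^+ = F^{1+} ∪ F^{2+}`, the discontinuity set of the return map. -/
def singPlusSet (f : ℝ → ℝ) : Set (ℝ × ℝ) := singPlus f 1 ∪ singPlus f 2

/-- `F^- = F^{1-} ∪ F^{2-}`, the discontinuity set of the inverse of the return map. -/
def singMinusSet (f : ℝ → ℝ) : Set (ℝ × ℝ) := singMinus f 1 ∪ singMinus f 2

/-! ### Unstable distance -/

/-- The unstable cone `{dr · dφ ≤ 0}`. -/
def unstableCone : Set (ℝ × ℝ) := {v | v.1 * v.2 ≤ 0}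

/-- The first nested cone at `ζ`: the image of the unstable cone at the preimage `ζ₋₁` of `ζ` under
the derivative at `ζ₋₁` of the return map. -/
def nestedCone (f : ℝ → ℝ) (ζ : ℝ × ℝ) : Set (ℝ × ℝ) :=
  {v | ∃ ζ' ∈ phaseSpace \ singPlusSet f, returnMap f ζ' = ζ ∧
    ∃ u ∈ unstableCone, fderiv ℝ (returnMap f) ζ' u = v}

/-- `γ : [0, 1] → [0, ∞) × [0, π]` is an unstable curve from `ζ` to `w`: inside the phase space,
apart possibly from the end points, differentiable, with velocity in the nested cone wherever this
cone is defined, that is off `F^-`. -/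
structure IsUnstableCurve (f : ℝ → ℝ) (ζ w : ℝ × ℝ) (γ : ℝ → ℝ × ℝ) : Prop where
  source : γ 0 = ζ
  target : γ 1 = w
  continuousOn : ContinuousOn γ (Icc 0 1)
  mem_phaseSpace : ∀ t ∈ Ioo (0 : ℝ) 1, γ t ∈ phaseSpace
  differentiable : ∀ t ∈ Ioo (0 : ℝ) 1, DifferentiableAt ℝ γ t
  deriv_mem : ∀ t ∈ Ioo (0 : ℝ) 1, γ t ∉ singMinusSet f → deriv γ t ∈ nestedCone f (γ t)

/-- Euclidean length of the curve `γ` on `[0, 1]` (`ℝ × ℝ` itself carries the sup norm). -/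
def curveLength (γ : ℝ → ℝ × ℝ) : ℝ≥0∞ :=
  eVariationOn (fun t => WithLp.toLp 2 (γ t)) (Icc 0 1)

/-- Unstable distance between two points (`∞` if no unstable curve joins them). -/
def unstableDist (f : ℝ → ℝ) (ζ w : ℝ × ℝ) : ℝ≥0∞ :=
  ⨅ (γ : ℝ → ℝ × ℝ) (_ : IsUnstableCurve f ζ w γ), curveLength γ

/-- Unstable distance between a point and a set. -/
def unstableInfDist (f : ℝ → ℝ) (ζ : ℝ × ℝ) (A : Set (ℝ × ℝ)) : ℝ≥0∞ :=
  ⨅ w ∈ A, unstableDist f ζ w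

/-- The `ε`-neighbourhood of `A` with respect to the unstable distance. -/
def unstableNhd (f : ℝ → ℝ) (A : Set (ℝ × ℝ)) (ε : ℝ) : Set (ℝ × ℝ) :=
  {ζ ∈ phaseSpace | unstableInfDist f ζ A ≤ ENNReal.ofReal ε}

end

end CuspBilliard

namespace CuspBilliard

/-! ### Elementary properties of the profile -/

section Profile

variable {f : ℝ → ℝ}

/-! Each `F^{i+}` is a nondecreasing graph over arc length with heights in `[0, π]`; time reversal
turns `F^{i-}` into `F^{i+}` and preserves area. A point `ζ` of the neighbourhood is joined to some
`w ∈ F` by an unstable curve of length at most `2ε`. If moreover `|ζ.2 - w.2| ≤ 2ε h(ζ.1)` with `h`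
integrable, the area is `O(ε)`: the horizontal displacement costs `O(ε)` because a bounded monotone
graph shifted sideways sweeps an area at most shift times height, however long the graph is, and the
vertical one costs `O(ε) ∫ h` (`volume_le_of_monotone_graph`). On a bounded stretch of wall `h = 1`
will do. In the cusp `h` is a multiple of `|f'|`, integrable because the height of the wall
decreases to `0` (`exists_integrable_majorant`).

The crux is therefore that near `F` in the cusp unstable curves have slope `O(|f'|)`
(`exists_unstable_bound`). A vector in the nested cone satisfies `|dφ| ≤ (κ + sin φ / τ) |dr|`, with
`κ` the curvature and `τ` the preceding flight time (`abs_fderiv_returnMap_snd_le`). Here `κ ≤ f'' ≪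
|f'|`; and if `sin φ ≪ |f'|`, then `τ` is bounded below (`abs_snd_le_of_mem_nestedCone`). On `F`
itself `sin φ ≪ |f'|` (`exists_singPlus_bounds`), and a continuity argument propagates this along
the curve (`abs_sub_le_of_bootstrap`). The nested cone is undefined on `F^-`, where an unstable
curve could a priori move freely; but at almost every time spent there the velocity is a limit of
chords of `F^-`, which is itself Lipschitz with constant `O(|f'|)` (`ae_abs_deriv_le`).

The length is infinite because the projection of each curve to the arc length axis contains a
half-line. -/

theorem IsProfile.hasDerivAt (hf : IsProfile f) {x : ℝ} (hx : 0 < x) :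
    HasDerivAt f (deriv f x) x := (hf.differentiable₁ x hx).hasDerivAt

theorem IsProfile.hasDerivAt_deriv (hf : IsProfile f) {x : ℝ} (hx : 0 < x) :
    HasDerivAt (deriv f) (deriv (deriv f) x) x := (hf.differentiable₂ x hx).hasDerivAt

theorem IsProfile.hasDerivAt_deriv_deriv (hf : IsProfile f) {x : ℝ} (hx : 0 < x) :
    HasDerivAt (deriv (deriv f)) (deriv (deriv (deriv f)) x) x :=
  (hf.differentiable₃ x hx).hasDerivAt

theorem IsProfile.continuousOn_deriv (hf : IsProfile f) : ContinuousOn (deriv f) (Ioi 0) :=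
  fun _ hx => (hf.hasDerivAt_deriv hx).continuousAt.continuousWithinAt

theorem IsProfile.strictMonoOn_deriv (hf : IsProfile f)
    (hpos : ∀ x, 0 < x → 0 < deriv (deriv f) x) : StrictMonoOn (deriv f) (Ioi 0) := by
  apply strictMonoOn_of_deriv_pos (convex_Ioi 0) hf.continuousOn_deriv
  intro x hx
  rw [interior_Ioi] at hx
  exact hpos x hx

/-- The graph lies above its tangents. -/
theorem IsProfile.tangent_le (hf : IsProfile f) {x y : ℝ} (hx : 0 < x) (hy : 0 ≤ y) :
    f x + deriv f x * (y - x) ≤ f y := by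
  rcases lt_trichotomy x y with h | h | h
  · have := hf.convexOn.deriv_le_slope (mem_Ici.2 hx.le) (mem_Ici.2 hy) h
      (hf.differentiable₁ x hx)
    rw [slope_def_field, le_div_iff₀ (by linarith)] at this
    linarith
  · subst h; simp
  · have := hf.convexOn.slope_le_deriv (mem_Ici.2 hy) (mem_Ici.2 hx.le) h
      (hf.differentiable₁ x hx)
    rw [slope_def_field, div_le_iff₀ (by linarith)] at this
    linarith

/-- Convexity squeezes `f' x` between `f x - f (x - 1)` and `f (x + 1) - f x`. -/
theorem IsProfile.tendsto_deriv (hf : IsProfile f) : Tendsto (deriv f) atTop (𝓝 0) := by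
  have h1 : Tendsto (fun x : ℝ => f x - f (x - 1)) atTop (𝓝 0) := by
    have := hf.tendsto_zero.sub
      (hf.tendsto_zero.comp (tendsto_atTop_add_const_right atTop (-1 : ℝ) tendsto_id))
    simpa [Function.comp_def, sub_eq_add_neg] using this
  have h2 : Tendsto (fun x : ℝ => f (x + 1) - f x) atTop (𝓝 0) := by
    have := (hf.tendsto_zero.comp (tendsto_atTop_add_const_right atTop (1 : ℝ) tendsto_id)).sub
      hf.tendsto_zero
    simpa [Function.comp_def, sub_eq_add_neg] using this
  refine tendsto_of_tendsto_of_tendsto_of_le_of_le' h1 h2 ?_ ?_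
  · filter_upwards [eventually_ge_atTop (1 : ℝ)] with x hx
    have := hf.tangent_le (x := x) (y := x - 1) (by linarith) (by linarith)
    linarith
  · filter_upwards [eventually_ge_atTop (1 : ℝ)] with x hx
    have := hf.tangent_le (x := x) (y := x + 1) (by linarith) (by linarith)
    linarith

theorem IsProfile.deriv_neg (hf : IsProfile f)
    (hpos : ∀ x, 0 < x → 0 < deriv (deriv f) x) {x : ℝ} (hx : 0 < x) : deriv f x < 0 := by
  have h1 : deriv f x < deriv f (x + 1) :=
    hf.strictMonoOn_deriv hpos (mem_Ioi.2 hx) (mem_Ioi.2 (by linarith)) (by linarith)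
  have h2 : deriv f (x + 1) ≤ 0 := by
    refine ge_of_tendsto hf.tendsto_deriv ?_
    filter_upwards [eventually_ge_atTop (x + 1)] with y hy
    exact (hf.strictMonoOn_deriv hpos).monotoneOn (mem_Ioi.2 (by linarith))
      (mem_Ioi.2 (by linarith)) hy
  linarith

theorem IsProfile.strictAntiOn (hf : IsProfile f)
    (hpos : ∀ x, 0 < x → 0 < deriv (deriv f) x) : StrictAntiOn f (Ici 0) := by
  apply strictAntiOn_of_deriv_neg (convex_Ici 0) hf.continuousOn
  intro x hx
  rw [interior_Ici] at hx
  exact hf.deriv_neg hpos hx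

/-- Going from `x` to `y` along two tangents, at `x` and at the midpoint, gains strictly on the
single tangent, since `f'` is strictly increasing. -/
theorem IsProfile.tangent_lt (hf : IsProfile f)
    (hpos : ∀ x, 0 < x → 0 < deriv (deriv f) x) {x y : ℝ} (hx : 0 < x) (hy : 0 ≤ y)
    (hxy : y ≠ x) : f x + deriv f x * (y - x) < f y := by
  have hz : 0 < (x + y) / 2 := by linarith
  have h1 := hf.tangent_le hx hz.le
  have h2 := hf.tangent_le hz hy
  rcases lt_or_gt_of_ne hxy with h | h
  · have h3 : deriv f ((x + y) / 2) < deriv f x :=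
      hf.strictMonoOn_deriv hpos (mem_Ioi.2 hz) (mem_Ioi.2 hx) (by linarith)
    nlinarith
  · have h3 : deriv f x < deriv f ((x + y) / 2) :=
      hf.strictMonoOn_deriv hpos (mem_Ioi.2 hx) (mem_Ioi.2 hz) (by linarith)
    nlinarith

theorem IsProfile.continuous_comp_abs (hf : IsProfile f) : Continuous fun x : ℝ => f |x| :=
  hf.continuousOn.comp_continuous continuous_abs fun x => mem_Ici.2 (abs_nonneg x)

/-- In the cusp `f'' ≪ |f'| ≪ f`. -/
theorem IsProfile.exists_bounds (hf : IsProfile f) (h₁ : A1 f) (h₄ : A4 f) :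
    ∃ K X : ℝ, 1 ≤ K ∧ 1 ≤ X ∧ ∀ x, X ≤ x →
      deriv (deriv f) x ≤ K * -deriv f x ∧ -deriv f x ≤ K * f x := by
  obtain ⟨hpos, hO⟩ := h₄
  obtain ⟨C, hC⟩ := hO.bound
  obtain ⟨X₀, hX₀⟩ := eventually_atTop.1 hC
  set K := max C 1
  set X := max X₀ 1
  have hXpos : ∀ x, X ≤ x → 0 < x := fun x hx => by
    have : (1 : ℝ) ≤ X := le_max_right _ _
    linarith
  have h3 : ∀ x, X ≤ x → -(K * deriv (deriv f) x) ≤ deriv (deriv (deriv f)) x := by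
    intro x hx
    have h := hX₀ x (le_trans (le_max_left _ _) hx)
    have hp : 0 < deriv (deriv f) x := hpos x (hXpos x hx)
    have h' : |deriv (deriv (deriv f)) x| / deriv (deriv f) x ≤ C := by
      have h2 : ‖|deriv (deriv (deriv f)) x| / deriv (deriv f) x‖ ≤ C * ‖(1 : ℝ)‖ := h
      rw [Real.norm_of_nonneg (by positivity)] at h2
      simpa using h2
    rw [div_le_iff₀ hp] at h'
    have h5 : C * deriv (deriv f) x ≤ K * deriv (deriv f) x :=
      mul_le_mul_of_nonneg_right (le_max_left _ _) hp.le
    linarith [neg_abs_le (deriv (deriv (deriv f)) x)]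
  have h1' : Tendsto (deriv (deriv f)) atTop (𝓝 0) := h₁
  -- Integrate `f''' ≥ -K f''` from infinity, where `f''` and `f'` both vanish: `f'' + K f'`
  -- increases to `0`.
  have hd : ∀ x, X ≤ x → deriv (deriv f) x ≤ K * -deriv f x := by
    intro x hx
    have hmono : MonotoneOn (fun x => deriv (deriv f) x + K * deriv f x) (Ici X) := by
      apply monotoneOn_of_hasDerivWithinAt_nonneg (convex_Ici X)
        (f' := fun x => deriv (deriv (deriv f)) x + K * deriv (deriv f) x)
      · exact fun y hy => ((hf.hasDerivAt_deriv_deriv (hXpos y hy)).add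
          ((hf.hasDerivAt_deriv (hXpos y hy)).const_mul K)).continuousAt.continuousWithinAt
      · intro y hy
        rw [interior_Ici] at hy
        have hy' := hXpos y (le_of_lt hy)
        exact ((hf.hasDerivAt_deriv_deriv hy').add
          ((hf.hasDerivAt_deriv hy').const_mul K)).hasDerivWithinAt
      · intro y hy
        rw [interior_Ici] at hy
        linarith [h3 y (le_of_lt hy)]
    have hlim : Tendsto (fun x => deriv (deriv f) x + K * deriv f x) atTop (𝓝 0) := by
      simpa using h1'.add (hf.tendsto_deriv.const_mul K)
    have : deriv (deriv f) x + K * deriv f x ≤ 0 := by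
      refine ge_of_tendsto hlim ?_
      filter_upwards [eventually_ge_atTop x] with y hy
      exact hmono hx (hx.trans hy) hy
    linarith
  refine ⟨K, X, le_max_right _ _, le_max_right _ _, fun x hx => ⟨hd x hx, ?_⟩⟩
  -- The same integration one order lower.
  have hanti : AntitoneOn (fun x => deriv f x + K * f x) (Ici X) := by
    apply antitoneOn_of_hasDerivWithinAt_nonpos (convex_Ici X)
      (f' := fun x => deriv (deriv f) x + K * deriv f x)
    · exact fun y hy => ((hf.hasDerivAt_deriv (hXpos y hy)).add
        ((hf.hasDerivAt (hXpos y hy)).const_mul K)).continuousAt.continuousWithinAt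
    · intro y hy
      rw [interior_Ici] at hy
      have hy' := hXpos y (le_of_lt hy)
      exact ((hf.hasDerivAt_deriv hy').add
        ((hf.hasDerivAt hy').const_mul K)).hasDerivWithinAt
    · intro y hy
      rw [interior_Ici] at hy
      linarith [hd y (le_of_lt hy)]
  have hlim : Tendsto (fun x => deriv f x + K * f x) atTop (𝓝 0) := by
    simpa using hf.tendsto_deriv.add (hf.tendsto_zero.const_mul K)
  have : 0 ≤ deriv f x + K * f x := by
    refine le_of_tendsto hlim ?_
    filter_upwards [eventually_ge_atTop x] with y hy
    exact hanti hx (hx.trans hy) hy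
  linarith

/-- A logarithmic derivative bounded by `K` in the cusp: `|f'|` decays at most exponentially. -/
theorem IsProfile.neg_deriv_le_exp_mul (hf : IsProfile f) {K X : ℝ} (hX : 1 ≤ X)
    (hK : ∀ x, X ≤ x → deriv (deriv f) x ≤ K * -deriv f x) {x y : ℝ} (hx : X ≤ x)
    (hxy : x ≤ y) : -deriv f x ≤ Real.exp (K * (y - x)) * -deriv f y := by
  have hmono : MonotoneOn (fun x => Real.exp (K * x) * -deriv f x) (Ici X) := by
    have hd : ∀ y, X ≤ y → HasDerivAt (fun x => Real.exp (K * x) * -deriv f x)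
        (Real.exp (K * y) * K * -deriv f y + Real.exp (K * y) * -deriv (deriv f) y) y := by
      intro y hy
      have h1 : HasDerivAt (fun x : ℝ => Real.exp (K * x)) (Real.exp (K * y) * K) y := by
        simpa using ((hasDerivAt_id y).const_mul K).exp
      exact h1.mul (hf.hasDerivAt_deriv (by linarith)).neg
    apply monotoneOn_of_hasDerivWithinAt_nonneg (convex_Ici X)
    · exact fun y hy => (hd y hy).continuousAt.continuousWithinAt
    · intro y hy
      rw [interior_Ici] at hy
      exact (hd y (le_of_lt hy)).hasDerivWithinAt
    · intro y hy
      rw [interior_Ici] at hy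
      have := hK y (le_of_lt hy)
      have he := Real.exp_pos (K * y)
      nlinarith
  have h := hmono (mem_Ici.2 hx) (mem_Ici.2 (hx.trans hxy)) hxy
  simp only at h
  have he := Real.exp_pos (K * x)
  rw [show K * (y - x) = K * y - K * x by ring, Real.exp_sub, div_mul_eq_mul_div,
    le_div_iff₀ he]
  linarith

end Profile

/-! ### Arc length -/

section ArcLength

variable {f : ℝ → ℝ}

/-- At `0` the slope may be infinite; the speed is dominated by `1 - f'`, and `-f'` is integrable up
to `0` as the nonnegative derivative of the continuous function `-f`. -/
theorem IsProfile.intervalIntegrable_speed (hf : IsProfile f)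
    (hpos : ∀ x, 0 < x → 0 < deriv (deriv f) x) {x y : ℝ} (hx : 0 ≤ x) (hxy : x ≤ y) :
    IntervalIntegrable (fun t => √(1 + deriv f t ^ 2)) volume x y := by
  have h1 : IntervalIntegrable (fun t => 1 + -deriv f t) volume x y := by
    refine intervalIntegrable_const.add ?_
    refine intervalIntegral.intervalIntegrable_deriv_of_nonneg (g := fun t => -f t) ?_ ?_ ?_
    · rw [uIcc_of_le hxy]
      exact (hf.continuousOn.mono fun z hz => mem_Ici.2 (hx.trans hz.1)).neg
    · intro z hz
      rw [min_eq_left hxy] at hz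
      exact (hf.hasDerivAt (hx.trans_lt hz.1)).neg
    · intro z hz
      rw [min_eq_left hxy] at hz
      linarith [hf.deriv_neg hpos (hx.trans_lt hz.1)]
  refine h1.mono_fun ?_ ?_
  · exact (Measurable.sqrt (measurable_const.add
      ((measurable_deriv f).pow_const 2))).aestronglyMeasurable
  · refine (ae_restrict_iff' measurableSet_uIoc).2 (Eventually.of_forall fun z hz => ?_)
    rw [uIoc_of_le hxy] at hz
    have hd := hf.deriv_neg hpos (hx.trans_lt hz.1)
    beta_reduce
    rw [Real.norm_of_nonneg (Real.sqrt_nonneg _), Real.norm_of_nonneg (by linarith)]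
    apply Real.sqrt_le_iff.2
    constructor
    · linarith
    · nlinarith

theorem arcLength_zero : arcLength f 0 = 0 := by simp [arcLength]

theorem one_le_speed (x : ℝ) : 1 ≤ √(1 + deriv f x ^ 2) :=
  Real.one_le_sqrt.2 (by nlinarith [sq_nonneg (deriv f x)])

/-- Arc length increases at least as fast as the abscissa. -/
theorem IsProfile.sub_le_arcLength_sub (hf : IsProfile f)
    (hpos : ∀ x, 0 < x → 0 < deriv (deriv f) x) {x y : ℝ} (hx : 0 ≤ x) (hxy : x ≤ y) :
    y - x ≤ arcLength f y - arcLength f x := by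
  unfold arcLength
  rw [intervalIntegral.integral_interval_sub_left
    (hf.intervalIntegrable_speed hpos le_rfl (hx.trans hxy))
    (hf.intervalIntegrable_speed hpos le_rfl hx)]
  have : ∫ _ in x..y, (1 : ℝ) ≤ ∫ t in x..y, √(1 + deriv f t ^ 2) :=
    intervalIntegral.integral_mono_on hxy intervalIntegrable_const
      (hf.intervalIntegrable_speed hpos hx hxy) fun t _ => one_le_speed t
  simpa using this

theorem IsProfile.strictMonoOn_arcLength (hf : IsProfile f)
    (hpos : ∀ x, 0 < x → 0 < deriv (deriv f) x) : StrictMonoOn (arcLength f) (Ici 0) := by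
  intro x hx y _ hxy
  linarith [hf.sub_le_arcLength_sub hpos hx hxy.le]

theorem IsProfile.continuousOn_arcLength (hf : IsProfile f)
    (hpos : ∀ x, 0 < x → 0 < deriv (deriv f) x) {y : ℝ} (hy : 0 ≤ y) :
    ContinuousOn (arcLength f) (Icc 0 y) := by
  have := intervalIntegral.continuousOn_primitive_interval
    (f := fun t => √(1 + deriv f t ^ 2)) (μ := volume) (a := 0) (b := y) ?_
  · rwa [uIcc_of_le hy] at this
  · rw [uIcc_of_le hy]
    exact (intervalIntegrable_iff_integrableOn_Icc_of_le hy).1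
      (hf.intervalIntegrable_speed hpos le_rfl hy)

theorem IsProfile.hasDerivAt_arcLength (hf : IsProfile f)
    (hpos : ∀ x, 0 < x → 0 < deriv (deriv f) x) {x : ℝ} (hx : 0 < x) :
    HasDerivAt (arcLength f) (√(1 + deriv f x ^ 2)) x := by
  refine intervalIntegral.integral_hasDerivAt_right
    (hf.intervalIntegrable_speed hpos le_rfl hx.le) ?_ ?_
  · exact (Measurable.sqrt (measurable_const.add
      ((measurable_deriv f).pow_const 2))).stronglyMeasurable.stronglyMeasurableAtFilter
  · exact ((hf.hasDerivAt_deriv hx).continuousAt.pow 2).const_add 1 |>.sqrt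

theorem IsProfile.exists_arcLength_eq (hf : IsProfile f)
    (hpos : ∀ x, 0 < x → 0 < deriv (deriv f) x) {r : ℝ} (hr : 0 ≤ r) :
    ∃ x ∈ Ici (0 : ℝ), arcLength f x = r := by
  have h := intermediate_value_Icc hr (hf.continuousOn_arcLength hpos hr)
  have h1 := hf.sub_le_arcLength_sub hpos le_rfl hr
  rw [arcLength_zero] at h h1
  obtain ⟨x, hx, hxr⟩ := h ⟨hr, by linarith⟩
  exact ⟨x, hx.1, hxr⟩

theorem IsProfile.abscissa_nonneg (hf : IsProfile f)
    (hpos : ∀ x, 0 < x → 0 < deriv (deriv f) x) {r : ℝ} (hr : 0 ≤ r) : 0 ≤ abscissa f r :=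
  Function.invFunOn_mem (hf.exists_arcLength_eq hpos hr)

theorem IsProfile.arcLength_abscissa (hf : IsProfile f)
    (hpos : ∀ x, 0 < x → 0 < deriv (deriv f) x) {r : ℝ} (hr : 0 ≤ r) :
    arcLength f (abscissa f r) = r :=
  Function.invFunOn_eq (hf.exists_arcLength_eq hpos hr)

theorem IsProfile.arcLength_nonneg (hf : IsProfile f)
    (hpos : ∀ x, 0 < x → 0 < deriv (deriv f) x) {x : ℝ} (hx : 0 ≤ x) : 0 ≤ arcLength f x := by
  have := hf.sub_le_arcLength_sub hpos le_rfl hx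
  rw [arcLength_zero] at this
  linarith

theorem IsProfile.abscissa_arcLength (hf : IsProfile f)
    (hpos : ∀ x, 0 < x → 0 < deriv (deriv f) x) {x : ℝ} (hx : 0 ≤ x) :
    abscissa f (arcLength f x) = x := by
  have h := hf.arcLength_nonneg hpos hx
  exact (hf.strictMonoOn_arcLength hpos).injOn (hf.abscissa_nonneg hpos h) hx
    (hf.arcLength_abscissa hpos h)

theorem IsProfile.abscissa_pos (hf : IsProfile f)
    (hpos : ∀ x, 0 < x → 0 < deriv (deriv f) x) {r : ℝ} (hr : 0 < r) : 0 < abscissa f r := by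
  refine lt_of_le_of_ne (hf.abscissa_nonneg hpos hr.le) fun h => ?_
  have := hf.arcLength_abscissa hpos hr.le
  rw [← h, arcLength_zero] at this
  exact hr.ne this

/-- The abscissa is a nondecreasing `1`-Lipschitz function of arc length. -/
theorem IsProfile.abscissa_sub_mem (hf : IsProfile f)
    (hpos : ∀ x, 0 < x → 0 < deriv (deriv f) x) {r r' : ℝ} (hr : 0 ≤ r) (hrr' : r ≤ r') :
    abscissa f r ≤ abscissa f r' ∧ abscissa f r' - abscissa f r ≤ r' - r := by
  have h0 := hf.abscissa_nonneg hpos hr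
  have h1 := hf.abscissa_nonneg hpos (hr.trans hrr')
  have h2 := hf.arcLength_abscissa hpos hr
  have h3 := hf.arcLength_abscissa hpos (hr.trans hrr')
  have hle : abscissa f r ≤ abscissa f r' := by
    refine ((hf.strictMonoOn_arcLength hpos).le_iff_le h0 h1).1 ?_
    rw [h2, h3]; exact hrr'
  refine ⟨hle, ?_⟩
  have := hf.sub_le_arcLength_sub hpos h0 hle
  rwa [h2, h3] at this

theorem IsProfile.abs_abscissa_sub_le (hf : IsProfile f)
    (hpos : ∀ x, 0 < x → 0 < deriv (deriv f) x) {r r' : ℝ} (hr : 0 ≤ r) (hr' : 0 ≤ r') :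
    |abscissa f r - abscissa f r'| ≤ |r - r'| := by
  rcases le_total r r' with h | h
  · have := hf.abscissa_sub_mem hpos hr h
    rw [abs_sub_comm, abs_sub_comm r, abs_of_nonneg (by linarith), abs_of_nonneg (by linarith)]
    exact this.2
  · have := hf.abscissa_sub_mem hpos hr' h
    rw [abs_of_nonneg (by linarith), abs_of_nonneg (by linarith)]
    exact this.2

theorem IsProfile.hasDerivAt_abscissa (hf : IsProfile f)
    (hpos : ∀ x, 0 < x → 0 < deriv (deriv f) x) {r : ℝ} (hr : 0 < r) :
    HasDerivAt (abscissa f) (√(1 + deriv f (abscissa f r) ^ 2))⁻¹ r := by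
  have hx := hf.abscissa_pos hpos hr
  refine HasDerivAt.of_local_left_inverse ?_ (hf.hasDerivAt_arcLength hpos hx)
    (by linarith [one_le_speed (f := f) (abscissa f r)]) ?_
  · rw [Metric.continuousAt_iff]
    intro ε hε
    refine ⟨min ε r, lt_min hε hr, fun {r'} hr' => ?_⟩
    rw [Real.dist_eq] at hr' ⊢
    have h1 : |r' - r| < r := hr'.trans_le (min_le_right _ _)
    have : 0 ≤ r' := by linarith [(abs_lt.1 h1).1]
    exact (hf.abs_abscissa_sub_le hpos this hr.le).trans_lt (hr'.trans_le (min_le_left _ _))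
  · filter_upwards [lt_mem_nhds hr] with r' hr'
    exact hf.arcLength_abscissa hpos hr'.le

theorem IsProfile.tendsto_abscissa (hf : IsProfile f)
    (hpos : ∀ x, 0 < x → 0 < deriv (deriv f) x) : Tendsto (abscissa f) atTop atTop := by
  refine tendsto_atTop.2 fun b => ?_
  have hb : 0 ≤ |b| := abs_nonneg b
  filter_upwards [eventually_ge_atTop (arcLength f |b|)] with r hr
  have := (hf.abscissa_sub_mem hpos (hf.arcLength_nonneg hpos hb) hr).1
  rw [hf.abscissa_arcLength hpos hb] at this
  exact (le_abs_self b).trans this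

end ArcLength

/-! ### Directions -/

section Directions

variable {f : ℝ → ℝ}

/-- The angle by which the wall descends at abscissa `x`. -/
noncomputable def wallAngle (f : ℝ → ℝ) (x : ℝ) : ℝ := -Real.arctan (deriv f x)

theorem cos_wallAngle (x : ℝ) : Real.cos (wallAngle f x) = (√(1 + deriv f x ^ 2))⁻¹ := by
  rw [wallAngle, Real.cos_neg, Real.cos_arctan, one_div]

theorem sin_wallAngle (x : ℝ) :
    Real.sin (wallAngle f x) = -deriv f x * (√(1 + deriv f x ^ 2))⁻¹ := by
  rw [wallAngle, Real.sin_neg, Real.sin_arctan, neg_mul, div_eq_mul_inv]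

theorem sin_wallAngle_eq (x : ℝ) :
    Real.sin (wallAngle f x) = -deriv f x * Real.cos (wallAngle f x) := by
  rw [sin_wallAngle, cos_wallAngle]

theorem cos_wallAngle_pos (x : ℝ) : 0 < Real.cos (wallAngle f x) := by
  rw [wallAngle, Real.cos_neg]; exact Real.cos_arctan_pos _

theorem wallAngle_mem (x : ℝ) : wallAngle f x ∈ Ioo (-(Real.pi / 2)) (Real.pi / 2) := by
  have := Real.arctan_mem_Ioo (deriv f x)
  rw [wallAngle]
  exact ⟨by linarith [this.2], by linarith [this.1]⟩

theorem wallAngle_pos {x : ℝ} (h : deriv f x < 0) : 0 < wallAngle f x := by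
  rw [wallAngle, neg_pos]
  exact Real.arctan_zero ▸ Real.arctan_strictMono h

theorem unitTangent_eq (x : ℝ) :
    unitTangent f x = (Real.cos (wallAngle f x), -Real.sin (wallAngle f x)) := by
  rw [sin_wallAngle, cos_wallAngle, unitTangent]
  ext <;> simp [mul_comm]

theorem inwardNormal_eq (x : ℝ) :
    inwardNormal f x = (-Real.sin (wallAngle f x), -Real.cos (wallAngle f x)) := by
  rw [sin_wallAngle, cos_wallAngle, inwardNormal]
  ext <;> simp [mul_comm]

/-- The absolute direction of a line element, clockwise from the horizontal. -/
theorem velocity_eq (ζ : ℝ × ℝ) : velocity f ζ =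
    (Real.cos (ζ.2 + wallAngle f (abscissa f ζ.1)),
      -Real.sin (ζ.2 + wallAngle f (abscissa f ζ.1))) := by
  rw [velocity, unitTangent_eq, inwardNormal_eq, Real.cos_add, Real.sin_add]
  ext
  · simp; ring
  · simp

theorem velocity_sq (ζ : ℝ × ℝ) : (velocity f ζ).1 ^ 2 + (velocity f ζ).2 ^ 2 = 1 := by
  rw [velocity_eq]
  simp only
  nlinarith [Real.sin_sq_add_cos_sq (ζ.2 + wallAngle f (abscissa f ζ.1))]

/-- The component of the velocity along the inward normal is `sin φ > 0`, so the motion starts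
strictly below the tangent of the wall. -/
theorem velocity_lt {ζ : ℝ × ℝ} (hζ : ζ ∈ phaseSpace) :
    (velocity f ζ).2 < deriv f (abscissa f ζ.1) * (velocity f ζ).1 := by
  have hs : 0 < Real.sin ζ.2 := Real.sin_pos_of_pos_of_lt_pi hζ.2.1 hζ.2.2
  have hc := cos_wallAngle_pos (f := f) (abscissa f ζ.1)
  have h1 := sin_wallAngle_eq (f := f) (abscissa f ζ.1)
  have h2 := Real.sin_sq_add_cos_sq (wallAngle f (abscissa f ζ.1))
  rw [velocity_eq]
  simp only [Real.cos_add, Real.sin_add]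
  set c := Real.cos (wallAngle f (abscissa f ζ.1))
  set s := Real.sin (wallAngle f (abscissa f ζ.1))
  have h3 : 0 < c * (deriv f (abscissa f ζ.1) * (Real.cos ζ.2 * c - Real.sin ζ.2 * s) +
      (Real.sin ζ.2 * c + Real.cos ζ.2 * s)) := by
    have : c * (deriv f (abscissa f ζ.1) * (Real.cos ζ.2 * c - Real.sin ζ.2 * s) +
      (Real.sin ζ.2 * c + Real.cos ζ.2 * s)) = Real.sin ζ.2 := by
      have h4 : deriv f (abscissa f ζ.1) * c = -s := by linarith
      linear_combination (Real.cos ζ.2 * c - Real.sin ζ.2 * s) * h4 + Real.sin ζ.2 * h2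
    rw [this]; exact hs
  have := pos_of_mul_pos_right h3 hc.le
  linarith

end Directions

/-! ### The next collision -/

section Collision

variable {f : ℝ → ℝ}

theorem ray_fst (ζ : ℝ × ℝ) (t : ℝ) :
    (ray f ζ t).1 = abscissa f ζ.1 + t * (velocity f ζ).1 := rfl

theorem ray_snd (ζ : ℝ × ℝ) (t : ℝ) :
    (ray f ζ t).2 = f (abscissa f ζ.1) + t * (velocity f ζ).2 := rfl

/-- By convexity, the free motion stays below the wall from which it starts. -/
theorem IsProfile.ray_lt (hf : IsProfile f) (hpos : ∀ x, 0 < x → 0 < deriv (deriv f) x)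
    {ζ : ℝ × ℝ} (hζ : ζ ∈ phaseSpace) {t : ℝ} (ht : 0 < t) (h : 0 ≤ (ray f ζ t).1) :
    (ray f ζ t).2 < f (ray f ζ t).1 := by
  have h1 := hf.tangent_le (hf.abscissa_pos hpos hζ.1) h
  have h2 := mul_lt_mul_of_pos_left (velocity_lt (f := f) hζ) ht
  rw [ray_fst] at h1
  rw [ray_fst, ray_snd]
  linarith

theorem continuous_ray (ζ : ℝ × ℝ) : Continuous (ray f ζ) := by
  unfold ray; fun_prop

theorem IsProfile.continuous_gap (hf : IsProfile f) (ζ : ℝ × ℝ) :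
    Continuous fun t => f |(ray f ζ t).1| - |(ray f ζ t).2| :=
  (hf.continuous_comp_abs.comp (continuous_ray ζ).fst).sub (continuous_ray ζ).snd.abs

/-- Keeps the collision times away from `0`: their set is then closed and its infimum is a genuine
collision. -/
theorem IsProfile.exists_gap_pos (hf : IsProfile f)
    (hpos : ∀ x, 0 < x → 0 < deriv (deriv f) x) {ζ : ℝ × ℝ} (hζ : ζ ∈ phaseSpace) :
    ∃ δ > 0, ∀ t, 0 < t → t < δ → |(ray f ζ t).2| < f |(ray f ζ t).1| := by
  have hx := hf.abscissa_pos hpos hζ.1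
  have h0 : ∀ᶠ t in 𝓝 (0 : ℝ), 0 < (ray f ζ t).1 ∧ 0 < (ray f ζ t).2 := by
    refine ((continuous_ray ζ).fst.tendsto 0 |>.eventually_const_lt ?_).and
      ((continuous_ray ζ).snd.tendsto 0 |>.eventually_const_lt ?_)
    · simpa [ray_fst] using hx
    · simpa [ray_snd] using hf.pos _ hx.le
  obtain ⟨δ, hδ, h⟩ := Metric.eventually_nhds_iff.1 h0
  refine ⟨δ, hδ, fun t ht htδ => ?_⟩
  obtain ⟨h1, h2⟩ := h (y := t) (by rwa [Real.dist_eq, sub_zero, abs_of_pos ht])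
  rw [abs_of_pos h1, abs_of_pos h2]
  exact hf.ray_lt hpos hζ ht h1.le

theorem IsProfile.exists_mem_boundary (hf : IsProfile f)
    (hpos : ∀ x, 0 < x → 0 < deriv (deriv f) x) {ζ : ℝ × ℝ} (hζ : ζ ∈ phaseSpace) :
    ∃ t, 0 < t ∧ ray f ζ t ∈ boundary₄ f := by
  have hx := hf.abscissa_pos hpos hζ.1
  obtain ⟨δ, hδ, hgap⟩ := hf.exists_gap_pos hpos hζ
  -- A horizontal motion must go left, since the wall descends, and ends in the mirror image of its
  -- starting point. Any other motion leaves the strip `|y| ≤ f 0`.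
  by_cases hv : (velocity f ζ).2 = 0
  · have h1 := velocity_lt (f := f) hζ
    have h2 := velocity_sq (f := f) ζ
    have h3 := hf.deriv_neg hpos hx
    rw [hv] at h1 h2
    have h4 : (velocity f ζ).1 < 0 := by
      by_contra! h
      nlinarith
    have h5 : (velocity f ζ).1 = -1 := by nlinarith
    refine ⟨2 * abscissa f ζ.1, by linarith, ?_⟩
    have e1 : (ray f ζ (2 * abscissa f ζ.1)).1 = -abscissa f ζ.1 := by
      rw [ray_fst, h5]; ring
    have e2 : (ray f ζ (2 * abscissa f ζ.1)).2 = f (abscissa f ζ.1) := by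
      rw [ray_snd, hv]; ring
    change |(ray f ζ (2 * abscissa f ζ.1)).2| = f |(ray f ζ (2 * abscissa f ζ.1)).1|
    rw [e1, e2, abs_neg, abs_of_pos hx, abs_of_pos (hf.pos _ hx.le)]
  · have hle : ∀ x : ℝ, f |x| ≤ f 0 := fun x =>
      (hf.strictAntiOn hpos).antitoneOn (mem_Ici.2 le_rfl) (mem_Ici.2 (abs_nonneg x))
        (abs_nonneg x)
    have hf0 := hf.pos 0 le_rfl
    have hfx := hf.pos _ hx.le
    have hv' : 0 < |(velocity f ζ).2| := abs_pos.2 hv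
    -- By this time the vertical displacement exceeds `f 0 + f x`, so `|y| > f 0`; the summand `δ`
    -- makes this strict and puts `t₁` after `δ / 2`.
    set t₁ := δ + (f 0 + f (abscissa f ζ.1)) / |(velocity f ζ).2| with ht₁
    have ht₁δ : δ / 2 ≤ t₁ := by
      have : 0 ≤ (f 0 + f (abscissa f ζ.1)) / |(velocity f ζ).2| := by positivity
      linarith
    have hneg : f |(ray f ζ t₁).1| - |(ray f ζ t₁).2| ≤ 0 := by
      have h1 : t₁ * |(velocity f ζ).2| =
          δ * |(velocity f ζ).2| + (f 0 + f (abscissa f ζ.1)) := by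
        rw [ht₁, add_mul, div_mul_cancel₀ _ hv'.ne']
      have h2 : t₁ * |(velocity f ζ).2| ≤ |(ray f ζ t₁).2| + f (abscissa f ζ.1) := by
        have e : t₁ * (velocity f ζ).2 = (ray f ζ t₁).2 - f (abscissa f ζ.1) := by
          rw [ray_snd]; ring
        have := abs_sub (ray f ζ t₁).2 (f (abscissa f ζ.1))
        rwa [← e, abs_mul, abs_of_pos (show 0 < t₁ by linarith), abs_of_pos hfx] at this
      have h3 : 0 < δ * |(velocity f ζ).2| := by positivity
      linarith [hle (ray f ζ t₁).1]
    have hp : 0 ≤ f |(ray f ζ (δ / 2)).1| - |(ray f ζ (δ / 2)).2| := by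
      linarith [hgap (δ / 2) (by linarith) (by linarith)]
    obtain ⟨t, ht, hteq⟩ := intermediate_value_Icc' ht₁δ (hf.continuous_gap ζ).continuousOn
      ⟨hneg, hp⟩
    refine ⟨t, by linarith [ht.1], ?_⟩
    change |(ray f ζ t).2| = f |(ray f ζ t).1|
    simp only at hteq
    linarith

theorem IsProfile.flightTime_spec (hf : IsProfile f)
    (hpos : ∀ x, 0 < x → 0 < deriv (deriv f) x) {ζ : ℝ × ℝ} (hζ : ζ ∈ phaseSpace) :
    0 < flightTime f ζ ∧ collisionPoint f ζ ∈ boundary₄ f := by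
  obtain ⟨δ, hδ, hgap⟩ := hf.exists_gap_pos hpos hζ
  obtain ⟨t₀, ht₀, hb₀⟩ := hf.exists_mem_boundary hpos hζ
  have hset : {t | 0 < t ∧ ray f ζ t ∈ boundary₄ f} =
      {t | δ ≤ t} ∩ {t | f |(ray f ζ t).1| - |(ray f ζ t).2| = 0} := by
    ext t
    constructor
    · rintro ⟨h1, h2⟩
      have h2' : |(ray f ζ t).2| = f |(ray f ζ t).1| := h2
      refine ⟨?_, ?_⟩
      · by_contra! h
        exact (hgap t h1 (not_le.1 h)).ne h2'
      · change _ - _ = (0 : ℝ)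
        rw [h2', sub_self]
    · rintro ⟨h1, h2⟩
      have h1' : δ ≤ t := h1
      have h2' : f |(ray f ζ t).1| - |(ray f ζ t).2| = 0 := h2
      exact ⟨by linarith, by change |(ray f ζ t).2| = f |(ray f ζ t).1|; linarith⟩
  have hmem : flightTime f ζ ∈ {t | 0 < t ∧ ray f ζ t ∈ boundary₄ f} := by
    refine IsClosed.csInf_mem ?_ ⟨t₀, ht₀, hb₀⟩ ⟨0, fun t ht => ht.1.le⟩
    rw [hset]
    exact isClosed_Ici.inter (isClosed_eq (hf.continuous_gap ζ) continuous_const)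
  exact hmem

theorem notMem_boundary_of_lt_flightTime {ζ : ℝ × ℝ} {t : ℝ} (ht : 0 < t)
    (htτ : t < flightTime f ζ) : ray f ζ t ∉ boundary₄ f := fun h =>
  absurd (csInf_le ⟨0, fun _ hs => hs.1.le⟩ ⟨ht, h⟩ : flightTime f ζ ≤ t) (not_le.2 htτ)

/-- Up to the next collision the motion stays in the interior of `Q₄`. -/
theorem IsProfile.abs_ray_lt (hf : IsProfile f)
    (hpos : ∀ x, 0 < x → 0 < deriv (deriv f) x) {ζ : ℝ × ℝ} (hζ : ζ ∈ phaseSpace) {t : ℝ}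
    (ht : 0 < t) (htτ : t < flightTime f ζ) : |(ray f ζ t).2| < f |(ray f ζ t).1| := by
  obtain ⟨δ, hδ, hgap⟩ := hf.exists_gap_pos hpos hζ
  by_contra! h
  have hδt : δ ≤ t := by
    by_contra! h'
    exact absurd (hgap t ht h') (not_lt.2 h)
  obtain ⟨s, hs, hseq⟩ := intermediate_value_Icc' (show δ / 2 ≤ t by linarith)
    (hf.continuous_gap ζ).continuousOn
    ⟨sub_nonpos.2 h, (sub_pos.2 (hgap (δ / 2) (by linarith) (by linarith))).le⟩
  refine notMem_boundary_of_lt_flightTime (f := f) (ζ := ζ) (t := s) (by linarith [hs.1])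
    (hs.2.trans_lt htτ) ?_
  change |(ray f ζ s).2| = f |(ray f ζ s).1|
  simp only at hseq
  linarith

/-- A criterion for the flight time. -/
theorem flightTime_eq {ζ : ℝ × ℝ} {τ : ℝ} (hτ : 0 < τ) (hb : ray f ζ τ ∈ boundary₄ f)
    (h : ∀ t, 0 < t → t < τ → |(ray f ζ t).2| < f |(ray f ζ t).1|) : flightTime f ζ = τ := by
  refine le_antisymm (csInf_le ⟨0, fun _ hs => hs.1.le⟩ ⟨hτ, hb⟩) ?_
  refine le_csInf ⟨τ, hτ, hb⟩ fun t ht => ?_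
  by_contra! h'
  exact (h t ht.1 h').ne ht.2

/-- No collision in the closed first quadrant. -/
theorem IsProfile.collisionPoint_neg (hf : IsProfile f)
    (hpos : ∀ x, 0 < x → 0 < deriv (deriv f) x) {ζ : ℝ × ℝ} (hζ : ζ ∈ phaseSpace) :
    (collisionPoint f ζ).1 < 0 ∨ (collisionPoint f ζ).2 < 0 := by
  obtain ⟨hτ, hb⟩ := hf.flightTime_spec hpos hζ
  by_contra! h
  have h1 := hf.ray_lt hpos hζ hτ h.1
  have h2 : |(collisionPoint f ζ).2| = f |(collisionPoint f ζ).1| := hb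
  rw [abs_of_nonneg h.1, abs_of_nonneg h.2] at h2
  exact h1.ne h2

theorem collisionPoint_fst (ζ : ℝ × ℝ) : (collisionPoint f ζ).1 =
    abscissa f ζ.1 + flightTime f ζ * (velocity f ζ).1 := rfl

theorem collisionPoint_snd (ζ : ℝ × ℝ) : (collisionPoint f ζ).2 =
    f (abscissa f ζ.1) + flightTime f ζ * (velocity f ζ).2 := rfl

/-- The quadrant of the next collision. -/
noncomputable def quadrant (f : ℝ → ℝ) (ζ : ℝ × ℝ) : ℝ × ℝ :=
  (Real.sign (collisionPoint f ζ).1, Real.sign (collisionPoint f ζ).2)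

/-- The three quadrants in which a collision can happen. -/
def collisionQuadrants : Set (ℝ × ℝ) := {(-1, 1), (-1, -1), (1, -1)}

theorem IsProfile.quadrant_mem (hf : IsProfile f)
    (hpos : ∀ x, 0 < x → 0 < deriv (deriv f) x) {ζ : ℝ × ℝ} (hζ : ζ ∈ phaseSpace)
    (h0 : (collisionPoint f ζ).1 ≠ 0) : quadrant f ζ ∈ collisionQuadrants := by
  have hb : |(collisionPoint f ζ).2| = f |(collisionPoint f ζ).1| :=
    (hf.flightTime_spec hpos hζ).2
  have h2 : (collisionPoint f ζ).2 ≠ 0 := by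
    rw [← abs_pos, hb]
    exact hf.pos _ (abs_nonneg _)
  have hneg := hf.collisionPoint_neg hpos hζ
  unfold quadrant collisionQuadrants
  rcases lt_or_gt_of_ne h0 with h | h <;> rcases lt_or_gt_of_ne h2 with h' | h'
  · simp [Real.sign_of_neg h, Real.sign_of_neg h']
  · simp [Real.sign_of_neg h, Real.sign_of_pos h']
  · simp [Real.sign_of_pos h, Real.sign_of_neg h']
  · exact absurd hneg (by push Not; exact ⟨h.le, h'.le⟩)

theorem sign_mul_abs_self (x : ℝ) : Real.sign x * |x| = x := by
  rcases lt_trichotomy x 0 with h | h | h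
  · rw [Real.sign_of_neg h, abs_of_neg h]; ring
  · simp [h]
  · rw [Real.sign_of_pos h, abs_of_pos h]; ring

theorem IsProfile.collisionPoint_eq (hf : IsProfile f)
    (hpos : ∀ x, 0 < x → 0 < deriv (deriv f) x) {ζ : ℝ × ℝ} (hζ : ζ ∈ phaseSpace) :
    (collisionPoint f ζ).1 = (quadrant f ζ).1 * |(collisionPoint f ζ).1| ∧
    (collisionPoint f ζ).2 = (quadrant f ζ).2 * f |(collisionPoint f ζ).1| := by
  have hb : |(collisionPoint f ζ).2| = f |(collisionPoint f ζ).1| :=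
    (hf.flightTime_spec hpos hζ).2
  rw [← hb]
  exact ⟨(sign_mul_abs_self _).symm, (sign_mul_abs_self _).symm⟩

end Collision

/-! ### The derivative of the return map -/

section Cone

variable {f : ℝ → ℝ}

/-- Curvature of the wall at abscissa `x`. -/
noncomputable def curvature (f : ℝ → ℝ) (x : ℝ) : ℝ :=
  deriv (deriv f) x / (1 + deriv f x ^ 2) * (√(1 + deriv f x ^ 2))⁻¹

theorem curvature_nonneg {x : ℝ} (h : 0 < deriv (deriv f) x) : 0 ≤ curvature f x := by
  unfold curvature; positivity

theorem curvature_le {x : ℝ} (h : 0 < deriv (deriv f) x) :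
    curvature f x ≤ deriv (deriv f) x := by
  unfold curvature
  have h1 : deriv (deriv f) x / (1 + deriv f x ^ 2) ≤ deriv (deriv f) x :=
    div_le_self h.le (by nlinarith [sq_nonneg (deriv f x)])
  have h2 : (√(1 + deriv f x ^ 2))⁻¹ ≤ 1 := inv_le_one_of_one_le₀ (one_le_speed x)
  calc _ ≤ deriv (deriv f) x * 1 := mul_le_mul h1 h2 (by positivity) h.le
    _ = _ := mul_one _

theorem IsProfile.hasDerivAt_wallAngle_abscissa (hf : IsProfile f)
    (hpos : ∀ x, 0 < x → 0 < deriv (deriv f) x) {r : ℝ} (hr : 0 < r) :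
    HasDerivAt (fun r => wallAngle f (abscissa f r)) (-curvature f (abscissa f r)) r := by
  have h1 := (hf.hasDerivAt_deriv (hf.abscissa_pos hpos hr)).comp r
    (hf.hasDerivAt_abscissa hpos hr)
  have h2 := h1.arctan.neg
  refine h2.congr_deriv ?_
  simp only [curvature, Function.comp]
  ring

theorem IsProfile.hasDerivAt_height (hf : IsProfile f)
    (hpos : ∀ x, 0 < x → 0 < deriv (deriv f) x) {r : ℝ} (hr : 0 < r) :
    HasDerivAt (fun r => f (abscissa f r)) (-Real.sin (wallAngle f (abscissa f r))) r := by
  refine ((hf.hasDerivAt (hf.abscissa_pos hpos hr)).comp r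
    (hf.hasDerivAt_abscissa hpos hr)).congr_deriv ?_
  rw [sin_wallAngle]; ring

theorem isOpen_phaseSpace : IsOpen phaseSpace := isOpen_Ioi.prod isOpen_Ioo

theorem tangentialSpeed_eq (ζ : ℝ × ℝ) : tangentialSpeed f ζ =
    (quadrant f ζ).1 * Real.cos (ζ.2 + wallAngle f (abscissa f ζ.1)) *
        Real.cos (wallAngle f |(collisionPoint f ζ).1|) +
      (quadrant f ζ).2 * Real.sin (ζ.2 + wallAngle f (abscissa f ζ.1)) *
        Real.sin (wallAngle f |(collisionPoint f ζ).1|) := by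
  rw [tangentialSpeed, velocity_eq, unitTangent_eq, quadrant]
  ring

theorem sq_eq_one_of_mem_collisionQuadrants {σ : ℝ × ℝ} (h : σ ∈ collisionQuadrants) :
    σ.1 ^ 2 = 1 ∧ σ.2 ^ 2 = 1 := by
  rcases h with rfl | rfl | rfl <;> norm_num

/-- Cauchy–Schwarz for the folded velocity and the unit tangent. A sign may be `0`, so the folded
velocity is only known to have norm at most `1`. -/
theorem abs_tangentialSpeed_le_one (ζ : ℝ × ℝ) : |tangentialSpeed f ζ| ≤ 1 := by
  rw [tangentialSpeed_eq]
  have hs : ∀ x : ℝ, Real.sign x ^ 2 ≤ 1 := fun x => by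
    rcases Real.sign_apply_eq x with h | h | h <;> rw [h] <;> norm_num
  have h1 : (quadrant f ζ).1 ^ 2 ≤ 1 := hs _
  have h2 : (quadrant f ζ).2 ^ 2 ≤ 1 := hs _
  have h3 := Real.sin_sq_add_cos_sq (ζ.2 + wallAngle f (abscissa f ζ.1))
  have h4 := Real.sin_sq_add_cos_sq (wallAngle f |(collisionPoint f ζ).1|)
  generalize Real.sin (ζ.2 + wallAngle f (abscissa f ζ.1)) = s at *
  generalize Real.cos (ζ.2 + wallAngle f (abscissa f ζ.1)) = c at *
  generalize Real.sin (wallAngle f |(collisionPoint f ζ).1|) = s' at *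
  generalize Real.cos (wallAngle f |(collisionPoint f ζ).1|) = c' at *
  generalize (quadrant f ζ).1 = p at *
  generalize (quadrant f ζ).2 = q at *
  rw [← sq_le_one_iff_abs_le_one]
  have h5 : (p * c) ^ 2 + (q * s) ^ 2 ≤ 1 := by
    have : (p * c) ^ 2 ≤ c ^ 2 := by rw [mul_pow]; nlinarith [sq_nonneg c]
    have : (q * s) ^ 2 ≤ s ^ 2 := by rw [mul_pow]; nlinarith [sq_nonneg s]
    linarith
  nlinarith [sq_nonneg (p * c * s' - q * s * c')]

theorem cos_returnMap (ζ : ℝ × ℝ) : Real.cos (returnMap f ζ).2 = tangentialSpeed f ζ := by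
  have := abs_le.1 (abs_tangentialSpeed_le_one (f := f) ζ)
  exact Real.cos_arccos this.1 this.2

theorem IsProfile.abscissa_returnMap (hf : IsProfile f)
    (hpos : ∀ x, 0 < x → 0 < deriv (deriv f) x) (ζ : ℝ × ℝ) :
    abscissa f (returnMap f ζ).1 = |(collisionPoint f ζ).1| :=
  hf.abscissa_arcLength hpos (abs_nonneg _)

theorem collisionPoint_fst_ne_zero {ζ : ℝ × ℝ} (h : 0 < (returnMap f ζ).1) :
    (collisionPoint f ζ).1 ≠ 0 := by
  intro h0
  simp [returnMap, h0, arcLength_zero] at h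

/-- The point `σ · (x, f x)`, for `x` the abscissa of the next collision, lies on the line of the
motion if and only if this vanishes. -/
noncomputable def lineDefect (f : ℝ → ℝ) (σ ζ : ℝ × ℝ) : ℝ :=
  (σ.1 * abscissa f (returnMap f ζ).1 - abscissa f ζ.1) * (velocity f ζ).2 -
    (σ.2 * f (abscissa f (returnMap f ζ).1) - f (abscissa f ζ.1)) * (velocity f ζ).1

theorem IsProfile.lineDefect_quadrant (hf : IsProfile f)
    (hpos : ∀ x, 0 < x → 0 < deriv (deriv f) x) {ζ : ℝ × ℝ} (hζ : ζ ∈ phaseSpace) :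
    lineDefect f (quadrant f ζ) ζ = 0 := by
  obtain ⟨h1, h2⟩ := hf.collisionPoint_eq hpos hζ
  rw [lineDefect, hf.abscissa_returnMap hpos, ← h1, ← h2, collisionPoint_fst,
    collisionPoint_snd]
  ring

/-- The line of the motion passes through only one of the three symmetric images of the next
collision point. -/
theorem IsProfile.eq_of_lineDefect_eq_zero (hf : IsProfile f)
    (hpos : ∀ x, 0 < x → 0 < deriv (deriv f) x) {ζ : ℝ × ℝ} (hζ : ζ ∈ phaseSpace)
    (h1 : 0 < (returnMap f ζ).1) {σ σ' : ℝ × ℝ} (hσ : σ ∈ collisionQuadrants)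
    (hσ' : σ' ∈ collisionQuadrants) (h : lineDefect f σ ζ = 0)
    (h' : lineDefect f σ' ζ = 0) : σ = σ' := by
  have hv := velocity_sq (f := f) ζ
  have hx := hf.abscissa_pos hpos hζ.1
  have hy := hf.pos _ hx.le
  have hX := hf.abscissa_pos hpos h1
  have hY := hf.pos _ hX.le
  unfold lineDefect at h h'
  generalize (velocity f ζ).1 = v at *
  generalize (velocity f ζ).2 = w at *
  generalize f (abscissa f ζ.1) = y at *
  generalize f (abscissa f (returnMap f ζ).1) = Y at *
  generalize abscissa f ζ.1 = x at *
  generalize abscissa f (returnMap f ζ).1 = X at *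
  -- Both displacements are parallel to the same unit vector `(v, w)`, so their cross product
  -- vanishes; for two different quadrants it has a strict sign.
  have key : (σ.1 * X - x) * (σ'.2 * Y - y) - (σ.2 * Y - y) * (σ'.1 * X - x) = 0 := by
    linear_combination (-((σ.1 * X - x) * (σ'.2 * Y - y) - (σ.2 * Y - y) * (σ'.1 * X - x))) * hv
      + (v * (σ'.1 * X - x) + w * (σ'.2 * Y - y)) * h
      - (v * (σ.1 * X - x) + w * (σ.2 * Y - y)) * h'
  rcases hσ with rfl | rfl | rfl <;> rcases hσ' with rfl | rfl | rfl <;> first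
    | rfl
    | (exfalso; simp only at key; nlinarith [mul_pos hX hY, mul_pos hx hY, mul_pos hX hy])

theorem IsProfile.continuousAt_velocity (hf : IsProfile f)
    (hpos : ∀ x, 0 < x → 0 < deriv (deriv f) x) {ζ : ℝ × ℝ} (hζ : ζ ∈ phaseSpace) :
    ContinuousAt (velocity f) ζ := by
  have h : velocity f = fun ζ => (Real.cos (ζ.2 + wallAngle f (abscissa f ζ.1)),
      -Real.sin (ζ.2 + wallAngle f (abscissa f ζ.1))) := funext velocity_eq
  have h1 : ContinuousAt (fun ζ : ℝ × ℝ => wallAngle f (abscissa f ζ.1)) ζ :=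
    ContinuousAt.comp' (f := Prod.fst)
      (hf.hasDerivAt_wallAngle_abscissa hpos hζ.1).continuousAt continuousAt_fst
  have h2 : ContinuousAt (fun ζ : ℝ × ℝ => ζ.2 + wallAngle f (abscissa f ζ.1)) ζ :=
    continuousAt_snd.add h1
  rw [h]
  exact (Real.continuous_cos.continuousAt.comp h2).prodMk
    (Real.continuous_sin.continuousAt.comp h2).neg

/-- Where the return map is continuous, the quadrant of the next collision is locally constant. -/
theorem IsProfile.eventually_quadrant_eq (hf : IsProfile f)
    (hpos : ∀ x, 0 < x → 0 < deriv (deriv f) x) {ζ : ℝ × ℝ} (hζ : ζ ∈ phaseSpace)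
    (hT : 0 < (returnMap f ζ).1) (hc : ContinuousAt (returnMap f) ζ) :
    ∀ᶠ z in 𝓝 ζ, z ∈ phaseSpace ∧ 0 < (returnMap f z).1 ∧ quadrant f z = quadrant f ζ := by
  have e1 : ∀ᶠ z in 𝓝 ζ, 0 < (returnMap f z).1 :=
    (continuousAt_fst.comp hc).eventually_const_lt hT
  have hσ := hf.quadrant_mem hpos hζ (collisionPoint_fst_ne_zero hT)
  have hdef : ∀ σ, ContinuousAt (lineDefect f σ) ζ := by
    intro σ
    have a0 : ContinuousAt (fun z : ℝ × ℝ => abscissa f z.1) ζ :=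
      ContinuousAt.comp' (f := Prod.fst) (hf.hasDerivAt_abscissa hpos hζ.1).continuousAt
        continuousAt_fst
    have b0 : ContinuousAt (fun z : ℝ × ℝ => f (abscissa f z.1)) ζ :=
      ContinuousAt.comp' (f := Prod.fst) (hf.hasDerivAt_height hpos hζ.1).continuousAt
        continuousAt_fst
    have c1 : ContinuousAt (fun z : ℝ × ℝ => (returnMap f z).1) ζ := continuousAt_fst.comp hc
    have a1 : ContinuousAt (fun z : ℝ × ℝ => abscissa f (returnMap f z).1) ζ :=
      ContinuousAt.comp' (f := fun z => (returnMap f z).1)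
        (hf.hasDerivAt_abscissa hpos hT).continuousAt c1
    have b1 : ContinuousAt (fun z : ℝ × ℝ => f (abscissa f (returnMap f z).1)) ζ :=
      ContinuousAt.comp' (f := fun z => (returnMap f z).1)
        (hf.hasDerivAt_height hpos hT).continuousAt c1
    have v := hf.continuousAt_velocity hpos hζ
    exact (((a1.const_mul σ.1).sub a0).mul v.snd).sub (((b1.const_mul σ.2).sub b0).mul v.fst)
  -- For a wrong quadrant the defect is nonzero at `ζ`, hence nearby, whereas a line element that
  -- collides in that quadrant has defect zero.
  have e2 : ∀ σ ∈ collisionQuadrants, ∀ᶠ z in 𝓝 ζ, quadrant f z = σ →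
      z ∈ phaseSpace → σ = quadrant f ζ := by
    intro σ hσ'
    by_cases h : σ = quadrant f ζ
    · exact Eventually.of_forall fun _ _ _ => h
    · have hne : lineDefect f σ ζ ≠ 0 := fun h0 => h
        (hf.eq_of_lineDefect_eq_zero hpos hζ hT hσ' hσ h0 (hf.lineDefect_quadrant hpos hζ))
      filter_upwards [(hdef σ).eventually_ne hne] with z hz hq hzp
      exact absurd (hq ▸ hf.lineDefect_quadrant hpos hzp) hz
  have e2' : ∀ᶠ z in 𝓝 ζ, ∀ σ ∈ collisionQuadrants, quadrant f z = σ →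
      z ∈ phaseSpace → σ = quadrant f ζ :=
    (Set.Finite.eventually_all (by unfold collisionQuadrants; exact Set.toFinite _)).2 e2
  filter_upwards [isOpen_phaseSpace.mem_nhds hζ, e1, e2'] with z hz hz1 hz2
  exact ⟨hz, hz1, hz2 _ (hf.quadrant_mem hpos hz (collisionPoint_fst_ne_zero hz1)) rfl hz⟩

/-- Algebra of a wave front: `a` is the displacement along the wall at departure, `θ` the change of
absolute direction, `τ` the flight time. Divergence, `a θ ≤ 0`, means that `τ θ` and `-s a` do not
cancel in `v₁ q`, so `τ |θ| ≤ S |v₁|`. -/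
theorem abs_le_of_diverging {v₁ v₂ q τ θ s a S σ k : ℝ} (hS : 0 < S) (hτ : 0 < τ) (hs : 0 ≤ s)
    (hk : 0 ≤ k) (hq : q ^ 2 = S ^ 2) (hσ : σ ^ 2 = 1) (ha : a * θ ≤ 0)
    (h₁ : v₁ * q = τ * θ - s * a) (h₂ : S * v₂ = -(q * (θ + σ * k * v₁))) :
    |v₂| ≤ (k + S / τ) * |v₁| := by
  have hq' : |q| = S := by rw [← abs_of_pos hS]; exact (sq_eq_sq_iff_abs_eq_abs q S).1 hq
  have hσ' : |σ| = 1 := by rw [← abs_one]; exact (sq_eq_sq_iff_abs_eq_abs σ 1).1 (by simpa using hσ)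
  have h3 : |v₂| = |θ + σ * k * v₁| := by
    have := congrArg abs h₂
    rw [abs_neg, abs_mul, abs_mul, hq', abs_of_pos hS] at this
    exact mul_left_cancel₀ hS.ne' this
  have h4 : |v₂| ≤ |θ| + k * |v₁| := by
    rw [h3]
    refine (abs_add_le _ _).trans ?_
    rw [abs_mul, abs_mul, hσ', abs_of_nonneg hk, one_mul]
  have h5 : τ * |θ| ≤ S * |v₁| := by
    have h6 : S * |v₁| = |τ * θ - s * a| := by
      rw [← h₁, abs_mul, hq', mul_comm]
    rw [h6, ← abs_of_pos hτ, ← abs_mul, abs_of_pos hτ]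
    apply sq_le_sq.1
    nlinarith [mul_nonneg hs hτ.le, sq_nonneg (s * a), mul_nonneg (mul_nonneg hs hτ.le)
      (neg_nonneg.2 ha)]
  have h7 : |θ| ≤ S / τ * |v₁| := by
    rw [div_mul_eq_mul_div, le_div_iff₀ hτ]; linarith
  nlinarith

/-- The image of the unstable cone under the derivative of the return map consists of wave fronts
that are at most as divergent as a front emanating from the previous collision point. -/
theorem IsProfile.abs_fderiv_returnMap_snd_le (hf : IsProfile f)
    (hpos : ∀ x, 0 < x → 0 < deriv (deriv f) x) {ζ : ℝ × ℝ} (hζ : ζ ∈ phaseSpace)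
    (hT : returnMap f ζ ∈ phaseSpace) {u : ℝ × ℝ} (hu : u ∈ unstableCone) :
    |(fderiv ℝ (returnMap f) ζ u).2| ≤
      (curvature f (abscissa f (returnMap f ζ).1) +
        Real.sin (returnMap f ζ).2 / flightTime f ζ) * |(fderiv ℝ (returnMap f) ζ u).1| := by
  -- Without differentiability `fderiv` is `0` and both sides vanish.
  by_cases hd : DifferentiableAt ℝ (returnMap f) ζ
  swap
  · simp [fderiv_zero_of_not_differentiableAt hd]
  obtain ⟨a, b⟩ := u
  set v := fderiv ℝ (returnMap f) ζ (a, b) with hv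
  have hline : HasDerivAt (fun s : ℝ => ζ + s • ((a, b) : ℝ × ℝ)) (a, b) 0 := by
    simpa using ((hasDerivAt_id (0 : ℝ)).smul_const ((a, b) : ℝ × ℝ)).const_add ζ
  have hcomp : HasDerivAt (fun s : ℝ => returnMap f (ζ + s • ((a, b) : ℝ × ℝ))) v 0 := by
    have : HasFDerivAt (returnMap f) (fderiv ℝ (returnMap f) ζ) (ζ + (0 : ℝ) • ((a, b) : ℝ × ℝ)) := by
      simpa using hd.hasFDerivAt
    exact this.comp_hasDerivAt 0 hline
  have hR1 : HasDerivAt (fun s : ℝ => (returnMap f (ζ + s • ((a, b) : ℝ × ℝ))).1) v.1 0 :=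
    hcomp.fst
  have hP1 : HasDerivAt (fun s : ℝ => (returnMap f (ζ + s • ((a, b) : ℝ × ℝ))).2) v.2 0 :=
    hcomp.snd
  have hR0 : HasDerivAt (fun s : ℝ => (ζ + s • ((a, b) : ℝ × ℝ)).1) a 0 := hline.fst
  have hP0 : HasDerivAt (fun s : ℝ => (ζ + s • ((a, b) : ℝ × ℝ)).2) b 0 := hline.snd
  have h0 : ζ + (0 : ℝ) • ((a, b) : ℝ × ℝ) = ζ := by simp
  have hev : ∀ᶠ s in 𝓝 (0 : ℝ), ζ + s • ((a, b) : ℝ × ℝ) ∈ phaseSpace ∧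
      0 < (returnMap f (ζ + s • ((a, b) : ℝ × ℝ))).1 ∧
      quadrant f (ζ + s • ((a, b) : ℝ × ℝ)) = quadrant f ζ := by
    have := hline.continuousAt.tendsto
    rw [h0] at this
    exact this.eventually (hf.eventually_quadrant_eq hpos hζ hT.1 hd.continuousAt)
  have hσ := hf.quadrant_mem hpos hζ (collisionPoint_fst_ne_zero hT.1)
  obtain ⟨hσ1, hσ2⟩ := sq_eq_one_of_mem_collisionQuadrants hσ
  set σ := quadrant f ζ with hσdef
  -- the two scalar identities along the line
  have hI : (fun s : ℝ => lineDefect f σ (ζ + s • ((a, b) : ℝ × ℝ))) =ᶠ[𝓝 0] fun _ => 0 := by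
    filter_upwards [hev] with s hs
    rw [← hs.2.2]
    exact hf.lineDefect_quadrant hpos hs.1
  have hII : (fun s : ℝ => Real.cos (returnMap f (ζ + s • ((a, b) : ℝ × ℝ))).2) =ᶠ[𝓝 0]
      fun s => σ.1 * Real.cos ((ζ + s • ((a, b) : ℝ × ℝ)).2 +
          wallAngle f (abscissa f (ζ + s • ((a, b) : ℝ × ℝ)).1)) *
        Real.cos (wallAngle f (abscissa f (returnMap f (ζ + s • ((a, b) : ℝ × ℝ))).1)) +
      σ.2 * Real.sin ((ζ + s • ((a, b) : ℝ × ℝ)).2 +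
          wallAngle f (abscissa f (ζ + s • ((a, b) : ℝ × ℝ)).1)) *
        Real.sin (wallAngle f (abscissa f (returnMap f (ζ + s • ((a, b) : ℝ × ℝ))).1)) := by
    filter_upwards [hev] with s hs
    rw [cos_returnMap, tangentialSpeed_eq, hs.2.2, hf.abscissa_returnMap hpos]
  have hr0 : 0 < (ζ + (0 : ℝ) • ((a, b) : ℝ × ℝ)).1 := by rw [h0]; exact hζ.1
  have hr1 : 0 < (returnMap f (ζ + (0 : ℝ) • ((a, b) : ℝ × ℝ))).1 := by rw [h0]; exact hT.1
  have dx0 := (hf.hasDerivAt_abscissa hpos hr0).comp 0 hR0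
  have dy0 := (hf.hasDerivAt_height hpos hr0).comp 0 hR0
  have dα0 := (hf.hasDerivAt_wallAngle_abscissa hpos hr0).comp 0 hR0
  have dx1 := (hf.hasDerivAt_abscissa hpos hr1).comp 0 hR1
  have dy1 := (hf.hasDerivAt_height hpos hr1).comp 0 hR1
  have dα1 := (hf.hasDerivAt_wallAngle_abscissa hpos hr1).comp 0 hR1
  have dΘ := hP0.add dα0
  -- The return map is never solved for: the identity "the collision point is on the ray" yields the
  -- arc length component of `v` (`eI`), and the formula for the cosine of the outgoing angle yields
  -- the angle component (`eII`).
  have dI := (((dx1.const_mul σ.1).sub dx0).mul dΘ.sin.neg).sub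
    (((dy1.const_mul σ.2).sub dy0).mul dΘ.cos)
  have eI := dI.unique ((hasDerivAt_const (0 : ℝ) (0 : ℝ)).congr_of_eventuallyEq (by
    filter_upwards [hI] with s hs
    simp only [lineDefect, velocity_eq] at hs
    exact hs))
  have dII := ((dΘ.cos.const_mul σ.1).mul dα1.cos).add ((dΘ.sin.const_mul σ.2).mul dα1.sin)
  have eII := hP1.cos.unique (dII.congr_of_eventuallyEq hII)
  obtain ⟨hτ, -⟩ := hf.flightTime_spec hpos hζ
  obtain ⟨hc1, hc2⟩ := hf.collisionPoint_eq hpos hζ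
  rw [← hf.abscissa_returnMap hpos, ← hσdef, collisionPoint_fst, velocity_eq] at hc1
  rw [← hf.abscissa_returnMap hpos, ← hσdef, collisionPoint_snd, velocity_eq] at hc2
  have hcos := cos_returnMap (f := f) ζ
  rw [tangentialSpeed_eq, ← hσdef, ← hf.abscissa_returnMap hpos] at hcos
  simp only [Function.comp, h0, Pi.add_apply, Pi.sub_apply, Pi.neg_apply]
    at eI eII
  rw [← cos_wallAngle, ← cos_wallAngle] at eI
  have hS : 0 < Real.sin (returnMap f ζ).2 := Real.sin_pos_of_pos_of_lt_pi hT.2.1 hT.2.2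
  have hs0 : 0 < Real.sin ζ.2 := Real.sin_pos_of_pos_of_lt_pi hζ.2.1 hζ.2.2
  have hk0 := curvature_nonneg (hpos _ (hf.abscissa_pos hpos hζ.1))
  have hk1 := curvature_nonneg (hpos _ (hf.abscissa_pos hpos hT.1))
  have hab : a * b ≤ 0 := hu
  have hsin : Real.sin ζ.2 =
      Real.sin (ζ.2 + wallAngle f (abscissa f ζ.1)) * Real.cos (wallAngle f (abscissa f ζ.1)) -
      Real.cos (ζ.2 + wallAngle f (abscissa f ζ.1)) * Real.sin (wallAngle f (abscissa f ζ.1)) := by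
    rw [← Real.sin_sub, add_sub_cancel_right]
  have hpyΘ := Real.sin_sq_add_cos_sq (ζ.2 + wallAngle f (abscissa f ζ.1))
  have hpy1 := Real.sin_sq_add_cos_sq (wallAngle f (abscissa f (returnMap f ζ).1))
  have hpyφ := Real.sin_sq_add_cos_sq (returnMap f ζ).2
  simp only at hc1 hc2
  generalize v.1 = v₁ at *
  generalize v.2 = v₂ at *
  generalize Real.sin (ζ.2 + wallAngle f (abscissa f ζ.1)) = sΘ at *
  generalize Real.cos (ζ.2 + wallAngle f (abscissa f ζ.1)) = cΘ at *
  generalize Real.sin (wallAngle f (abscissa f (returnMap f ζ).1)) = s₁ at *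
  generalize Real.cos (wallAngle f (abscissa f (returnMap f ζ).1)) = c₁ at *
  generalize Real.sin (wallAngle f (abscissa f ζ.1)) = s₀ at *
  generalize Real.cos (wallAngle f (abscissa f ζ.1)) = c₀ at *
  generalize curvature f (abscissa f ζ.1) = k₀ at *
  generalize curvature f (abscissa f (returnMap f ζ).1) = k₁ at *
  generalize Real.sin (returnMap f ζ).2 = S at *
  generalize Real.cos (returnMap f ζ).2 = Cφ at *
  generalize flightTime f ζ = τ at *
  -- Up to sign, `q` is the normal component of the folded velocity at the collision, so `q ^ 2 = S
  -- ^ 2`. The dispersing wall only helps divergence: `a θ = a b - k₀ a ^ 2 ≤ 0`.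
  refine abs_le_of_diverging (q := -σ.1 * c₁ * sΘ + σ.2 * s₁ * cΘ) (θ := b - k₀ * a)
    (s := Real.sin ζ.2) (a := a) (σ := σ.1 * σ.2) hS hτ hs0.le hk1 ?_ ?_ ?_ ?_ ?_
  · subst hcos
    linear_combination hpyφ * (-1) + (c₁ ^ 2 * sΘ ^ 2 + cΘ ^ 2 * c₁ ^ 2) * hσ1 +
      (s₁ ^ 2 * cΘ ^ 2 + sΘ ^ 2 * s₁ ^ 2) * hσ2 + (c₁ ^ 2 + s₁ ^ 2) * hpyΘ + hpy1
  · rw [mul_pow, hσ1, hσ2, one_mul]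
  · nlinarith [mul_nonneg hk0 (sq_nonneg a)]
  · linear_combination eI - cΘ * (b - k₀ * a) * hc1 + sΘ * (b - k₀ * a) * hc2 +
      τ * (b - k₀ * a) * hpyΘ + a * hsin
  · linear_combination -eII - σ.2 * c₁ * sΘ * k₁ * v₁ * hσ1 + σ.1 * s₁ * cΘ * k₁ * v₁ * hσ2

end Cone

/-! ### Nearly tangential line elements in the cusp -/

section NestedCone

variable {f : ℝ → ℝ}

theorem sin_wallAngle_le {x : ℝ} (h : deriv f x < 0) : Real.sin (wallAngle f x) ≤ -deriv f x := by
  rw [sin_wallAngle_eq]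
  exact mul_le_of_le_one_right (by linarith) (Real.cos_le_one _)

/-- The inclination of the ray is at most its angle with the wall plus the inclination of the wall.
It bounds how fast the ray can change height. -/
theorem IsProfile.sin_direction_le (hf : IsProfile f)
    (hpos : ∀ x, 0 < x → 0 < deriv (deriv f) x) {ζ : ℝ × ℝ} (hζ : ζ ∈ phaseSpace)
    (hT : returnMap f ζ ∈ phaseSpace) :
    |(velocity f ζ).2| ≤
      Real.sin (returnMap f ζ).2 + -deriv f (abscissa f (returnMap f ζ).1) := by
  obtain ⟨hσ1, hσ2⟩ := sq_eq_one_of_mem_collisionQuadrants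
    (hf.quadrant_mem hpos hζ (collisionPoint_fst_ne_zero hT.1))
  have hx := hf.abscissa_pos hpos hT.1
  have hcos := cos_returnMap (f := f) ζ
  rw [tangentialSpeed_eq, ← hf.abscissa_returnMap hpos] at hcos
  have hS : 0 < Real.sin (returnMap f ζ).2 := Real.sin_pos_of_pos_of_lt_pi hT.2.1 hT.2.2
  have hle := sin_wallAngle_le (hf.deriv_neg hpos hx)
  have hs0 : 0 < Real.sin (wallAngle f (abscissa f (returnMap f ζ).1)) :=
    Real.sin_pos_of_pos_of_lt_pi (wallAngle_pos (hf.deriv_neg hpos hx))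
      (by linarith [(wallAngle_mem (f := f) (abscissa f (returnMap f ζ).1)).2, Real.pi_pos])
  have hc1 := Real.cos_le_one (wallAngle f (abscissa f (returnMap f ζ).1))
  have hc0 := cos_wallAngle_pos (f := f) (abscissa f (returnMap f ζ).1)
  have hpyΘ := Real.sin_sq_add_cos_sq (ζ.2 + wallAngle f (abscissa f ζ.1))
  have hpy1 := Real.sin_sq_add_cos_sq (wallAngle f (abscissa f (returnMap f ζ).1))
  have hpyφ := Real.sin_sq_add_cos_sq (returnMap f ζ).2
  have hCle : |Real.cos (returnMap f ζ).2| ≤ 1 := Real.abs_cos_le_one _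
  rw [velocity_eq]
  simp only [abs_neg]
  refine le_trans ?_ (add_le_add_right hle _)
  generalize Real.sin (ζ.2 + wallAngle f (abscissa f ζ.1)) = sΘ at *
  generalize Real.cos (ζ.2 + wallAngle f (abscissa f ζ.1)) = cΘ at *
  generalize Real.sin (wallAngle f (abscissa f (returnMap f ζ).1)) = s₁ at *
  generalize Real.cos (wallAngle f (abscissa f (returnMap f ζ).1)) = c₁ at *
  generalize Real.sin (returnMap f ζ).2 = S at *
  generalize Real.cos (returnMap f ζ).2 = Cφ at *
  generalize (quadrant f ζ).1 = p at *
  generalize (quadrant f ζ).2 = t at *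
  set q := -p * c₁ * sΘ + t * s₁ * cΘ with hq
  have hq2 : q ^ 2 = S ^ 2 := by
    rw [hq]
    subst hcos
    linear_combination hpyφ * (-1) + (c₁ ^ 2 * sΘ ^ 2 + cΘ ^ 2 * c₁ ^ 2) * hσ1 +
      (s₁ ^ 2 * cΘ ^ 2 + sΘ ^ 2 * s₁ ^ 2) * hσ2 + (c₁ ^ 2 + s₁ ^ 2) * hpyΘ + hpy1
  have hqS : |q| = S := by rw [← abs_of_pos hS]; exact (sq_eq_sq_iff_abs_eq_abs q S).1 hq2
  have hp : |p| = 1 := by rw [← abs_one]; exact (sq_eq_sq_iff_abs_eq_abs p 1).1 (by simpa using hσ1)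
  have ht : |t| = 1 := by rw [← abs_one]; exact (sq_eq_sq_iff_abs_eq_abs t 1).1 (by simpa using hσ2)
  -- Rotation back from the frame of the wall to the horizontal frame.
  have e : sΘ = -p * c₁ * q + t * s₁ * Cφ := by
    rw [hq, hcos]
    linear_combination (-c₁ ^ 2 * sΘ) * hσ1 - s₁ ^ 2 * sΘ * hσ2 - sΘ * hpy1
  rw [e]
  refine (abs_add_le _ _).trans ?_
  rw [abs_mul, abs_mul, abs_mul, abs_mul, abs_neg, hp, ht, hqS, abs_of_pos hc0, abs_of_pos hs0,
    one_mul, one_mul]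
  nlinarith

/-- In the cusp, line elements that are nearly tangential have a flight time before the collision
bounded away from zero, so the nested cone is thin. -/
theorem IsProfile.abs_snd_le_of_mem_nestedCone (hf : IsProfile f)
    (hpos : ∀ x, 0 < x → 0 < deriv (deriv f) x) {K X : ℝ} (hK : 1 ≤ K) (hX : 1 ≤ X)
    (hKX : ∀ x, X ≤ x → deriv (deriv f) x ≤ K * -deriv f x ∧ -deriv f x ≤ K * f x)
    {M : ℝ} (hM : 0 ≤ M) {ζ : ℝ × ℝ} (hζ : ζ ∈ phaseSpace) (hx : X ≤ abscissa f ζ.1)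
    (hs : Real.sin ζ.2 ≤ M * -deriv f (abscissa f ζ.1)) {v : ℝ × ℝ}
    (hv : v ∈ nestedCone f ζ) :
    |v.2| ≤ (K + M * (1 + M) * K) * -deriv f (abscissa f ζ.1) * |v.1| := by
  obtain ⟨z, hz, rfl, u, hu, rfl⟩ := hv
  have hz' := hz.1
  refine (hf.abs_fderiv_returnMap_snd_le hpos hz' hζ hu).trans ?_
  refine mul_le_mul_of_nonneg_right ?_ (abs_nonneg _)
  have hxpos := hf.abscissa_pos hpos hζ.1
  have hfx := hf.pos _ hxpos.le
  obtain ⟨hK1, hK2⟩ := hKX _ hx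
  have hk := (curvature_le (hpos _ hxpos)).trans hK1
  have hη : 0 < -deriv f (abscissa f (returnMap f z).1) := by
    linarith [hf.deriv_neg hpos hxpos]
  obtain ⟨hτ, -⟩ := hf.flightTime_spec hpos hz'
  have hv1 : |(velocity f z).1| ≤ 1 := by
    rw [← sq_le_one_iff_abs_le_one]; nlinarith [velocity_sq (f := f) z]
  have hx0 := hf.abscissa_pos hpos hz'.1
  -- A ray that crosses the vertical axis travels at least the new abscissa, which is at least `1`.
  -- Otherwise the height drops by at least `f x`, at a rate at most `(1 + M) |f' x| ≤ (1 + M) K f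
  -- x`.
  have hτK : 1 ≤ flightTime f z * ((1 + M) * K) := by
    have hMK : 1 ≤ (1 + M) * K := by nlinarith
    obtain ⟨hc1, hc2⟩ := hf.collisionPoint_eq hpos hz'
    have hdir := hf.sin_direction_le hpos hz' hζ
    rw [← hf.abscissa_returnMap hpos, collisionPoint_fst] at hc1
    rw [← hf.abscissa_returnMap hpos, collisionPoint_snd] at hc2
    have hσ := hf.quadrant_mem hpos hz' (collisionPoint_fst_ne_zero hζ.1)
    generalize quadrant f z = σ at *
    have left : σ.1 = -1 → 1 ≤ flightTime f z * ((1 + M) * K) := by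
      intro h
      rw [h] at hc1
      have : flightTime f z * |(velocity f z).1| ≤ flightTime f z * 1 :=
        mul_le_mul_of_nonneg_left hv1 hτ.le
      have h2 : flightTime f z * -|(velocity f z).1| ≤ flightTime f z * (velocity f z).1 :=
        mul_le_mul_of_nonneg_left (neg_abs_le _) hτ.le
      nlinarith
    rcases hσ with rfl | rfl | rfl
    · exact left rfl
    · exact left rfl
    · simp only at hc2
      have hy0 := hf.pos _ hx0.le
      have h1 : f (abscissa f (returnMap f z).1) ≤ flightTime f z * |(velocity f z).2| := by
        have h2 : flightTime f z * -|(velocity f z).2| ≤ flightTime f z * (velocity f z).2 :=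
          mul_le_mul_of_nonneg_left (neg_abs_le _) hτ.le
        nlinarith
      have h3 : |(velocity f z).2| ≤ (1 + M) * K * f (abscissa f (returnMap f z).1) := by
        nlinarith
      have h4 := mul_le_mul_of_nonneg_left h3 hτ.le
      have h5 : 1 * f (abscissa f (returnMap f z).1) ≤
          flightTime f z * ((1 + M) * K) * f (abscissa f (returnMap f z).1) := by linarith
      exact le_of_mul_le_mul_right h5 hfx
  have hdiv : Real.sin (returnMap f z).2 / flightTime f z ≤
      M * (1 + M) * K * -deriv f (abscissa f (returnMap f z).1) := by
    rw [div_le_iff₀ hτ]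
    have : 0 ≤ M * -deriv f (abscissa f (returnMap f z).1) := by positivity
    nlinarith
  linarith

end NestedCone

/-! ### The singularity curves -/

section Singularities

variable {f : ℝ → ℝ}

/-- `m` is the slope of the line from `(x, f x)` that is tangent to the wall in the second
quadrant. -/
def IsLeftSlope (f : ℝ → ℝ) (x m : ℝ) : Prop :=
  ∃ s, 0 < s ∧ m = -deriv f s ∧ f x = f s + m * (x + s)

/-- `m` is the slope of the line from `(x, f x)` that supports the wall in the fourth quadrant, at
the vertex or tangentially. -/
def IsRightSlope (f : ℝ → ℝ) (x m : ℝ) : Prop :=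
  ∃ s, 0 ≤ s ∧ s < x ∧ 0 < m ∧ f x + f s = m * (x - s) ∧
    (∀ X, 0 ≤ X → f s + m * s ≤ f X + m * X) ∧ (s = 0 ∨ (0 < s ∧ m = -deriv f s))

theorem cos_sq_arctan_mul (m : ℝ) : Real.cos (Real.arctan m) ^ 2 * (1 + m ^ 2) = 1 := by
  rw [Real.cos_sq_arctan, one_div, inv_mul_cancel₀ (by positivity)]

/-- Dictionary between angles and slopes: all questions about the shape of `F^{1+}` and `F^{2+}`
become questions about slopes of supporting lines of the graph of `f`. -/
theorem angle_eq_of_slope (hd : ∀ x, 0 < x → deriv f x < 0) {ζ : ℝ × ℝ} (hζ : ζ ∈ phaseSpace)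
    (hx : 0 < abscissa f ζ.1) {m : ℝ} (hm : 0 < m) (h₁ : (velocity f ζ).1 < 0)
    (h₂ : (velocity f ζ).2 = m * (velocity f ζ).1) :
    ζ.2 = Real.pi - Real.arctan m - wallAngle f (abscissa f ζ.1) := by
  have hsq := velocity_sq (f := f) ζ
  have hcm := cos_sq_arctan_mul m
  have hcpos := Real.cos_arctan_pos m
  have hv1 : (velocity f ζ).1 = -Real.cos (Real.arctan m) := by
    rw [h₂] at hsq
    have h3 : ((velocity f ζ).1 ^ 2 - Real.cos (Real.arctan m) ^ 2) * (1 + m ^ 2) = 0 := by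
      linear_combination hsq - hcm
    have h4 : (velocity f ζ).1 ^ 2 - Real.cos (Real.arctan m) ^ 2 = 0 :=
      (mul_eq_zero.1 h3).resolve_right (by positivity)
    nlinarith
  have hsm : Real.sin (Real.arctan m) = m * Real.cos (Real.arctan m) := by
    rw [Real.sin_arctan, Real.cos_arctan]; ring
  have hv2 : (velocity f ζ).2 = -Real.sin (Real.arctan m) := by
    rw [h₂, hv1, hsm]; ring
  rw [velocity_eq] at hv1 hv2
  simp only at hv1 hv2
  have ha := wallAngle_pos (hd _ hx)
  have ha' := (wallAngle_mem (f := f) (abscissa f ζ.1)).2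
  have hb := Real.arctan_pos.2 hm
  have hb' := Real.arctan_lt_pi_div_two m
  refine Real.injOn_cos ⟨hζ.2.1.le, hζ.2.2.le⟩ ⟨by linarith, by linarith⟩ ?_
  have e : ζ.2 = (ζ.2 + wallAngle f (abscissa f ζ.1)) - wallAngle f (abscissa f ζ.1) := by ring
  rw [e, Real.cos_sub, hv1, sub_sub, Real.cos_pi_sub, Real.cos_add]
  linear_combination (-Real.sin (wallAngle f (abscissa f ζ.1))) * hv2

/-- Tangential speed `±1` leaves no normal component. In the second and fourth quadrants, `σ.1 * σ.2
= -1`, unfolding reverses the sign of the wall slope. -/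
theorem velocity_parallel_of_tangential {ζ : ℝ × ℝ} (hσ : quadrant f ζ ∈ collisionQuadrants)
    (hσ' : (quadrant f ζ).1 * (quadrant f ζ).2 = -1) (h : |tangentialSpeed f ζ| = 1) :
    (velocity f ζ).2 = -deriv f |(collisionPoint f ζ).1| * (velocity f ζ).1 := by
  obtain ⟨hσ1, hσ2⟩ := sq_eq_one_of_mem_collisionQuadrants hσ
  have h' : tangentialSpeed f ζ ^ 2 = 1 := by rw [← sq_abs, h, one_pow]
  rw [tangentialSpeed_eq] at h'
  rw [velocity_eq]
  simp only
  have hpyΘ := Real.sin_sq_add_cos_sq (ζ.2 + wallAngle f (abscissa f ζ.1))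
  have hpy1 := Real.sin_sq_add_cos_sq (wallAngle f |(collisionPoint f ζ).1|)
  have hs := sin_wallAngle_eq (f := f) |(collisionPoint f ζ).1|
  have hc := cos_wallAngle_pos (f := f) |(collisionPoint f ζ).1|
  generalize Real.sin (ζ.2 + wallAngle f (abscissa f ζ.1)) = sΘ at *
  generalize Real.cos (ζ.2 + wallAngle f (abscissa f ζ.1)) = cΘ at *
  generalize Real.sin (wallAngle f |(collisionPoint f ζ).1|) = s₁ at *
  generalize Real.cos (wallAngle f |(collisionPoint f ζ).1|) = c₁ at *
  generalize (quadrant f ζ).1 = p at *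
  generalize (quadrant f ζ).2 = t at *
  have hq : (c₁ * sΘ + s₁ * cΘ) ^ 2 = 0 := by
    linear_combination -h' + (c₁ ^ 2 * cΘ ^ 2) * hσ1 + (s₁ ^ 2 * sΘ ^ 2) * hσ2 +
      2 * c₁ * cΘ * s₁ * sΘ * hσ' + (c₁ ^ 2 + s₁ ^ 2) * hpyΘ + hpy1
  have hq' : c₁ * sΘ + s₁ * cΘ = 0 := by simpa using hq
  rw [hs] at hq'
  refine mul_left_cancel₀ hc.ne' ?_
  linear_combination -hq'

theorem IsProfile.exists_isLeftSlope (hf : IsProfile f)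
    (hpos : ∀ x, 0 < x → 0 < deriv (deriv f) x) {ζ : ℝ × ℝ} (hζ : ζ ∈ singPlus f 1) :
    ∃ m, 0 < m ∧ IsLeftSlope f (abscissa f ζ.1) m ∧
      ζ.2 = Real.pi - Real.arctan m - wallAngle f (abscissa f ζ.1) := by
  obtain ⟨hp, h1, h2, h3⟩ := hζ
  have hx := hf.abscissa_pos hpos hp.1
  have hq : quadrant f ζ = (-1, 1) := by
    rw [quadrant, Real.sign_of_neg h1, Real.sign_of_pos h2]
  have hpar := velocity_parallel_of_tangential (hf.quadrant_mem hpos hp h1.ne)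
    (by rw [hq]; norm_num) h3
  obtain ⟨hτ, -⟩ := hf.flightTime_spec hpos hp
  obtain ⟨hc1, hc2⟩ := hf.collisionPoint_eq hpos hp
  have hs : 0 < |(collisionPoint f ζ).1| := abs_pos.2 h1.ne
  have hm := hf.deriv_neg hpos hs
  have hv : (velocity f ζ).1 < 0 := by
    rw [collisionPoint_fst] at h1
    by_contra! h
    nlinarith [mul_nonneg hτ.le h]
  rw [hq] at hc1 hc2
  rw [collisionPoint_fst] at hc1
  rw [collisionPoint_snd, hpar] at hc2
  simp only at hc1 hc2
  rw [collisionPoint_fst] at hc2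
  refine ⟨-deriv f |(collisionPoint f ζ).1|, by linarith, ⟨_, hs, rfl, ?_⟩,
    angle_eq_of_slope (fun x => hf.deriv_neg hpos) hp hx (by linarith) hv hpar⟩
  rw [collisionPoint_fst]
  linear_combination hc2 +
    deriv f |abscissa f ζ.1 + flightTime f ζ * (velocity f ζ).1| * hc1

theorem IsProfile.exists_isRightSlope (hf : IsProfile f)
    (hpos : ∀ x, 0 < x → 0 < deriv (deriv f) x) {ζ : ℝ × ℝ} (hζ : ζ ∈ singPlus f 2) :
    ∃ m, 0 < m ∧ IsRightSlope f (abscissa f ζ.1) m ∧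
      ζ.2 = Real.pi - Real.arctan m - wallAngle f (abscissa f ζ.1) := by
  obtain ⟨hp, h2, h3⟩ := hζ
  have hx := hf.abscissa_pos hpos hp.1
  have hfx := hf.pos _ hx.le
  obtain ⟨hτ, -⟩ := hf.flightTime_spec hpos hp
  obtain ⟨hc1, hc2⟩ := hf.collisionPoint_eq hpos hp
  have hq2 : (quadrant f ζ).2 = -1 := by rw [quadrant, Real.sign_of_neg h2]
  rw [hq2] at hc2
  rcases h3 with h0 | ⟨h1, h3⟩
  · rw [h0, abs_zero, collisionPoint_snd] at hc2
    rw [collisionPoint_fst] at h0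
    have hf0 := hf.pos 0 le_rfl
    have hv : (velocity f ζ).1 < 0 := by
      by_contra! h
      nlinarith [mul_nonneg hτ.le h]
    set m := (f (abscissa f ζ.1) + f 0) / abscissa f ζ.1 with hmdef
    have hm : 0 < m := by positivity
    have hmx : m * abscissa f ζ.1 = f (abscissa f ζ.1) + f 0 := div_mul_cancel₀ _ hx.ne'
    have hpar : (velocity f ζ).2 = m * (velocity f ζ).1 := by
      refine mul_left_cancel₀ hτ.ne' ?_
      linear_combination hc2 - m * h0 + hmx
    refine ⟨m, hm, ⟨0, le_rfl, hx, hm, by linarith, fun X hX => ?_, Or.inl rfl⟩,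
      angle_eq_of_slope (fun x => hf.deriv_neg hpos) hp hx hm hv hpar⟩
    rcases hX.eq_or_lt with rfl | hX0
    · exact le_rfl
    -- The line through the vertex supports the lower wall: beyond the starting abscissa because
    -- already `m X ≥ f x + f 0`, before it because the ray reaches the vertex without an earlier
    -- collision.
    rcases le_or_gt (abscissa f ζ.1) X with hXx | hXx
    · have := hf.pos X hX
      nlinarith [mul_le_mul_of_nonneg_left hXx hm.le]
    · set t := (abscissa f ζ.1 - X) / -(velocity f ζ).1 with ht
      have htv : t * (velocity f ζ).1 = X - abscissa f ζ.1 := by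
        rw [ht, div_neg, neg_mul, div_mul_cancel₀ _ hv.ne]; ring
      have ht0 : 0 < t := div_pos (by linarith) (by linarith)
      have htτ : t < flightTime f ζ := by
        by_contra! h
        nlinarith
      have := hf.abs_ray_lt hpos hp ht0 htτ
      rw [ray_fst, ray_snd, hpar, htv, add_sub_cancel, abs_of_pos hX0, abs_lt] at this
      have e : t * (m * (velocity f ζ).1) = m * (X - abscissa f ζ.1) := by rw [← htv]; ring
      rw [e] at this
      linarith [this.1]
  · have hq : quadrant f ζ = (1, -1) := by
      rw [quadrant, Real.sign_of_neg h2, Real.sign_of_pos h1]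
    have hpar := velocity_parallel_of_tangential (hf.quadrant_mem hpos hp h1.ne')
      (by rw [hq]; norm_num) h3
    rw [abs_of_pos h1] at hc2 hpar
    have hm := hf.deriv_neg hpos h1
    set s := (collisionPoint f ζ).1 with hs
    have hs' : s = abscissa f ζ.1 + flightTime f ζ * (velocity f ζ).1 := rfl
    rw [collisionPoint_snd] at hc2
    have hfs := hf.pos s h1.le
    have hv2 : (velocity f ζ).2 < 0 := by
      by_contra! h
      nlinarith [mul_nonneg hτ.le h]
    have hv : (velocity f ζ).1 < 0 := by
      by_contra! h
      nlinarith
    refine ⟨-deriv f s, by linarith, ⟨s, h1.le, ?_, by linarith, ?_, fun X hX => ?_,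
      Or.inr ⟨h1, rfl⟩⟩,
      angle_eq_of_slope (fun x => hf.deriv_neg hpos) hp hx (by linarith) hv hpar⟩
    · rw [hs']; nlinarith
    · rw [hpar] at hc2
      linear_combination hc2 - deriv f s * hs'
    · linarith [hf.tangent_le h1 hX]

/-- The tangent at `s` lies below the graph at `s'`. As `x` grows, the starting point sinks and
recedes, so a steeper line from it could no longer touch the wall. -/
theorem IsLeftSlope.antitone (hf : IsProfile f)
    (hpos : ∀ x, 0 < x → 0 < deriv (deriv f) x) {x x' m m' : ℝ} (hx : 0 < x) (hxx' : x ≤ x')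
    (h : IsLeftSlope f x m) (h' : IsLeftSlope f x' m') : m' ≤ m := by
  obtain ⟨s, hs, rfl, he⟩ := h
  obtain ⟨s', hs', hm', he'⟩ := h'
  by_contra! hlt
  have h1 := hf.tangent_le hs hs'.le
  have h2 : f x' ≤ f x := (hf.strictAntiOn hpos).antitoneOn (mem_Ici.2 hx.le)
    (mem_Ici.2 (hx.le.trans hxx')) hxx'
  have hm := hf.deriv_neg hpos hs
  nlinarith [mul_pos (sub_pos.2 hlt) hs', mul_pos (sub_pos.2 hlt) hx,
    mul_nonneg (neg_nonneg.2 hm.le) (sub_nonneg.2 hxx'),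
    mul_nonneg (sub_pos.2 hlt).le (sub_nonneg.2 hxx')]

/-- The supporting line from `x'` is tested at the contact abscissa `s` of the line from `x`; the
support inequality treats vertex and tangency alike. -/
theorem IsRightSlope.antitone (hf : IsProfile f)
    (hpos : ∀ x, 0 < x → 0 < deriv (deriv f) x) {x x' m m' : ℝ} (hx : 0 < x) (hxx' : x ≤ x')
    (h : IsRightSlope f x m) (h' : IsRightSlope f x' m') : m' ≤ m := by
  obtain ⟨s, hs, hsx, hm, he, -, -⟩ := h
  obtain ⟨s', hs', hsx', hm', he', hmin, -⟩ := h'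
  by_contra! hlt
  have h1 := hmin s hs
  have h2 : f x' ≤ f x := (hf.strictAntiOn hpos).antitoneOn (mem_Ici.2 hx.le)
    (mem_Ici.2 (hx.le.trans hxx')) hxx'
  nlinarith [mul_pos (sub_pos.2 hlt) (show 0 < x' - s by linarith),
    mul_nonneg hm.le (sub_nonneg.2 hxx')]

/-- The line rises from the tangency to `x`, so `f s < f x`: the tangency is farther out than `x`,
where the wall is flatter. -/
theorem IsLeftSlope.le (hf : IsProfile f)
    (hpos : ∀ x, 0 < x → 0 < deriv (deriv f) x) {x m : ℝ} (hx : 0 < x)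
    (h : IsLeftSlope f x m) : m ≤ -deriv f x := by
  obtain ⟨s, hs, rfl, he⟩ := h
  have hm := hf.deriv_neg hpos hs
  have h1 : f s < f x := by nlinarith
  have h2 : x < s := ((hf.strictAntiOn hpos).lt_iff_gt (mem_Ici.2 hs.le) (mem_Ici.2 hx.le)).1 h1
  linarith [hf.strictMonoOn_deriv hpos (mem_Ioi.2 hx) (mem_Ioi.2 hs) h2]

/-- This is `A2` once the vertex is ruled out. A line supporting at the vertex has slope at least `f
0 - f 1`, by comparison with abscissa `1`, but also slope `(f x + f 0) / x`, which is too small for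
large `x`. -/
theorem IsProfile.exists_isRightSlope_le (hf : IsProfile f)
    (hpos : ∀ x, 0 < x → 0 < deriv (deriv f) x) (h₂ : A2 f) :
    ∃ C X : ℝ, 1 ≤ C ∧ ∀ x, X ≤ x → ∀ m, IsRightSlope f x m → m ≤ C * -deriv f x := by
  obtain ⟨C, hC⟩ := h₂
  obtain ⟨X₀, hX₀⟩ := eventually_atTop.1 hC
  have h01 : f 1 < f 0 := hf.strictAntiOn hpos (mem_Ici.2 le_rfl) (mem_Ici.2 zero_le_one) one_pos
  set X := max (max X₀ 1) ((2 * f 0 + 1) / (f 0 - f 1))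
  refine ⟨max C 1, X, le_max_right _ _, fun x hx m hm => ?_⟩
  have hx1 : X₀ ≤ x := (le_max_left _ _).trans ((le_max_left _ _).trans hx)
  have hx2 : 1 ≤ x := (le_max_right _ _).trans ((le_max_left _ _).trans hx)
  have hx3 : (2 * f 0 + 1) / (f 0 - f 1) ≤ x := (le_max_right _ _).trans hx
  have hx0 : 0 < x := by linarith
  have hd := hf.deriv_neg hpos hx0
  obtain ⟨s, hs, hsx, hm0, he, hmin, hcase⟩ := hm
  rcases hcase with rfl | ⟨hs0, hms⟩
  · exfalso
    rw [div_le_iff₀ (by linarith)] at hx3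
    have h1 := hmin 1 zero_le_one
    have h2 : f x ≤ f 0 := (hf.strictAntiOn hpos).antitoneOn (mem_Ici.2 le_rfl)
      (mem_Ici.2 hx0.le) hx0.le
    nlinarith
  · have := hX₀ x hx1 s ⟨hs0, hsx, by rw [he, hms, mul_div_cancel_right₀ _ (by linarith)]⟩
    rw [abs_of_neg hd, abs_of_neg (hf.deriv_neg hpos hs0), ← hms] at this
    exact this.trans (mul_le_mul_of_nonneg_right (le_max_left _ _) (by linarith))

/-- Support at `s'`, tested at `s`, gives `(m - m') (x + s) ≤ f x - f x' + m' (x' - x)`. Both terms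
on the right are at most `|f' x| (x' - x)`, and `x + s ≥ 1`. -/
theorem IsLeftSlope.sub_le (hf : IsProfile f)
    (hpos : ∀ x, 0 < x → 0 < deriv (deriv f) x) {x x' m m' : ℝ} (hx : 1 ≤ x) (hxx' : x ≤ x')
    (h : IsLeftSlope f x m) (h' : IsLeftSlope f x' m') :
    m - m' ≤ 2 * -deriv f x * (x' - x) := by
  have hx0 : 0 < x := by linarith
  have hle := IsLeftSlope.le hf hpos (by linarith) h'
  have hanti := IsLeftSlope.antitone hf hpos hx0 hxx' h h'
  have hd : deriv f x ≤ deriv f x' := (hf.strictMonoOn_deriv hpos).monotoneOn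
    (mem_Ioi.2 hx0) (mem_Ioi.2 (by linarith)) hxx'
  have htan := hf.tangent_le hx0 (show (0 : ℝ) ≤ x' by linarith)
  obtain ⟨s, hs, hm, he⟩ := h
  obtain ⟨s', hs', hm', he'⟩ := h'
  have h1 := hf.tangent_le hs' hs.le
  have h2 : (m - m') * x ≤ (-deriv f x + m') * (x' - x) := by
    rw [← neg_eq_iff_eq_neg.2 hm'] at h1
    nlinarith [mul_nonneg (sub_nonneg.2 hanti) hs.le]
  have h3 : (-deriv f x + m') * (x' - x) ≤ 2 * -deriv f x * (x' - x) :=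
    mul_le_mul_of_nonneg_right (by linarith) (by linarith)
  nlinarith [mul_nonneg (sub_nonneg.2 hanti) (sub_nonneg.2 hx)]

/-- As for left slopes, but the lever arm is now `x - s'`. From `f x' ≤ m' (x' - s')` and `m' ≤ C K
f x'` one gets `x' - s' ≥ 1 / (C K)`; the bound on `x' - x` gives up half of it. -/
theorem IsRightSlope.sub_le (hf : IsProfile f)
    (hpos : ∀ x, 0 < x → 0 < deriv (deriv f) x) {x x' m m' C K : ℝ} (hC : 1 ≤ C) (hK : 1 ≤ K)
    (hx : 0 < x) (hxx' : x ≤ x') (hfK : -deriv f x' ≤ K * f x') (hmC : m' ≤ C * -deriv f x')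
    (hδ : x' - x ≤ 1 / (2 * C * K))
    (h : IsRightSlope f x m) (h' : IsRightSlope f x' m') :
    m - m' ≤ 2 * C * K * (1 + C) * -deriv f x * (x' - x) := by
  have hanti := IsRightSlope.antitone hf hpos hx hxx' h h'
  have hd : deriv f x ≤ deriv f x' := (hf.strictMonoOn_deriv hpos).monotoneOn
    (mem_Ioi.2 hx) (mem_Ioi.2 (by linarith)) hxx'
  have hdn := hf.deriv_neg hpos hx
  have htan := hf.tangent_le hx (show (0 : ℝ) ≤ x' by linarith)
  obtain ⟨s, hs, hsx, hm, he, hmin, -⟩ := h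
  obtain ⟨s', hs', hsx', hm', he', -, -⟩ := h'
  have h1 := hmin s' hs'
  have hfx' := hf.pos x' (by linarith)
  have hfs' := hf.pos s' hs'
  have hCK : 0 < C * K := by positivity
  -- the distance to the tangency is bounded below
  have hdist : 1 ≤ C * K * (x' - s') := by
    have h2 : m' ≤ C * K * f x' := by nlinarith
    have h3 : f x' ≤ m' * (x' - s') := by linarith
    have h4 : m' * (x' - s') ≤ C * K * f x' * (x' - s') :=
      mul_le_mul_of_nonneg_right h2 (by linarith)
    have h5 : 1 * f x' ≤ C * K * (x' - s') * f x' := by linarith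
    exact le_of_mul_le_mul_right h5 hfx'
  have hdist' : 1 ≤ 2 * C * K * (x - s') := by
    rw [le_div_iff₀ (by positivity)] at hδ
    nlinarith
  have h2 : (m - m') * (x - s') ≤ (-deriv f x + m') * (x' - x) := by nlinarith
  have h3 : (-deriv f x + m') * (x' - x) ≤ (1 + C) * -deriv f x * (x' - x) := by
    refine mul_le_mul_of_nonneg_right ?_ (by linarith)
    nlinarith
  have h4 : (m - m') * 1 ≤ (m - m') * (2 * C * K * (x - s')) :=
    mul_le_mul_of_nonneg_left hdist' (by linarith)
  have h5 : 2 * (C * K) * ((m - m') * (x - s')) ≤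
      2 * (C * K) * ((1 + C) * -deriv f x * (x' - x)) :=
    mul_le_mul_of_nonneg_left (h2.trans h3) (by positivity)
  linarith

end Singularities

/-! ### Monotonicity, size and Lipschitz constants of the singularity curves -/

section SingularBounds

variable {f : ℝ → ℝ}

/-- The absolute slope of the wall as a function of arc length. -/
noncomputable def wallSlope (f : ℝ → ℝ) (r : ℝ) : ℝ := -deriv f (abscissa f r)

theorem IsProfile.wallSlope_pos (hf : IsProfile f)
    (hpos : ∀ x, 0 < x → 0 < deriv (deriv f) x) {r : ℝ} (hr : 0 < r) : 0 < wallSlope f r := by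
  rw [wallSlope, neg_pos]
  exact hf.deriv_neg hpos (hf.abscissa_pos hpos hr)

theorem IsProfile.wallSlope_anti (hf : IsProfile f)
    (hpos : ∀ x, 0 < x → 0 < deriv (deriv f) x) {r r' : ℝ} (hr : 0 < r) (h : r ≤ r') :
    wallSlope f r' ≤ wallSlope f r :=
  neg_le_neg ((hf.strictMonoOn_deriv hpos).monotoneOn (mem_Ioi.2 (hf.abscissa_pos hpos hr))
    (mem_Ioi.2 (hf.abscissa_pos hpos (hr.trans_le h))) (hf.abscissa_sub_mem hpos hr.le h).1)

theorem IsProfile.le_abscissa (hf : IsProfile f)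
    (hpos : ∀ x, 0 < x → 0 < deriv (deriv f) x) {X r : ℝ} (hX : 0 ≤ X)
    (hr : arcLength f X ≤ r) : X ≤ abscissa f r := by
  have := (hf.abscissa_sub_mem hpos (hf.arcLength_nonneg hpos hX) hr).1
  rwa [hf.abscissa_arcLength hpos hX] at this

/-- In the cusp, the slope changes by a factor of at most `2` over a bounded distance. -/
theorem IsProfile.wallSlope_le_two_mul (hf : IsProfile f)
    (hpos : ∀ x, 0 < x → 0 < deriv (deriv f) x) {K X : ℝ} (hK : 1 ≤ K) (hX : 1 ≤ X)
    (hKX : ∀ x, X ≤ x → deriv (deriv f) x ≤ K * -deriv f x)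
    {r r' : ℝ} (hr : arcLength f X ≤ r) (hr' : arcLength f X ≤ r')
    (h : |r - r'| ≤ Real.log 2 / K) : wallSlope f r ≤ 2 * wallSlope f r' := by
  have hR : 0 < arcLength f X := by
    have := hf.sub_le_arcLength_sub hpos le_rfl (show 0 ≤ X by linarith)
    rw [arcLength_zero] at this
    linarith
  have hp := hf.wallSlope_pos hpos (hR.trans_le hr')
  rcases le_total r r' with hle | hle
  · obtain ⟨h1, h2⟩ := hf.abscissa_sub_mem hpos (hR.le.trans hr) hle
    have h3 := hf.neg_deriv_le_exp_mul hX hKX (hf.le_abscissa hpos (by linarith) hr) h1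
    refine h3.trans (mul_le_mul_of_nonneg_right ?_ hp.le)
    rw [← Real.exp_log (show (0 : ℝ) < 2 by norm_num)]
    apply Real.exp_le_exp.2
    rw [abs_sub_comm, abs_of_nonneg (by linarith), le_div_iff₀ (by linarith)] at h
    nlinarith
  · have := hf.wallSlope_anti hpos (hR.trans_le hr') hle
    linarith

theorem abs_arctan_sub_le (a b : ℝ) : |Real.arctan a - Real.arctan b| ≤ |a - b| := by
  have := Convex.norm_image_sub_le_of_norm_deriv_le (f := Real.arctan) (s := univ) (C := 1)
    (fun x _ => Real.differentiable_arctan x) (fun x _ => ?_) convex_univ (mem_univ b) (mem_univ a)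
  · simpa [Real.norm_eq_abs] using this
  · rw [Real.deriv_arctan, Real.norm_of_nonneg (by positivity)]
    rw [div_le_one (by positivity)]
    nlinarith [sq_nonneg x]

theorem arctan_le_self_of_nonneg {a : ℝ} (ha : 0 ≤ a) : Real.arctan a ≤ a := by
  have := abs_arctan_sub_le a 0
  rw [Real.arctan_zero, sub_zero, sub_zero, abs_of_nonneg ha] at this
  exact (le_abs_self _).trans this

theorem IsProfile.wallAngle_anti (hf : IsProfile f)
    (hpos : ∀ x, 0 < x → 0 < deriv (deriv f) x) {x x' : ℝ} (hx : 0 < x) (h : x ≤ x') :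
    wallAngle f x' ≤ wallAngle f x :=
  neg_le_neg (Real.arctan_strictMono.monotone ((hf.strictMonoOn_deriv hpos).monotoneOn
    (mem_Ioi.2 hx) (mem_Ioi.2 (hx.trans_le h)) h))

/-- The singularity curves are increasing graphs over the arc length. -/
theorem IsProfile.singPlus_mono (hf : IsProfile f)
    (hpos : ∀ x, 0 < x → 0 < deriv (deriv f) x) (i : Fin 3) {ζ ζ' : ℝ × ℝ}
    (hζ : ζ ∈ singPlus f i) (hζ' : ζ' ∈ singPlus f i) (h : ζ.1 ≤ ζ'.1) : ζ.2 ≤ ζ'.2 := by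
  have main : ∀ {m m' : ℝ}, 0 < ζ.1 → m' ≤ m →
      Real.pi - Real.arctan m - wallAngle f (abscissa f ζ.1) ≤
        Real.pi - Real.arctan m' - wallAngle f (abscissa f ζ'.1) := by
    intro m m' h0 hm
    have h1 := hf.wallAngle_anti hpos (hf.abscissa_pos hpos h0)
      (hf.abscissa_sub_mem hpos h0.le h).1
    have h2 := Real.arctan_strictMono.monotone hm
    linarith
  fin_cases i
  · exact (hζ.2.trans hζ'.2.symm : ζ.2 = ζ'.2).le
  · have h0 : 0 < ζ.1 := hζ.1.1
    obtain ⟨m, -, hm, e⟩ := hf.exists_isLeftSlope hpos hζ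
    obtain ⟨m', -, hm', e'⟩ := hf.exists_isLeftSlope hpos hζ'
    rw [e, e']
    exact main h0 (hm.antitone hf hpos (hf.abscissa_pos hpos h0)
      (hf.abscissa_sub_mem hpos h0.le h).1 hm')
  · have h0 : 0 < ζ.1 := hζ.1.1
    obtain ⟨m, -, hm, e⟩ := hf.exists_isRightSlope hpos hζ
    obtain ⟨m', -, hm', e'⟩ := hf.exists_isRightSlope hpos hζ'
    rw [e, e']
    exact main h0 (hm.antitone hf hpos (hf.abscissa_pos hpos h0)
      (hf.abscissa_sub_mem hpos h0.le h).1 hm')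

theorem IsProfile.sin_angle_le (hf : IsProfile f)
    (hpos : ∀ x, 0 < x → 0 < deriv (deriv f) x) {x m : ℝ} (hx : 0 < x) (hm : 0 < m) :
    Real.sin (Real.pi - Real.arctan m - wallAngle f x) ≤ m + -deriv f x := by
  have ha := wallAngle_pos (hf.deriv_neg hpos hx)
  have hb := Real.arctan_pos.2 hm
  have h1 := arctan_le_self_of_nonneg hm.le
  have h2 : wallAngle f x ≤ -deriv f x := by
    rw [wallAngle, ← Real.arctan_neg]
    exact arctan_le_self_of_nonneg (by linarith [hf.deriv_neg hpos hx])
  rw [sub_sub, Real.sin_pi_sub]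
  exact (Real.sin_le (by linarith)).trans (by linarith)

theorem IsProfile.abs_wallAngle_sub_le (hf : IsProfile f)
    (hpos : ∀ x, 0 < x → 0 < deriv (deriv f) x) {K X : ℝ} (hK : 1 ≤ K) (hX : 1 ≤ X)
    (hKX : ∀ x, X ≤ x → deriv (deriv f) x ≤ K * -deriv f x) {x x' : ℝ} (hx : X ≤ x)
    (hxx' : x ≤ x') :
    |wallAngle f x' - wallAngle f x| ≤ K * -deriv f x * (x' - x) := by
  have h1 : |wallAngle f x' - wallAngle f x| ≤ |deriv f x' - deriv f x| := by
    have := abs_arctan_sub_le (deriv f x) (deriv f x')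
    rw [abs_sub_comm (deriv f x') (deriv f x)]
    refine le_trans (le_of_eq ?_) this
    rw [wallAngle, wallAngle]
    congr 1; ring
  refine h1.trans ?_
  have := Convex.norm_image_sub_le_of_norm_deriv_le (f := deriv f) (s := Icc x x')
    (C := K * -deriv f x)
    (fun y hy => hf.differentiable₂ y (by linarith [hy.1])) (fun y hy => ?_) (convex_Icc x x')
    (left_mem_Icc.2 hxx') (right_mem_Icc.2 hxx')
  · rwa [Real.norm_eq_abs, Real.norm_eq_abs, abs_of_nonneg (sub_nonneg.2 hxx')] at this
  · have hy0 : 0 < y := by linarith [hy.1]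
    rw [Real.norm_of_nonneg (hpos y hy0).le]
    refine (hKX y (hx.trans hy.1)).trans (mul_le_mul_of_nonneg_left ?_ (by linarith))
    exact neg_le_neg ((hf.strictMonoOn_deriv hpos).monotoneOn (mem_Ioi.2 (by linarith))
      (mem_Ioi.2 hy0) hy.1)

/-- In the cusp the singularity curves are close to the tangential directions, at a distance
`O(|f'|)`, and are locally Lipschitz with constant `O(|f'|)`. -/
theorem IsProfile.exists_singPlus_bounds (hf : IsProfile f)
    (hpos : ∀ x, 0 < x → 0 < deriv (deriv f) x) (h₂ : A2 f) {K X : ℝ} (hK : 1 ≤ K) (hX : 1 ≤ X)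
    (hKX : ∀ x, X ≤ x → deriv (deriv f) x ≤ K * -deriv f x ∧ -deriv f x ≤ K * f x) :
    ∃ C R δ : ℝ, 0 < C ∧ 0 < δ ∧
      (∀ i, ∀ ζ ∈ singPlus f i, R ≤ ζ.1 → Real.sin ζ.2 ≤ C * wallSlope f ζ.1) ∧
      (∀ i, i ≠ 0 → ∀ ζ ∈ singPlus f i, ∀ ζ' ∈ singPlus f i, R ≤ ζ.1 → ζ.1 ≤ ζ'.1 →
        ζ'.1 ≤ ζ.1 + δ → |ζ'.2 - ζ.2| ≤ C * wallSlope f ζ.1 * (ζ'.1 - ζ.1)) := by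
  obtain ⟨C₀, X₀, hC₀, hR⟩ := hf.exists_isRightSlope_le hpos h₂
  set X₁ := max X X₀
  have hX₁ : 0 ≤ X₁ := by
    have : X ≤ X₁ := le_max_left _ _
    linarith
  have hRpos : 0 < arcLength f X₁ := by
    have h1 : X ≤ X₁ := le_max_left _ _
    have := hf.sub_le_arcLength_sub hpos le_rfl hX₁
    rw [arcLength_zero] at this
    linarith
  -- Sum of the Lipschitz constants of the right slopes, of the wall angle and of the left slopes,
  -- in units of `|f'|`; it also exceeds the `C₀ + 1` needed for the sine.
  set C := 2 * C₀ * K * (1 + C₀) + K + 2 with hC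
  have hCK : 1 ≤ C₀ * K := one_le_mul_of_one_le_of_one_le hC₀ hK
  have hCge : C₀ + 1 ≤ C := by nlinarith
  have lip : ∀ {ζ ζ' : ℝ × ℝ} {m m' : ℝ}, arcLength f X₁ ≤ ζ.1 → ζ.1 ≤ ζ'.1 → m' ≤ m →
      m - m' ≤ (2 * C₀ * K * (1 + C₀) + 2) * wallSlope f ζ.1 *
        (abscissa f ζ'.1 - abscissa f ζ.1) →
      |(Real.pi - Real.arctan m' - wallAngle f (abscissa f ζ'.1)) -
        (Real.pi - Real.arctan m - wallAngle f (abscissa f ζ.1))| ≤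
        C * wallSlope f ζ.1 * (ζ'.1 - ζ.1) := by
    intro ζ ζ' m m' h1 h2 h3 h4
    have h0 : 0 < ζ.1 := hRpos.trans_le h1
    obtain ⟨hx1, hx2⟩ := hf.abscissa_sub_mem hpos h0.le h2
    have hxX : X ≤ abscissa f ζ.1 := (le_max_left _ _).trans (hf.le_abscissa hpos hX₁ h1)
    have h5 := hf.abs_wallAngle_sub_le hpos hK hX (fun x hx => (hKX x hx).1) hxX hx1
    have h6 := abs_arctan_sub_le m m'
    rw [abs_of_nonneg (sub_nonneg.2 h3)] at h6
    have hη := hf.wallSlope_pos hpos h0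
    have e : (Real.pi - Real.arctan m' - wallAngle f (abscissa f ζ'.1)) -
        (Real.pi - Real.arctan m - wallAngle f (abscissa f ζ.1)) =
        (Real.arctan m - Real.arctan m') -
        (wallAngle f (abscissa f ζ'.1) - wallAngle f (abscissa f ζ.1)) := by ring
    rw [e]
    refine (abs_sub _ _).trans ((add_le_add (h6.trans h4) h5).trans ?_)
    change _ + K * wallSlope f ζ.1 * _ ≤ _
    have h7 : C * wallSlope f ζ.1 * (abscissa f ζ'.1 - abscissa f ζ.1) ≤
        C * wallSlope f ζ.1 * (ζ'.1 - ζ.1) :=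
      mul_le_mul_of_nonneg_left hx2 (by positivity)
    refine le_trans (le_of_eq ?_) h7
    rw [hC]; ring
  refine ⟨C, arcLength f X₁, 1 / (2 * C₀ * K), by positivity, by positivity, ?_, ?_⟩
  · intro i ζ hζ hr
    have h0 : 0 < ζ.1 := hRpos.trans_le hr
    have hx0 := hf.abscissa_pos hpos h0
    have hη := hf.wallSlope_pos hpos h0
    have hX₁' := hf.le_abscissa hpos hX₁ hr
    have h1 : (C₀ + 1) * wallSlope f ζ.1 ≤ C * wallSlope f ζ.1 :=
      mul_le_mul_of_nonneg_right hCge hη.le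
    have fin : ∀ {m : ℝ}, 0 < m → m ≤ C₀ * wallSlope f ζ.1 →
        ζ.2 = Real.pi - Real.arctan m - wallAngle f (abscissa f ζ.1) →
        Real.sin ζ.2 ≤ C * wallSlope f ζ.1 := by
      intro m hm hmC e
      have h2 := hf.sin_angle_le hpos hx0 hm
      rw [← e] at h2
      change _ ≤ m + wallSlope f ζ.1 at h2
      linarith
    fin_cases i
    · have h2 : ζ.2 = Real.pi := hζ.2
      rw [h2, Real.sin_pi]
      positivity
    · obtain ⟨m, hm, hms, e⟩ := hf.exists_isLeftSlope hpos hζ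
      refine fin hm ?_ e
      have := hms.le hf hpos hx0
      change m ≤ wallSlope f ζ.1 at this
      nlinarith
    · obtain ⟨m, hm, hms, e⟩ := hf.exists_isRightSlope hpos hζ
      exact fin hm (hR _ ((le_max_right _ _).trans hX₁') m hms) e
  · intro i hi ζ hζ ζ' hζ' hr hrr' hδ
    have h0 : 0 < ζ.1 := hRpos.trans_le hr
    have hx0 := hf.abscissa_pos hpos h0
    have hη := hf.wallSlope_pos hpos h0
    obtain ⟨hx1, hx2⟩ := hf.abscissa_sub_mem hpos h0.le hrr'
    have hX₁' := hf.le_abscissa hpos hX₁ hr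
    have hxX : X ≤ abscissa f ζ.1 := (le_max_left _ _).trans hX₁'
    have hnn : 0 ≤ wallSlope f ζ.1 * (abscissa f ζ'.1 - abscissa f ζ.1) :=
      mul_nonneg hη.le (sub_nonneg.2 hx1)
    have hnn' : 0 ≤ 2 * C₀ * K * (1 + C₀) *
        (wallSlope f ζ.1 * (abscissa f ζ'.1 - abscissa f ζ.1)) := mul_nonneg (by positivity) hnn
    fin_cases i
    · exact absurd rfl hi
    · obtain ⟨m, hm, hms, e⟩ := hf.exists_isLeftSlope hpos hζ
      obtain ⟨m', hm', hms', e'⟩ := hf.exists_isLeftSlope hpos hζ'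
      rw [e, e']
      refine lip hr hrr' (hms.antitone hf hpos hx0 hx1 hms') ?_
      have := hms.sub_le hf hpos (hX.trans hxX) hx1 hms'
      change _ ≤ 2 * wallSlope f ζ.1 * _ at this
      linarith
    · obtain ⟨m, hm, hms, e⟩ := hf.exists_isRightSlope hpos hζ
      obtain ⟨m', hm', hms', e'⟩ := hf.exists_isRightSlope hpos hζ'
      rw [e, e']
      refine lip hr hrr' (hms.antitone hf hpos hx0 hx1 hms') ?_
      have := hms.sub_le hf hpos hC₀ hK hx0 hx1 (hKX _ (hxX.trans hx1)).2
        (hR _ (((le_max_right _ _).trans hX₁').trans hx1) m' hms') (by linarith) hms'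
      change _ ≤ 2 * C₀ * K * (1 + C₀) * wallSlope f ζ.1 * _ at this
      linarith

end SingularBounds

/-! ### Curves of finite length -/

section Length

/-- The total variation controls the integral of the derivative. -/
theorem integral_abs_deriv_le {g : ℝ → ℝ} {ε : ℝ} (hε : 0 ≤ ε)
    (hg : eVariationOn g (Icc 0 1) ≤ ENNReal.ofReal ε)
    (hd : ∀ t ∈ Ioo (0 : ℝ) 1, DifferentiableAt ℝ g t) :
    IntervalIntegrable (deriv g) volume 0 1 ∧ ∫ t in (0 : ℝ)..1, |deriv g t| ≤ ε := by
  have hbv : BoundedVariationOn g (Icc 0 1) := ne_top_of_le_ne_top ENNReal.ofReal_ne_top hg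
  have hloc := hbv.locallyBoundedVariationOn
  have h01 : (0 : ℝ) ≤ 1 := zero_le_one
  have hint : IntervalIntegrable (deriv g) volume 0 1 := by
    apply BoundedVariationOn.intervalIntegrable_deriv
    rwa [uIcc_of_le h01]
  refine ⟨hint, ?_⟩
  -- The variation function dominates the increments of `g`, so `|g'| ≤ V'` almost everywhere; being
  -- monotone, `V` satisfies `∫ V' ≤ V 1 - V 0`.
  set V : ℝ → ℝ := variationOnFromTo g (Icc 0 1) 0
  have h0 : (0 : ℝ) ∈ Icc (0 : ℝ) 1 := by simp
  have hV : MonotoneOn V (Icc 0 1) := variationOnFromTo.monotoneOn hloc h0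
  have hV' : MonotoneOn V (uIcc 0 1) := by rwa [uIcc_of_le h01]
  have hle : ∀ᵐ t ∂volume, t ∈ Ioo (0 : ℝ) 1 → |deriv g t| ≤ deriv V t := by
    filter_upwards [hV.ae_differentiableWithinAt_of_mem] with t ht ht'
    have hnhds : Icc (0 : ℝ) 1 ∈ 𝓝 t := Icc_mem_nhds ht'.1 ht'.2
    have hVd := ((ht (Ioo_subset_Icc_self ht')).differentiableAt hnhds).hasDerivAt
    have hgd := (hd t ht').hasDerivAt
    have l1 : Tendsto (fun s => |slope g t s|) (𝓝[>] t) (𝓝 |deriv g t|) :=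
      (hgd.tendsto_slope.mono_left (nhdsGT_le_nhdsNE t)).abs
    have l2 : Tendsto (fun s => slope V t s) (𝓝[>] t) (𝓝 (deriv V t)) :=
      hVd.tendsto_slope.mono_left (nhdsGT_le_nhdsNE t)
    refine le_of_tendsto_of_tendsto l1 l2 ?_
    filter_upwards [self_mem_nhdsWithin, nhdsWithin_le_nhds hnhds] with s hs hs'
    have hst : 0 < s - t := sub_pos.2 hs
    rw [slope_def_field, slope_def_field, abs_div, abs_of_pos hst]
    exact div_le_div_of_nonneg_right (variationOnFromTo.abs_sub_le_sub_of_le hloc h0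
      (Ioo_subset_Icc_self ht') hs' (le_of_lt hs)) hst.le
  calc ∫ t in (0 : ℝ)..1, |deriv g t| ≤ ∫ t in (0 : ℝ)..1, deriv V t := by
        refine intervalIntegral.integral_mono_ae_restrict h01 hint.abs
          hV'.intervalIntegrable_deriv ?_
        rw [← restrict_Ioo_eq_restrict_Icc]
        exact (ae_restrict_iff' measurableSet_Ioo).2 hle
    _ ≤ V 1 - V 0 := by
        have h1 := hV'.intervalIntegral_deriv_mem_uIcc
        have h2 : V 0 ≤ V 1 := hV h0 (by simp) h01
        rw [uIcc_of_le (sub_nonneg.2 h2)] at h1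
        exact h1.2
    _ = (eVariationOn g (Icc 0 1)).toReal := by
        simp only [V]
        rw [variationOnFromTo.self, variationOnFromTo.eq_of_le _ _ h01, inter_self, sub_zero]
    _ ≤ ε := ENNReal.toReal_le_of_le_ofReal hε hg

theorem lipschitzWith_withLp_fst : LipschitzWith 1 fun p : WithLp 2 (ℝ × ℝ) => p.fst :=
  LipschitzWith.of_dist_le_mul fun p q => by
    rw [NNReal.coe_one, one_mul, dist_eq_norm, dist_eq_norm]
    exact WithLp.norm_fst_le ℝ (p - q)

theorem lipschitzWith_withLp_snd : LipschitzWith 1 fun p : WithLp 2 (ℝ × ℝ) => p.snd :=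
  LipschitzWith.of_dist_le_mul fun p q => by
    rw [NNReal.coe_one, one_mul, dist_eq_norm, dist_eq_norm]
    exact WithLp.norm_snd_le ℝ (p - q)

theorem eVariationOn_fst_le (γ : ℝ → ℝ × ℝ) :
    eVariationOn (fun t => (γ t).1) (Icc 0 1) ≤ curveLength γ := by
  have := (lipschitzWith_withLp_fst.lipschitzOnWith (s := univ)).comp_eVariationOn_le
    (g := fun t => WithLp.toLp 2 (γ t)) (s := Icc (0 : ℝ) 1) (fun _ _ => mem_univ _)
  rw [ENNReal.coe_one, one_mul] at this
  exact this

theorem eVariationOn_snd_le (γ : ℝ → ℝ × ℝ) :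
    eVariationOn (fun t => (γ t).2) (Icc 0 1) ≤ curveLength γ := by
  have := (lipschitzWith_withLp_snd.lipschitzOnWith (s := univ)).comp_eVariationOn_le
    (g := fun t => WithLp.toLp 2 (γ t)) (s := Icc (0 : ℝ) 1) (fun _ _ => mem_univ _)
  rw [ENNReal.coe_one, one_mul] at this
  exact this

theorem abs_sub_le_of_eVariationOn_le {g : ℝ → ℝ} {ε : ℝ} (hε : 0 ≤ ε)
    (hg : eVariationOn g (Icc 0 1) ≤ ENNReal.ofReal ε) {s t : ℝ} (hs : s ∈ Icc (0 : ℝ) 1)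
    (ht : t ∈ Icc (0 : ℝ) 1) : |g s - g t| ≤ ε := by
  have h := (eVariationOn.edist_le g hs ht).trans hg
  rw [edist_dist, Real.dist_eq] at h
  exact (ENNReal.ofReal_le_ofReal_iff hε).1 h

/-- Almost every time at which a curve is in a set is an accumulation point of such times. -/
theorem ae_neBot_nhdsWithin (E : Set ℝ) : ∀ᵐ t : ℝ, t ∈ E → (𝓝[E ∩ Ioi t] t).NeBot := by
  -- A subset of the line has only countably many points isolated from the right.
  have h : (volume : Measure ℝ) {t ∈ E | 𝓝[E ∩ Ioi t] t = ⊥} = 0 :=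
    (countable_setOfPred_isolated_right_within (s := E)).measure_zero volume
  filter_upwards [measure_eq_zero_iff_ae_notMem.1 h] with t ht htE
  exact ⟨fun hb => ht ⟨htE, hb⟩⟩

/-- Derivatives that exist can be computed along any set accumulating at `t`, so a Lipschitz
relation valid only at times in `E` passes to them. -/
theorem abs_deriv_le_of_frequently {g r : ℝ → ℝ} {t H : ℝ} {E : Set ℝ}
    (hg : DifferentiableAt ℝ g t) (hr : DifferentiableAt ℝ r t) [(𝓝[E ∩ Ioi t] t).NeBot]
    (h : ∀ᶠ s in 𝓝[E ∩ Ioi t] t, |g s - g t| ≤ H * |r s - r t|) :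
    |deriv g t| ≤ H * |deriv r t| := by
  have hle : 𝓝[E ∩ Ioi t] t ≤ 𝓝[≠] t :=
    nhdsWithin_mono t fun s hs => (ne_of_gt hs.2 : s ≠ t)
  have l1 := (hg.hasDerivAt.tendsto_slope.mono_left hle).abs
  have l2 := (hr.hasDerivAt.tendsto_slope.mono_left hle).abs.const_mul H
  refine le_of_tendsto_of_tendsto l1 l2 ?_
  filter_upwards [h, self_mem_nhdsWithin] with s hs hs'
  have hst : 0 < s - t := sub_pos.2 hs'.2
  rw [slope_def_field, slope_def_field, abs_div, abs_div, ← mul_div_assoc]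
  exact div_le_div_of_nonneg_right hs (abs_nonneg _)

/-- A continuity argument: if `φ` moves at a speed at most `A |r'|` as long as `u φ ≤ B`, with `u`
contracting, then `u φ ≤ B` persists along a short curve. -/
theorem abs_sub_le_of_bootstrap {r φ u : ℝ → ℝ} {A B ε : ℝ} (hA : 0 ≤ A)
    (hu : ∀ x y, |u x - u y| ≤ |x - y|) (hφc : ContinuousOn φ (Icc 0 1))
    (hφd : ∀ t ∈ Ioo (0 : ℝ) 1, DifferentiableAt ℝ φ t)
    (hφi : IntervalIntegrable (deriv φ) volume 0 1)
    (hri : IntervalIntegrable (deriv r) volume 0 1)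
    (hr : ∫ t in (0 : ℝ)..1, |deriv r t| ≤ ε)
    (h : ∀ᵐ t : ℝ, t ∈ Ioo (0 : ℝ) 1 → u (φ t) ≤ B → |deriv φ t| ≤ A * |deriv r t|)
    (h1 : u (φ 1) + A * ε < B) : |φ 0 - φ 1| ≤ A * ε := by
  -- Control starts at the end `1`, which lies on the singularity curve, and is integrated
  -- backwards. The endpoint `a` is left out of the assumption so that `a` may be the last time at
  -- which `u φ ≥ B`.
  have key : ∀ a ∈ Icc (0 : ℝ) 1, (∀ t ∈ Ioc a 1, u (φ t) ≤ B) → |φ a - φ 1| ≤ A * ε := by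
    intro a ha hB
    have hsub : uIcc a 1 ⊆ uIcc 0 1 := by
      rw [uIcc_of_le ha.2, uIcc_of_le zero_le_one]
      exact Icc_subset_Icc_left ha.1
    have hφi' := hφi.mono_set hsub
    have hri' := hri.mono_set hsub
    have e : ∫ t in a..1, deriv φ t = φ 1 - φ a :=
      intervalIntegral.integral_eq_sub_of_hasDerivAt_of_le ha.2
        (hφc.mono (Icc_subset_Icc_left ha.1))
        (fun t ht => (hφd t ⟨ha.1.trans_lt ht.1, ht.2⟩).hasDerivAt) hφi'
    rw [abs_sub_comm, ← e]
    calc |∫ t in a..1, deriv φ t| ≤ ∫ t in a..1, |deriv φ t| :=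
          intervalIntegral.abs_integral_le_integral_abs ha.2
      _ ≤ ∫ t in a..1, A * |deriv r t| := by
          refine intervalIntegral.integral_mono_ae_restrict ha.2 hφi'.abs
            (hri'.abs.const_mul A) ?_
          rw [← restrict_Ioo_eq_restrict_Icc]
          refine (ae_restrict_iff' measurableSet_Ioo).2 ?_
          filter_upwards [h] with t ht ht'
          exact ht ⟨ha.1.trans_lt ht'.1, ht'.2⟩ (hB t ⟨ht'.1, ht'.2.le⟩)
      _ = A * ∫ t in a..1, |deriv r t| := intervalIntegral.integral_const_mul _ _
      _ ≤ A * ∫ t in (0 : ℝ)..1, |deriv r t| := by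
          refine mul_le_mul_of_nonneg_left ?_ hA
          exact intervalIntegral.integral_mono_interval ha.1 ha.2 le_rfl
            (Eventually.of_forall fun t => abs_nonneg _) hri.abs
      _ ≤ A * ε := mul_le_mul_of_nonneg_left hr hA
  have huc : Continuous u := by
    have : LipschitzWith 1 u := LipschitzWith.of_dist_le_mul fun x y => by
      simpa [Real.dist_eq] using hu x y
    exact this.continuous
  have hcont : ContinuousOn (fun t => u (φ t)) (Icc 0 1) := huc.comp_continuousOn hφc
  have hε : 0 ≤ A * ε := by
    refine mul_nonneg hA (le_trans ?_ hr)
    exact intervalIntegral.integral_nonneg zero_le_one fun t _ => abs_nonneg _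
  refine key 0 (by simp) ?_
  by_contra! hex
  obtain ⟨t₀, ht₀, hBt₀⟩ := hex
  set S := {t ∈ Icc (0 : ℝ) 1 | B ≤ u (φ t)}
  have hSc : IsCompact S := by
    refine isCompact_Icc.of_isClosed_subset ?_ fun t ht => ht.1
    exact hcont.preimage_isClosed_of_isClosed isClosed_Icc isClosed_Ici
  obtain ⟨a, haS, hamax⟩ := hSc.exists_isGreatest ⟨t₀, ⟨ht₀.1.le, ht₀.2⟩, hBt₀.le⟩
  have h2 := key a haS.1 fun t ht => by
    by_contra! hlt
    exact absurd (hamax ⟨⟨haS.1.1.trans ht.1.le, ht.2⟩, hlt.le⟩) (not_le.2 ht.1)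
  have h3 := (le_abs_self _).trans (hu (φ a) (φ 1))
  have h4 := haS.2
  linarith

end Length

/-! ### Unstable curves in the cusp -/

section UnstableCurves

variable {f : ℝ → ℝ}

theorem abs_sin_sub_sin_le (x y : ℝ) : |Real.sin x - Real.sin y| ≤ |x - y| := by
  simpa [Real.dist_eq] using Real.lipschitzWith_sin.dist_le_mul x y

/-- The velocity of an unstable curve in the cusp, at a nearly tangential line element: also along
the singularity curves, for almost every time. -/
theorem IsProfile.ae_abs_deriv_le (hf : IsProfile f)
    (hpos : ∀ x, 0 < x → 0 < deriv (deriv f) x) {K X : ℝ} (hK : 1 ≤ K) (hX : 1 ≤ X)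
    (hKX : ∀ x, X ≤ x → deriv (deriv f) x ≤ K * -deriv f x ∧ -deriv f x ≤ K * f x)
    {C R δ M ε : ℝ} (hC : 0 < C) (hM : 0 ≤ M)
    (hlip : ∀ i, i ≠ 0 → ∀ ζ ∈ singPlus f i, ∀ ζ' ∈ singPlus f i, R ≤ ζ.1 → ζ.1 ≤ ζ'.1 →
        ζ'.1 ≤ ζ.1 + δ → |ζ'.2 - ζ.2| ≤ C * wallSlope f ζ.1 * (ζ'.1 - ζ.1))
    (hεδ : ε ≤ δ) (hεK : ε ≤ Real.log 2 / K) {ζ w : ℝ × ℝ} {γ : ℝ → ℝ × ℝ}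
    (hγ : IsUnstableCurve f ζ w γ)
    (hvar : ∀ s ∈ Icc (0 : ℝ) 1, ∀ t ∈ Icc (0 : ℝ) 1, |(γ s).1 - (γ t).1| ≤ ε)
    (hR : ∀ t ∈ Icc (0 : ℝ) 1, max (arcLength f X) R ≤ (γ t).1) :
    ∀ᵐ t : ℝ, t ∈ Ioo (0 : ℝ) 1 → Real.sin (γ t).2 ≤ M * wallSlope f (γ t).1 →
      |deriv (fun s => (γ s).2) t| ≤
        (K + M * (1 + M) * K + 2 * C) * wallSlope f (γ t).1 * |deriv (fun s => (γ s).1) t| := by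
  have hD : 0 ≤ K + M * (1 + M) * K := by positivity
  filter_upwards [ae_neBot_nhdsWithin {t ∈ Ioo (0 : ℝ) 1 | γ t ∈ singMinus f 1},
    ae_neBot_nhdsWithin {t ∈ Ioo (0 : ℝ) 1 | γ t ∈ singMinus f 2}] with t hE1 hE2 ht hsin
  have hmem := hγ.mem_phaseSpace t ht
  have hd := hγ.differentiable t ht
  have hd1 : DifferentiableAt ℝ (fun s => (γ s).1) t := hd.fst
  have hd2 : DifferentiableAt ℝ (fun s => (γ s).2) t := hd.snd
  have hη := hf.wallSlope_pos hpos hmem.1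
  have htI := Ioo_subset_Icc_self ht
  have hRt := hR t htI
  -- While on `F^{i-}` the curve inherits its Lipschitz constant. The estimate `hlip` uses the slope
  -- at the left one of the two points; the factor `2` moves it to `γ t`.
  have sing : ∀ i : Fin 3, i ≠ 0 →
      (t ∈ {t ∈ Ioo (0 : ℝ) 1 | γ t ∈ singMinus f i} →
        (𝓝[{t ∈ Ioo (0 : ℝ) 1 | γ t ∈ singMinus f i} ∩ Ioi t] t).NeBot) →
      γ t ∈ singMinus f i → |deriv (fun s => (γ s).2) t| ≤
        2 * C * wallSlope f (γ t).1 * |deriv (fun s => (γ s).1) t| := by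
    intro i hi hE hmi
    have := hE ⟨ht, hmi⟩
    refine abs_deriv_le_of_frequently
      (E := {t ∈ Ioo (0 : ℝ) 1 | γ t ∈ singMinus f i}) hd2 hd1 ?_
    filter_upwards [self_mem_nhdsWithin] with s hs
    have hsI := Ioo_subset_Icc_self hs.1.1
    have hsi : γ s ∈ singMinus f i := hs.1.2
    have hRs := hR s hsI
    have hst := hvar s hsI t htI
    rcases le_total (γ t).1 (γ s).1 with hle | hle
    · rw [abs_of_nonneg (sub_nonneg.2 hle)] at hst ⊢
      have h1 := hlip i hi _ hmi _ hsi ((le_max_right _ _).trans hRt) hle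
        (by change (γ s).1 ≤ (γ t).1 + δ; linarith)
      simp only at h1
      rw [show Real.pi - (γ s).2 - (Real.pi - (γ t).2) = -((γ s).2 - (γ t).2) by ring,
        abs_neg] at h1
      refine h1.trans (mul_le_mul_of_nonneg_right ?_ (sub_nonneg.2 hle))
      nlinarith
    · have hst' := hst
      rw [abs_sub_comm] at hst' ⊢
      rw [abs_sub_comm (γ s).1]
      rw [abs_of_nonneg (sub_nonneg.2 hle)] at hst' ⊢
      have h1 := hlip i hi _ hsi _ hmi ((le_max_right _ _).trans hRs) hle
        (by change (γ t).1 ≤ (γ s).1 + δ; linarith)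
      simp only at h1
      rw [show Real.pi - (γ t).2 - (Real.pi - (γ s).2) = -((γ t).2 - (γ s).2) by ring,
        abs_neg] at h1
      refine h1.trans (mul_le_mul_of_nonneg_right ?_ (sub_nonneg.2 hle))
      have h2 := hf.wallSlope_le_two_mul hpos hK hX (fun x hx => (hKX x hx).1)
        ((le_max_left _ _).trans hRs) ((le_max_left _ _).trans hRt) (hst.trans hεK)
      nlinarith
  have hnn : 0 ≤ wallSlope f (γ t).1 * |deriv (fun s => (γ s).1) t| :=
    mul_nonneg hη.le (abs_nonneg _)
  have hnn1 := mul_nonneg hD hnn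
  have hnn2 := mul_nonneg hC.le hnn
  by_cases hs : γ t ∈ singMinusSet f
  · have h1 : |deriv (fun s => (γ s).2) t| ≤
        2 * C * wallSlope f (γ t).1 * |deriv (fun s => (γ s).1) t| := by
      rcases hs with hs | hs
      · exact sing 1 (by decide) hE1 hs
      · exact sing 2 (by decide) hE2 hs
    linarith
  · have h1 := hf.abs_snd_le_of_mem_nestedCone hpos hK hX hKX hM hmem
      (hf.le_abscissa hpos (by linarith) ((le_max_left _ _).trans hRt)) hsin
      (hγ.deriv_mem t ht hs)
    have g1 : HasDerivAt (fun s => (γ s).1) (deriv γ t).1 t := hd.hasDerivAt.fst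
    have g2 : HasDerivAt (fun s => (γ s).2) (deriv γ t).2 t := hd.hasDerivAt.snd
    have e1 := g1.deriv
    have e2 := g2.deriv
    rw [e1] at hnn1 hnn2 ⊢
    rw [e2]
    change _ ≤ _ * wallSlope f (γ t).1 * _ at h1
    linarith

/-- Along a short unstable curve that ends in a singularity curve in the cusp, the angle changes
by at most `O(|f'|)` times the length. -/
theorem IsProfile.exists_unstable_bound (hf : IsProfile f) (h₁ : A1 f) (h₂ : A2 f) (h₄ : A4 f) :
    ∃ C R ε₀ : ℝ, 0 < C ∧ 0 < R ∧ 0 < ε₀ ∧ ∀ (i : Fin 3) (F : Set (ℝ × ℝ)),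
      (F = singPlus f i ∨ F = singMinus f i) → ∀ (ζ w : ℝ × ℝ) (γ : ℝ → ℝ × ℝ) (ε : ℝ),
      0 ≤ ε → ε ≤ ε₀ → R ≤ ζ.1 → w ∈ F → IsUnstableCurve f ζ w γ →
      curveLength γ ≤ ENNReal.ofReal ε → |ζ.2 - w.2| ≤ ε * (C * wallSlope f ζ.1) := by
  have hpos : ∀ x, 0 < x → 0 < deriv (deriv f) x := h₄.1
  obtain ⟨K, X, hK, hX, hKX⟩ := hf.exists_bounds h₁ h₄
  obtain ⟨C₁, R₁, δ, hC₁, hδ, hsin, hlip⟩ := hf.exists_singPlus_bounds hpos h₂ hK hX hKX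
  set M := 2 * (2 * C₁ + 1) with hMdef
  set C := 2 * (K + M * (1 + M) * K + 2 * C₁) with hCdef
  have hM : 0 < M := by positivity
  have hC : 0 < C := by positivity
  have hRpos : 0 < arcLength f X := by
    have := hf.sub_le_arcLength_sub hpos le_rfl (show 0 ≤ X by linarith)
    rw [arcLength_zero] at this
    linarith
  set R₀ := max (arcLength f X) R₁ with hR₀
  have hR₀pos : 0 < R₀ := hRpos.trans_le (le_max_left _ _)
  have hlog : 0 < Real.log 2 := Real.log_pos (by norm_num)
  -- In turn: the curve, starting beyond `R₀ + 1`, stays beyond `R₀`; wall slopes along it agree up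
  -- to a factor `2`; the Lipschitz bound on `F^±` applies; the angle changes by at most half the
  -- margin of the continuity argument.
  set ε₀ := min (min 1 (Real.log 2 / K)) (min δ (1 / (2 * C))) with hε₀
  have hε₀pos : 0 < ε₀ := by positivity
  refine ⟨C, R₀ + 1, ε₀, hC, by linarith, hε₀pos, ?_⟩
  intro i F hF ζ w γ ε hε hεε₀ hRζ hw hγ hlen
  have he1 : ε ≤ 1 := hεε₀.trans ((min_le_left _ _).trans (min_le_left _ _))
  have he2 : ε ≤ Real.log 2 / K := hεε₀.trans ((min_le_left _ _).trans (min_le_right _ _))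
  have he3 : ε ≤ δ := hεε₀.trans ((min_le_right _ _).trans (min_le_left _ _))
  have he4 : ε ≤ 1 / (2 * C) := hεε₀.trans ((min_le_right _ _).trans (min_le_right _ _))
  have hv1 := (eVariationOn_fst_le γ).trans hlen
  have hv2 := (eVariationOn_snd_le γ).trans hlen
  have hvar : ∀ s ∈ Icc (0 : ℝ) 1, ∀ t ∈ Icc (0 : ℝ) 1, |(γ s).1 - (γ t).1| ≤ ε :=
    fun s hs t ht => abs_sub_le_of_eVariationOn_le (g := fun t => (γ t).1) hε hv1 hs ht
  have hI0 : (0 : ℝ) ∈ Icc (0 : ℝ) 1 := by simp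
  have hI1 : (1 : ℝ) ∈ Icc (0 : ℝ) 1 := by simp
  have hR : ∀ t ∈ Icc (0 : ℝ) 1, R₀ ≤ (γ t).1 := by
    intro t ht
    have := (abs_le.1 (hvar t ht 0 hI0)).1
    rw [hγ.source] at this
    linarith
  have hη := hf.wallSlope_pos hpos (show 0 < ζ.1 by linarith)
  have hcmp : ∀ t ∈ Icc (0 : ℝ) 1, wallSlope f (γ t).1 ≤ 2 * wallSlope f ζ.1 ∧
      wallSlope f ζ.1 ≤ 2 * wallSlope f (γ t).1 := by
    intro t ht
    have h1 := hvar t ht 0 hI0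
    have h2 := hvar 0 hI0 t ht
    have hζR := hR 0 hI0
    rw [hγ.source] at h1 h2 hζR
    exact ⟨hf.wallSlope_le_two_mul hpos hK hX (fun x hx => (hKX x hx).1)
        ((le_max_left _ _).trans (hR t ht)) ((le_max_left _ _).trans hζR) (h1.trans he2),
      hf.wallSlope_le_two_mul hpos hK hX (fun x hx => (hKX x hx).1)
        ((le_max_left _ _).trans hζR) ((le_max_left _ _).trans (hR t ht)) (h2.trans he2)⟩
  have hae := hf.ae_abs_deriv_le hpos hK hX hKX hC₁ hM.le hlip he3 he2 hγ hvar hR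
  have hd1 : ∀ t ∈ Ioo (0 : ℝ) 1, DifferentiableAt ℝ (fun s => (γ s).1) t :=
    fun t ht => (hγ.differentiable t ht).fst
  have hd2 : ∀ t ∈ Ioo (0 : ℝ) 1, DifferentiableAt ℝ (fun s => (γ s).2) t :=
    fun t ht => (hγ.differentiable t ht).snd
  obtain ⟨hi1, hint1⟩ := integral_abs_deriv_le hε hv1 hd1
  obtain ⟨hi2, -⟩ := integral_abs_deriv_le hε hv2 hd2
  have hend : Real.sin (γ 1).2 ≤ 2 * C₁ * wallSlope f ζ.1 := by
    have h1 : Real.sin (γ 1).2 ≤ C₁ * wallSlope f (γ 1).1 := by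
      have hR1 : R₁ ≤ (γ 1).1 := (le_max_right _ _).trans (hR 1 hI1)
      rw [hγ.target] at hR1 ⊢
      rcases hF with rfl | rfl
      · exact hsin i w hw hR1
      · have := hsin i _ hw hR1
        simpa [Real.sin_pi_sub] using this
    nlinarith [(hcmp 1 hI1).1]
  have hfin := abs_sub_le_of_bootstrap (r := fun s => (γ s).1) (φ := fun s => (γ s).2)
    (u := Real.sin) (A := C * wallSlope f ζ.1) (B := (2 * C₁ + 1) * wallSlope f ζ.1) (ε := ε)
    (by positivity) abs_sin_sub_sin_le hγ.continuousOn.snd hd2 hi2 hi1 hint1 ?_ ?_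
  · simp only [hγ.source, hγ.target] at hfin
    linarith
  · filter_upwards [hae] with t ht htI hB
    have htI' := Ioo_subset_Icc_self htI
    obtain ⟨hc1, hc2⟩ := hcmp t htI'
    refine (ht htI (hB.trans ?_)).trans (mul_le_mul_of_nonneg_right ?_ (abs_nonneg _))
    · rw [hMdef]; nlinarith
    · have : 0 ≤ K + M * (1 + M) * K + 2 * C₁ := by positivity
      rw [hCdef]; nlinarith
  · rw [le_div_iff₀ (by positivity)] at he4
    nlinarith

end UnstableCurves

/-! ### Measure of neighbourhoods of monotone graphs -/

section Neighbourhoods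

/-- The integral over `[0, N]` telescopes to `∫ G` over `[N - ε, N + ε]` minus `∫ G` over `[-ε, ε]`,
bounded independently of `N`. -/
theorem _root_.Monotone.integral_shift_sub_le {G : ℝ → ℝ} (hG : Monotone G) {b : ℝ}
    (h0 : ∀ r, 0 ≤ G r) (hb : ∀ r, G r ≤ b) {ε : ℝ} (hε : 0 ≤ ε) :
    IntegrableOn (fun r => G (r + ε) - G (r - ε)) (Ioi 0) ∧
      ∫ r in Ioi (0 : ℝ), (G (r + ε) - G (r - ε)) ≤ 2 * ε * b := by
  have hint : ∀ x y : ℝ, IntervalIntegrable G volume x y := fun x y => hG.intervalIntegrable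
  have hp : Monotone fun r => G (r + ε) := fun x y h => hG (by linarith)
  have hm : Monotone fun r => G (r - ε) := fun x y h => hG (by linarith)
  have hle : ∀ N : ℝ, 0 ≤ N → ∫ r in (0 : ℝ)..N, (G (r + ε) - G (r - ε)) ≤ 2 * ε * b := by
    intro N hN
    rw [intervalIntegral.integral_sub hp.intervalIntegrable hm.intervalIntegrable,
      intervalIntegral.integral_comp_add_right, intervalIntegral.integral_comp_sub_right,
      intervalIntegral.integral_interval_sub_interval_comm (hint _ _) (hint _ _) (hint _ _)]
    have h1 : ∫ r in (N - ε)..(N + ε), G r ≤ 2 * ε * b := by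
      have := intervalIntegral.integral_mono_on (show N - ε ≤ N + ε by linarith) (hint _ _)
        (intervalIntegrable_const (c := b)) fun r _ => hb r
      rw [intervalIntegral.integral_const, smul_eq_mul] at this
      linarith
    have h2 : 0 ≤ ∫ r in (0 - ε)..(0 + ε), G r :=
      intervalIntegral.integral_nonneg (by linarith) fun r _ => h0 r
    rw [intervalIntegral.integral_symm (N - ε) (N + ε)]
    rw [intervalIntegral.integral_symm (0 - ε) (0 + ε)]
    linarith
  have hInt : IntegrableOn (fun r => G (r + ε) - G (r - ε)) (Ioi 0) := by
    refine integrableOn_Ioi_of_intervalIntegral_norm_bounded (l := atTop) (b := fun n : ℕ => (n : ℝ))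
      (2 * ε * b) 0 (fun n => ?_) tendsto_natCast_atTop_atTop (Eventually.of_forall fun n => ?_)
    · exact ((hp.intervalIntegrable).sub (hm.intervalIntegrable)).1
    · refine le_trans (le_of_eq ?_) (hle n n.cast_nonneg)
      refine intervalIntegral.integral_congr fun r _ => ?_
      exact Real.norm_of_nonneg (sub_nonneg.2 (hG (by linarith)))
  refine ⟨hInt, ?_⟩
  refine le_of_tendsto (intervalIntegral_tendsto_integral_Ioi 0 hInt
    (tendsto_natCast_atTop_atTop (R := ℝ))) (Eventually.of_forall fun n => hle n n.cast_nonneg)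

/-- The set between the graphs of two functions. -/
theorem volume_between_le {l u : ℝ → ℝ} (hl : Measurable l) (hu : Measurable u)
    (hint : IntegrableOn (fun r => u r - l r) (Ioi 0)) (hlu : ∀ r, l r ≤ u r) :
    volume {p : ℝ × ℝ | 0 < p.1 ∧ l p.1 ≤ p.2 ∧ p.2 ≤ u p.1} ≤
      ENNReal.ofReal (∫ r in Ioi (0 : ℝ), (u r - l r)) := by
  have hmeas : MeasurableSet {p : ℝ × ℝ | 0 < p.1 ∧ l p.1 ≤ p.2 ∧ p.2 ≤ u p.1} :=
    (measurableSet_lt measurable_const measurable_fst).inter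
      ((measurableSet_le (hl.comp measurable_fst) measurable_snd).inter
        (measurableSet_le measurable_snd (hu.comp measurable_fst)))
  rw [Measure.volume_eq_prod, Measure.prod_apply hmeas,
    ofReal_integral_eq_lintegral_ofReal hint (Eventually.of_forall fun r => sub_nonneg.2 (hlu r)),
    ← lintegral_indicator measurableSet_Ioi]
  refine lintegral_mono fun r => ?_
  by_cases hr : 0 < r
  · rw [indicator_of_mem (mem_Ioi.2 hr), ← Real.volume_Icc]
    exact measure_mono fun y hy => hy.2
  · have : Prod.mk r ⁻¹' {p : ℝ × ℝ | 0 < p.1 ∧ l p.1 ≤ p.2 ∧ p.2 ≤ u p.1} = ∅ := by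
      ext y
      simp only [mem_preimage, mem_empty_iff_false, iff_false]
      exact fun hy => hr hy.1
    rw [this, measure_empty]
    exact zero_le

/-- Since `S` need not meet every vertical line, it is replaced by `G`, the supremum of its heights
up to abscissa `r`, with `0` inserted for abscissas to the left of `S`. Then `A` lies between `G (r
- ε) - ε h r` and `G (r + ε) + ε h r`. -/
theorem volume_le_of_monotone_graph {S A : Set (ℝ × ℝ)} {b ε : ℝ} {h : ℝ → ℝ} (hb : 0 ≤ b)
    (hε : 0 ≤ ε) (hS : ∀ w ∈ S, 0 ≤ w.2 ∧ w.2 ≤ b)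
    (hmono : ∀ w ∈ S, ∀ w' ∈ S, w.1 ≤ w'.1 → w.2 ≤ w'.2) (hh : Measurable h)
    (hh0 : ∀ r, 0 ≤ h r) (hint : IntegrableOn h (Ioi 0))
    (hA : ∀ ζ ∈ A, 0 < ζ.1 ∧ ∃ w ∈ S, |ζ.1 - w.1| ≤ ε ∧ |ζ.2 - w.2| ≤ ε * h ζ.1) :
    volume A ≤ ENNReal.ofReal (2 * (b + ∫ r in Ioi (0 : ℝ), h r) * ε) := by
  set T : ℝ → Set ℝ := fun r => insert 0 {y | ∃ w ∈ S, w.1 ≤ r ∧ w.2 = y}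
  set G : ℝ → ℝ := fun r => sSup (T r)
  have hTb : ∀ r, ∀ y ∈ T r, y ≤ b := by
    rintro r y (rfl | ⟨w, hw, -, rfl⟩)
    · exact hb
    · exact (hS w hw).2
  have hTbdd : ∀ r, BddAbove (T r) := fun r => ⟨b, hTb r⟩
  have hTne : ∀ r, (T r).Nonempty := fun r => ⟨0, mem_insert _ _⟩
  have hG0 : ∀ r, 0 ≤ G r := fun r => le_csSup (hTbdd r) (mem_insert _ _)
  have hGb : ∀ r, G r ≤ b := fun r => csSup_le (hTne r) (hTb r)
  have hG : Monotone G := fun x y hxy => by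
    refine csSup_le_csSup (hTbdd y) (hTne x) (insert_subset_insert ?_)
    rintro _ ⟨w, hw, hwx, rfl⟩
    exact ⟨w, hw, hwx.trans hxy, rfl⟩
  obtain ⟨hi, hile⟩ := hG.integral_shift_sub_le hG0 hGb hε
  have hsub : A ⊆ {p : ℝ × ℝ | 0 < p.1 ∧ G (p.1 - ε) - ε * h p.1 ≤ p.2 ∧
      p.2 ≤ G (p.1 + ε) + ε * h p.1} := by
    intro ζ hζ
    obtain ⟨h0, w, hw, hw1, hw2⟩ := hA ζ hζ
    rw [abs_le] at hw1 hw2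
    have h1 : w.2 ≤ G (ζ.1 + ε) :=
      le_csSup (hTbdd _) (mem_insert_of_mem _ ⟨w, hw, by linarith, rfl⟩)
    have h2 : G (ζ.1 - ε) ≤ w.2 := by
      refine csSup_le (hTne _) ?_
      rintro y (rfl | ⟨w', hw', hle, rfl⟩)
      · exact (hS w hw).1
      · exact hmono w' hw' w hw (by linarith)
    exact ⟨h0, by linarith, by linarith⟩
  have e : (fun r => (G (r + ε) + ε * h r) - (G (r - ε) - ε * h r)) =
      fun r => (G (r + ε) - G (r - ε)) + 2 * ε * h r := by
    funext r; ring
  refine (measure_mono hsub).trans ((volume_between_le (l := fun r => G (r - ε) - ε * h r)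
    (u := fun r => G (r + ε) + ε * h r) ?_ ?_ ?_ ?_).trans (ENNReal.ofReal_le_ofReal ?_))
  · exact (hG.measurable.comp (measurable_id.sub_const ε)).sub (hh.const_mul ε)
  · exact (hG.measurable.comp (measurable_id.add_const ε)).add (hh.const_mul ε)
  · rw [e]
    exact hi.add (hint.const_mul _)
  · intro r
    have h1 := hG (show r - ε ≤ r + ε by linarith)
    have h2 := mul_nonneg hε (hh0 r)
    linarith
  · rw [e, integral_add hi (hint.const_mul _), integral_const_mul]
    linarith

/-- Time reversal preserves the Lebesgue measure. -/
theorem volume_reflect (A : Set (ℝ × ℝ)) :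
    volume ((fun ζ : ℝ × ℝ => (ζ.1, Real.pi - ζ.2)) ⁻¹' A) = volume A := by
  have h : MeasurePreserving (fun ζ : ℝ × ℝ => (ζ.1, Real.pi - ζ.2)) volume volume := by
    rw [Measure.volume_eq_prod]
    exact (MeasurePreserving.id volume).prod (Measure.measurePreserving_sub_left volume Real.pi)
  let e : (ℝ × ℝ) ≃ᵐ (ℝ × ℝ) :=
    { toFun := fun ζ => (ζ.1, Real.pi - ζ.2)
      invFun := fun ζ => (ζ.1, Real.pi - ζ.2)
      left_inv := fun ζ => by simp
      right_inv := fun ζ => by simp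
      measurable_toFun := h.measurable
      measurable_invFun := h.measurable }
  exact h.measure_preimage_equiv (f := e) A

theorem invMeasure_le (A : Set (ℝ × ℝ)) : invMeasure A ≤ volume A := by
  have h : invMeasure ≤ (volume : Measure (ℝ × ℝ)) := by
    refine le_trans ?_ (Measure.restrict_le_self (s := phaseSpace))
    calc invMeasure ≤ (volume.restrict phaseSpace).withDensity 1 :=
          withDensity_mono (Eventually.of_forall fun ζ =>
            ENNReal.ofReal_le_one.2 (Real.sin_le_one _))
      _ = _ := withDensity_one
  exact h A

variable {f : ℝ → ℝ}

/-- The slope is integrable along the cusp. -/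
theorem IsProfile.exists_integrable_majorant (hf : IsProfile f)
    (hpos : ∀ x, 0 < x → 0 < deriv (deriv f) x) {C R : ℝ} (hC : 0 < C) (hR : 0 < R) :
    ∃ h : ℝ → ℝ, Measurable h ∧ (∀ r, 0 ≤ h r) ∧ IntegrableOn h (Ioi 0) ∧
      (∀ r, 0 < r → r < R → 1 ≤ h r) ∧ ∀ r, R ≤ r → C * wallSlope f r ≤ h r := by
  -- The height as a function of arc length decreases to `0` with derivative `-sin` of the wall
  -- angle, which is therefore integrable; `c` converts sine into slope beyond `R`.
  set g : ℝ → ℝ := fun r => f (abscissa f r)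
  set c := √(1 + wallSlope f R ^ 2)
  have hgd : ∀ r, 0 < r → deriv g r = -Real.sin (wallAngle f (abscissa f r)) := fun r hr =>
    (hf.hasDerivAt_height hpos hr).deriv
  have hsin : ∀ r, 0 < r → 0 < Real.sin (wallAngle f (abscissa f r)) := fun r hr =>
    Real.sin_pos_of_pos_of_lt_pi (wallAngle_pos (hf.deriv_neg hpos (hf.abscissa_pos hpos hr)))
      (by linarith [(wallAngle_mem (f := f) (abscissa f r)).2, Real.pi_pos])
  have hgi : IntegrableOn (fun r => |deriv g r|) (Ioi R) := by
    have : IntegrableOn (deriv g) (Ioi R) := by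
      refine integrableOn_Ioi_deriv_of_nonpos' (g := g) (l := 0) (fun r hr => ?_) (fun r hr => ?_)
        (hf.tendsto_zero.comp (hf.tendsto_abscissa hpos))
      · exact (hf.hasDerivAt_height hpos (hR.trans_le hr)).differentiableAt.hasDerivAt
      · rw [hgd r (hR.trans hr)]
        linarith [hsin r (hR.trans hr)]
    exact this.abs
  refine ⟨fun r => if r < R then 1 else C * c * |deriv g r|, ?_, ?_, ?_, ?_, ?_⟩
  · exact Measurable.ite measurableSet_Iio measurable_const
      ((measurable_deriv g).norm.const_mul (C * c))
  · intro r
    dsimp only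
    split_ifs
    · exact zero_le_one
    · positivity
  · rw [← Ioc_union_Ioi_eq_Ioi hR.le]
    refine IntegrableOn.union ?_ ?_
    · rw [integrableOn_Ioc_iff_integrableOn_Ioo]
      refine (integrableOn_const (C := (1 : ℝ)) (by simp)).congr_fun (fun r hr => ?_)
        measurableSet_Ioo
      simp only
      rw [if_pos hr.2]
    · have hci : IntegrableOn (fun r => C * c * |deriv g r|) (Ioi R) := hgi.const_mul (C * c)
      refine hci.congr_fun (fun r hr => ?_) measurableSet_Ioi
      have : ¬ r < R := not_lt.2 (le_of_lt hr)
      simp [this]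
  · intro r _ hr
    simp [hr]
  · intro r hr
    have hr0 := hR.trans_le hr
    have hnot : ¬ r < R := not_lt.2 hr
    simp only [hnot, if_false]
    rw [hgd r hr0, abs_neg, abs_of_pos (hsin r hr0), mul_assoc]
    refine mul_le_mul_of_nonneg_left ?_ hC.le
    have hη := hf.wallSlope_pos hpos hr0
    have hanti := hf.wallSlope_anti hpos hR hr
    rw [sin_wallAngle]
    change wallSlope f r ≤ c * (wallSlope f r * _)
    have hle : √(1 + deriv f (abscissa f r) ^ 2) ≤ c := by
      apply Real.sqrt_le_sqrt
      have : deriv f (abscissa f r) ^ 2 = wallSlope f r ^ 2 := by rw [wallSlope, neg_sq]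
      rw [this]
      nlinarith
    have hs := one_le_speed (f := f) (abscissa f r)
    have h1 : 1 ≤ c * (√(1 + deriv f (abscissa f r) ^ 2))⁻¹ := by
      rw [← div_eq_mul_inv, le_div_iff₀ (by linarith)]
      linarith
    nlinarith

theorem singPlus_snd_mem (i : Fin 3) {ζ : ℝ × ℝ} (hζ : ζ ∈ singPlus f i) :
    0 ≤ ζ.2 ∧ ζ.2 ≤ Real.pi := by
  fin_cases i
  · have h : ζ.2 = Real.pi := hζ.2
    rw [h]
    exact ⟨Real.pi_pos.le, le_rfl⟩
  · exact ⟨hζ.1.2.1.le, hζ.1.2.2.le⟩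
  · exact ⟨hζ.1.2.1.le, hζ.1.2.2.le⟩

/-- The infima in the unstable distance need not be attained, hence `2 * ε`. -/
theorem exists_curve_of_mem_unstableNhd {F : Set (ℝ × ℝ)} {ε : ℝ} (hε : 0 < ε) {ζ : ℝ × ℝ}
    (hζ : ζ ∈ unstableNhd f F ε) : ∃ w ∈ F, ∃ γ, IsUnstableCurve f ζ w γ ∧
      curveLength γ ≤ ENNReal.ofReal (2 * ε) := by
  have h : unstableInfDist f ζ F < ENNReal.ofReal (2 * ε) :=
    hζ.2.trans_lt ((ENNReal.ofReal_lt_ofReal_iff (by linarith)).2 (by linarith))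
  simp only [unstableInfDist, unstableDist, iInf_lt_iff] at h
  obtain ⟨w, hw, γ, hγ, hlt⟩ := h
  exact ⟨w, hw, γ, hγ, hlt.le⟩

/-- The unstable neighbourhoods of the singularity curves have a measure of the order of their
size. -/
theorem IsProfile.exists_volume_unstableNhd_le (hf : IsProfile f) (h₁ : A1 f) (h₂ : A2 f)
    (h₄ : A4 f) (i : Fin 3) (F : Set (ℝ × ℝ)) (hF : F = singPlus f i ∨ F = singMinus f i) :
    ∃ C > 0, ∃ ε₀ > 0, ∀ ε : ℝ, 0 < ε → ε ≤ ε₀ →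
      volume (unstableNhd f F ε) ≤ ENNReal.ofReal (C * ε) := by
  have hpos : ∀ x, 0 < x → 0 < deriv (deriv f) x := h₄.1
  obtain ⟨C, R, ε₀, hC, hR, hε₀, hbound⟩ := hf.exists_unstable_bound h₁ h₂ h₄
  obtain ⟨h, hmeas, hh0, hint, hsmall, hlarge⟩ := hf.exists_integrable_majorant hpos hC hR
  have hI : 0 ≤ ∫ r in Ioi (0 : ℝ), h r := integral_nonneg hh0
  refine ⟨2 * (Real.pi + ∫ r in Ioi (0 : ℝ), h r) * 2, by positivity, ε₀ / 2, by positivity, ?_⟩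
  intro ε hε hεε₀
  have hnear : ∀ ζ ∈ unstableNhd f F ε, 0 < ζ.1 ∧ ∃ w ∈ F, |ζ.1 - w.1| ≤ 2 * ε ∧
      |ζ.2 - w.2| ≤ 2 * ε * h ζ.1 := by
    intro ζ hζ
    have hζ0 : 0 < ζ.1 := hζ.1.1
    obtain ⟨w, hw, γ, hγ, hlen⟩ := exists_curve_of_mem_unstableNhd hε hζ
    have hd1 := abs_sub_le_of_eVariationOn_le (g := fun t => (γ t).1) (s := 0) (t := 1)
      (by linarith) ((eVariationOn_fst_le γ).trans hlen) (by simp) (by simp)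
    have hd2 := abs_sub_le_of_eVariationOn_le (g := fun t => (γ t).2) (s := 0) (t := 1)
      (by linarith) ((eVariationOn_snd_le γ).trans hlen) (by simp) (by simp)
    simp only [hγ.source, hγ.target] at hd1 hd2
    refine ⟨hζ0, w, hw, hd1, ?_⟩
    rcases lt_or_ge ζ.1 R with hr | hr
    · have := hsmall ζ.1 hζ0 hr
      nlinarith
    · refine (hbound i F hF ζ w γ (2 * ε) (by linarith) (by linarith) hr hw hγ hlen).trans ?_
      exact mul_le_mul_of_nonneg_left (hlarge ζ.1 hr) (by linarith)
  have hfin : 2 * (Real.pi + ∫ r in Ioi (0 : ℝ), h r) * 2 * ε =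
      2 * (Real.pi + ∫ r in Ioi (0 : ℝ), h r) * (2 * ε) := by ring
  rw [hfin]
  rcases hF with rfl | rfl
  · exact volume_le_of_monotone_graph Real.pi_pos.le (by linarith)
      (fun w hw => singPlus_snd_mem i hw)
      (fun w hw w' hw' => hf.singPlus_mono hpos i hw hw') hmeas hh0 hint hnear
  -- `F^{i-}` is a decreasing graph; time reversal makes it the increasing graph `F^{i+}` and does
  -- not affect the estimate, as `h` depends on `r` only.
  · rw [← volume_reflect]
    refine volume_le_of_monotone_graph (S := singPlus f i) Real.pi_pos.le (by linarith)
      (fun w hw => singPlus_snd_mem i hw)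
      (fun w hw w' hw' => hf.singPlus_mono hpos i hw hw') hmeas hh0 hint ?_
    intro ζ hζ
    obtain ⟨h0, w, hw, hw1, hw2⟩ := hnear _ hζ
    refine ⟨h0, (w.1, Real.pi - w.2), hw, hw1, ?_⟩
    simp only at hw2 ⊢
    rwa [show ζ.2 - (Real.pi - w.2) = -(Real.pi - ζ.2 - w.2) by ring, abs_neg]

end Neighbourhoods

/-! ### Infinite length of the singularity curves -/

section InfiniteLength

variable {f : ℝ → ℝ}

/-- The projection to the first coordinate does not increase Hausdorff measure, and its image
contains a half-line. -/
theorem hausdorffMeasure_eq_top {F : Set (ℝ × ℝ)} {R : ℝ}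
    (h : ∀ r, R < r → ∃ ζ ∈ F, ζ.1 = r) :
    Measure.hausdorffMeasure 1 (WithLp.toLp 2 '' F : Set (WithLp 2 (ℝ × ℝ))) = ⊤ := by
  have h1 := lipschitzWith_withLp_fst.hausdorffMeasure_image_le zero_le_one (WithLp.toLp 2 '' F)
  have h2 : Ioi R ⊆ (fun p : WithLp 2 (ℝ × ℝ) => p.fst) '' (WithLp.toLp 2 '' F) := by
    intro r hr
    obtain ⟨ζ, hζ, rfl⟩ := h r hr
    exact ⟨_, ⟨ζ, hζ, rfl⟩, rfl⟩
  have h3 := measure_mono (μ := Measure.hausdorffMeasure 1) h2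
  rw [hausdorffMeasure_real, Real.volume_Ioi] at h3
  rw [hausdorffMeasure_real] at h1
  have h4 := h3.trans h1
  simpa using h4

/-- The line element at abscissa `x` that moves to the left and down with slope `m`. -/
theorem velocity_of_slope {r m : ℝ} :
    velocity f (r, Real.pi - Real.arctan m - wallAngle f (abscissa f r)) =
      (-Real.cos (Real.arctan m), -(m * Real.cos (Real.arctan m))) := by
  have hsm : Real.sin (Real.arctan m) = m * Real.cos (Real.arctan m) := by
    rw [Real.sin_arctan, Real.cos_arctan]; ring
  rw [velocity_eq]
  simp only [sub_add_cancel]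
  rw [Real.cos_pi_sub, Real.sin_pi_sub, hsm]

theorem IsProfile.slope_mem_phaseSpace (hf : IsProfile f)
    (hpos : ∀ x, 0 < x → 0 < deriv (deriv f) x) {r m : ℝ} (hr : 0 < r) (hm : 0 < m) :
    (r, Real.pi - Real.arctan m - wallAngle f (abscissa f r)) ∈ phaseSpace := by
  have ha := wallAngle_pos (hf.deriv_neg hpos (hf.abscissa_pos hpos hr))
  have ha' := (wallAngle_mem (f := f) (abscissa f r)).2
  have hb := Real.arctan_pos.2 hm
  have hb' := Real.arctan_lt_pi_div_two m
  exact ⟨hr, ⟨by linarith, by linarith⟩⟩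

/-- The motion is parametrised by horizontal distance instead of time, which clears the cosines from
the conditions to be checked. -/
theorem collisionPoint_of_slope {r m d : ℝ} (hd : 0 < d)
    (hb : |f (abscissa f r) - m * d| = f |abscissa f r - d|)
    (h : ∀ p, 0 < p → p < d → |f (abscissa f r) - m * p| < f |abscissa f r - p|) :
    collisionPoint f (r, Real.pi - Real.arctan m - wallAngle f (abscissa f r)) =
      (abscissa f r - d, f (abscissa f r) - m * d) := by
  set ζ : ℝ × ℝ := (r, Real.pi - Real.arctan m - wallAngle f (abscissa f r)) with hζ
  have hc := Real.cos_arctan_pos m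
  have hv : velocity f ζ = _ := velocity_of_slope
  have hray : ∀ t, ray f ζ t = (abscissa f r - t * Real.cos (Real.arctan m),
      f (abscissa f r) - m * (t * Real.cos (Real.arctan m))) := by
    intro t
    ext
    · rw [ray_fst, hv]; simp only [hζ]; ring
    · rw [ray_snd, hv]; simp only [hζ]; ring
  have hτ : flightTime f ζ = d / Real.cos (Real.arctan m) := by
    refine flightTime_eq (by positivity) ?_ fun t ht htd => ?_
    · rw [hray, div_mul_cancel₀ _ hc.ne']
      exact hb
    · rw [hray]
      exact h _ (by positivity) ((lt_div_iff₀ hc).1 htd)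
  rw [collisionPoint, hτ, hray, div_mul_cancel₀ _ hc.ne']

/-- Intermediate values for `f s - f' s (x + s)`. It exceeds `f x` at `s = x`. At `s = 2y` convexity
gives `|f' (2y)| y ≤ f y`, so with `x ≤ y` the value is at most `4 f y < f x`. -/
theorem IsProfile.exists_left_tangency (hf : IsProfile f)
    (hpos : ∀ x, 0 < x → 0 < deriv (deriv f) x) {x : ℝ} (hx : 0 < x) :
    ∃ s, x < s ∧ f x = f s + -deriv f s * (x + s) := by
  have hfx := hf.pos x hx.le
  obtain ⟨y, hy⟩ := eventually_atTop.1
    ((hf.tendsto_zero.eventually_lt_const (show 0 < f x / 5 by linarith)).and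
      (eventually_ge_atTop x))
  obtain ⟨hy1, hy2⟩ := hy y le_rfl
  have hy0 : 0 < y := by linarith
  have hcont : ContinuousOn (fun s => f s + -deriv f s * (x + s)) (Icc x (2 * y)) := by
    intro s hs
    have hs0 : 0 < s := hx.trans_le hs.1
    exact ((hf.hasDerivAt hs0).continuousAt.add ((hf.hasDerivAt_deriv hs0).continuousAt.neg.mul
      (continuousAt_const.add continuousAt_id))).continuousWithinAt
  have hend : f (2 * y) + -deriv f (2 * y) * (x + 2 * y) ≤ f x := by
    have h1 := hf.tangent_le (show 0 < 2 * y by linarith) hy0.le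
    have h2 : f (2 * y) ≤ f y := (hf.strictAntiOn hpos).antitoneOn (mem_Ici.2 hy0.le)
      (mem_Ici.2 (by linarith)) (by linarith)
    have h3 := hf.deriv_neg hpos (show 0 < 2 * y by linarith)
    have h4 := hf.pos (2 * y) (by linarith)
    nlinarith
  have hd := hf.deriv_neg hpos hx
  have hstart : f x < f x + -deriv f x * (x + x) := by nlinarith
  obtain ⟨s, hs, hse⟩ := intermediate_value_Icc' (by linarith) hcont ⟨hend, hstart.le⟩
  refine ⟨s, lt_of_le_of_ne hs.1 ?_, hse.symm⟩
  rintro rfl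
  simp only at hse
  linarith

/-- Intermediate values on `[1, x]`: the threshold for `x` ensures `|f' 1| (x - 1) ≥ 2 f 1 ≥ f 1 + f
x`, while at `s = x` the lever arm vanishes. -/
theorem IsProfile.exists_right_tangency (hf : IsProfile f)
    (hpos : ∀ x, 0 < x → 0 < deriv (deriv f) x) :
    ∃ X : ℝ, ∀ x, X ≤ x → ∃ s, 0 < s ∧ s < x ∧ f x + f s = -deriv f s * (x - s) := by
  have hd := hf.deriv_neg hpos one_pos
  refine ⟨2 + 2 * f 1 / -deriv f 1, fun x hx => ?_⟩
  have hf1 := hf.pos 1 zero_le_one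
  have hq : 0 < 2 * f 1 / -deriv f 1 := div_pos (by linarith) (by linarith)
  have hx1 : 1 < x := by linarith
  have hfx := hf.pos x (by linarith)
  have hfx1 : f x ≤ f 1 := (hf.strictAntiOn hpos).antitoneOn (mem_Ici.2 zero_le_one)
    (mem_Ici.2 (by linarith)) hx1.le
  have hcont : ContinuousOn (fun s => -deriv f s * (x - s) - f s - f x) (Icc 1 x) := by
    intro s hs
    have hs0 : 0 < s := one_pos.trans_le hs.1
    exact ((((hf.hasDerivAt_deriv hs0).continuousAt.neg.mul
      (continuousAt_const.sub continuousAt_id)).sub (hf.hasDerivAt hs0).continuousAt).sub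
      continuousAt_const).continuousWithinAt
  have hstart : 0 ≤ -deriv f 1 * (x - 1) - f 1 - f x := by
    have h1 : 2 * f 1 ≤ (x - 1) * -deriv f 1 := by
      rw [← div_le_iff₀ (by linarith)]; linarith
    linarith
  have hend : -deriv f x * (x - x) - f x - f x ≤ 0 := by
    rw [sub_self, mul_zero]; linarith
  obtain ⟨s, hs, hse⟩ := intermediate_value_Icc' hx1.le hcont ⟨hend, hstart⟩
  simp only at hse
  refine ⟨s, by linarith [hs.1], lt_of_le_of_ne hs.2 ?_, by linarith⟩
  rintro rfl
  rw [sub_self, mul_zero] at hse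
  linarith

theorem abs_tangentialSpeed_of_slope {r s : ℝ} (q : ℝ × ℝ)
    (hq : q = (-1, 1) ∨ q = (1, -1))
    (hquad : quadrant f (r, Real.pi - Real.arctan (-deriv f s) - wallAngle f (abscissa f r)) = q)
    (habs : |(collisionPoint f
      (r, Real.pi - Real.arctan (-deriv f s) - wallAngle f (abscissa f r))).1| = s) :
    |tangentialSpeed f
      (r, Real.pi - Real.arctan (-deriv f s) - wallAngle f (abscissa f r))| = 1 := by
  rw [tangentialSpeed_eq, hquad, habs]
  simp only [sub_add_cancel]
  rw [Real.cos_pi_sub, Real.sin_pi_sub, Real.arctan_neg, ← wallAngle]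
  have h := Real.sin_sq_add_cos_sq (wallAngle f s)
  rcases hq with rfl | rfl
  · rw [show (-1 : ℝ) * -Real.cos (wallAngle f s) * Real.cos (wallAngle f s) +
      1 * Real.sin (wallAngle f s) * Real.sin (wallAngle f s) = 1 by linarith, abs_one]
  · rw [show (1 : ℝ) * -Real.cos (wallAngle f s) * Real.cos (wallAngle f s) +
      -1 * Real.sin (wallAngle f s) * Real.sin (wallAngle f s) = -1 by linarith, abs_neg, abs_one]

theorem IsProfile.exists_mem_singPlus_one (hf : IsProfile f)
    (hpos : ∀ x, 0 < x → 0 < deriv (deriv f) x) {r : ℝ} (hr : 0 < r) :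
    ∃ ζ ∈ singPlus f 1, ζ.1 = r := by
  have hx := hf.abscissa_pos hpos hr
  set x := abscissa f r with hxdef
  obtain ⟨s, hxs, he⟩ := hf.exists_left_tangency hpos hx
  have hs : 0 < s := hx.trans hxs
  have hm := hf.deriv_neg hpos hs
  have hfs := hf.pos s hs.le
  have hcoll := collisionPoint_of_slope (f := f) (r := r) (m := -deriv f s) (d := x + s)
    (by linarith) ?_ ?_
  · have h1 : (collisionPoint f
        (r, Real.pi - Real.arctan (-deriv f s) - wallAngle f (abscissa f r))).1 = -s := by
      rw [hcoll]; simp only; ring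
    have h2 : (collisionPoint f
        (r, Real.pi - Real.arctan (-deriv f s) - wallAngle f (abscissa f r))).2 = f s := by
      rw [hcoll]; simp only; linarith
    refine ⟨_, ⟨hf.slope_mem_phaseSpace hpos hr (m := -deriv f s) (by linarith), ?_, ?_, ?_⟩, rfl⟩
    · rw [h1]; linarith
    · rw [h2]; exact hfs
    · refine abs_tangentialSpeed_of_slope (-1, 1) (Or.inl rfl) ?_ ?_
      · rw [quadrant, h1, h2, Real.sign_of_neg (by linarith), Real.sign_of_pos hfs]
      · rw [h1, abs_neg, abs_of_pos hs]
  · rw [← hxdef, show f x - -deriv f s * (x + s) = f s by linarith,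
      show x - (x + s) = -s by ring, abs_neg, abs_of_pos hs, abs_of_pos hfs]
  -- No earlier collision: until the vertical axis the ray descends while the wall above it rises;
  -- beyond the axis the ray lies on a tangent of the strictly convex mirrored wall.
  · intro p hp hpd
    rw [← hxdef, abs_of_pos (by nlinarith)]
    rcases le_or_gt 0 (x - p) with h | h
    · rw [abs_of_nonneg h]
      have : f x < f (x - p) := hf.strictAntiOn hpos (mem_Ici.2 h) (mem_Ici.2 hx.le) (by linarith)
      nlinarith
    · rw [abs_of_neg h]
      have := hf.tangent_lt hpos hs (y := -(x - p)) (by linarith) (by linarith)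
      linarith

theorem IsProfile.exists_mem_singPlus_two (hf : IsProfile f)
    (hpos : ∀ x, 0 < x → 0 < deriv (deriv f) x) :
    ∃ R : ℝ, ∀ r, R < r → ∃ ζ ∈ singPlus f 2, ζ.1 = r := by
  obtain ⟨X, hX⟩ := hf.exists_right_tangency hpos
  refine ⟨arcLength f |X|, fun r hr => ?_⟩
  have hr0 : 0 < r := (hf.arcLength_nonneg hpos (abs_nonneg X)).trans_lt hr
  have hx := hf.abscissa_pos hpos hr0
  have hxX : X ≤ abscissa f r :=
    (le_abs_self X).trans (hf.le_abscissa hpos (abs_nonneg X) hr.le)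
  set x := abscissa f r with hxdef
  obtain ⟨s, hs, hsx, he⟩ := hX x hxX
  have hm := hf.deriv_neg hpos hs
  have hfs := hf.pos s hs.le
  have hcoll := collisionPoint_of_slope (f := f) (r := r) (m := -deriv f s) (d := x - s)
    (by linarith) ?_ ?_
  · have h1 : (collisionPoint f
        (r, Real.pi - Real.arctan (-deriv f s) - wallAngle f (abscissa f r))).1 = s := by
      rw [hcoll]; simp only; ring
    have h2 : (collisionPoint f
        (r, Real.pi - Real.arctan (-deriv f s) - wallAngle f (abscissa f r))).2 = -f s := by
      rw [hcoll]; simp only; linarith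
    refine ⟨_, ⟨hf.slope_mem_phaseSpace hpos hr0 (m := -deriv f s) (by linarith), ?_,
      Or.inr ⟨?_, ?_⟩⟩, rfl⟩
    · rw [h2]; linarith
    · rw [h1]; exact hs
    · refine abs_tangentialSpeed_of_slope (1, -1) (Or.inr rfl) ?_ ?_
      · rw [quadrant, h1, h2, Real.sign_of_pos hs, Real.sign_of_neg (by linarith)]
      · rw [h1, abs_of_pos hs]
  · rw [← hxdef, show f x - -deriv f s * (x - s) = -f s by linarith,
      show x - (x - s) = s by ring, abs_neg, abs_of_pos hs, abs_of_pos hfs]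
  -- The lower wall is avoided by strict convexity at the tangency, the upper one because the ray
  -- descends while `f` increases to the left.
  · intro p hp hpd
    rw [← hxdef, abs_of_pos (show 0 < x - p by linarith), abs_lt]
    have h1 : f x < f (x - p) :=
      hf.strictAntiOn hpos (mem_Ici.2 (by linarith)) (mem_Ici.2 hx.le) (by linarith)
    have h2 := hf.tangent_lt hpos hs (y := x - p) (by linarith) (by linarith)
    constructor
    · linarith
    · nlinarith

theorem IsProfile.exists_mem_singPlus (hf : IsProfile f)
    (hpos : ∀ x, 0 < x → 0 < deriv (deriv f) x) (i : Fin 3) :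
    ∃ R : ℝ, ∀ r, R < r → ∃ ζ ∈ singPlus f i, ζ.1 = r := by
  fin_cases i
  · exact ⟨0, fun r hr => ⟨(r, Real.pi), ⟨le_of_lt hr, rfl⟩, rfl⟩⟩
  · exact ⟨0, fun r hr => hf.exists_mem_singPlus_one hpos hr⟩
  · exact hf.exists_mem_singPlus_two hpos

theorem IsProfile.hausdorffMeasure_singularity_eq_top (hf : IsProfile f)
    (hpos : ∀ x, 0 < x → 0 < deriv (deriv f) x) (i : Fin 3) (F : Set (ℝ × ℝ))
    (hF : F = singPlus f i ∨ F = singMinus f i) :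
    Measure.hausdorffMeasure 1 (WithLp.toLp 2 '' F : Set (WithLp 2 (ℝ × ℝ))) = ⊤ := by
  obtain ⟨R, hR⟩ := hf.exists_mem_singPlus hpos i
  refine hausdorffMeasure_eq_top (R := R) fun r hr => ?_
  obtain ⟨ζ, hζ, rfl⟩ := hR r hr
  rcases hF with rfl | rfl
  · exact ⟨ζ, hζ, rfl⟩
  · refine ⟨(ζ.1, Real.pi - ζ.2), ?_, rfl⟩
    change (ζ.1, Real.pi - (Real.pi - ζ.2)) ∈ singPlus f i
    rwa [sub_sub_cancel]

end InfiniteLength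

end CuspBilliard

open CuspBilliard in
theorem mainTheorem5 (f : ℝ → ℝ) (hf : IsProfile f)
    (h₁ : A1 f) (h₂ : A2 f) (h₃ : A3 f) (h₄ : A4 f)
    (i : Fin 3) (F : Set (ℝ × ℝ)) (hF : F = singPlus f i ∨ F = singMinus f i) :
    (∃ C > 0, ∃ ε₀ > 0, ∀ ε : ℝ, 0 < ε → ε ≤ ε₀ →
      invMeasure (unstableNhd f F ε) ≤ volume (unstableNhd f F ε) ∧
      volume (unstableNhd f F ε) ≤ ENNReal.ofReal (C * ε)) ∧
    -- the curve has infinite (Euclidean) length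
    Measure.hausdorffMeasure 1 (WithLp.toLp 2 '' F : Set (WithLp 2 (ℝ × ℝ))) = ⊤ := by
  refine ⟨?_, hf.hausdorffMeasure_singularity_eq_top h₄.1 i F hF⟩
  obtain ⟨C, hC, ε₀, hε₀, h⟩ := hf.exists_volume_unstableNhd_le h₁ h₂ h₄ i F hF
  exact ⟨C, hC, ε₀, hε₀, fun ε hε hεε₀ => ⟨invMeasure_le _, h ε hε hεε₀⟩⟩
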